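/- Let $0<M<\tfrac{2}{3\sqrt3}$ (sub-extremal case), $D(r)=1-\tfrac Mr-r^2$, let $r_c$ be the largest positive zero of $D$, and consider the cosmological region $r>r_c$ of the Schwarzschild--de Sitter metric, normalised so that $\lambda=3$, $$\tilde g=-D(r)\,dt^2+D(r)^{-1}dr^2+r^2\sigma ,$$ with $\sigma$ the round metric of $\mathbb S^2$. Fix $r_\star>r_c$ and $t_\bullet>0$, and put $\Theta(\tau)=1-\tfrac14\tau^2$. A conformal geodesic of $\tilde g$ is a pair $(x(\tau),\beta(\tau))$ with $$\tilde\nabla_{\dot x}\dot x=-2\langle\beta,\dot x\rangle\dot x+\tilde g(\dot x,\dot x)\beta^\sharp,\qquad \tilde\nabla_{\dot x}\beta=\langle\beta,\dot x\rangle\beta-\tfrac12\tilde g^\sharp(\beta,\beta)\dot x^\flat+\tilde L(\dot x,\cdot),$$ where $\tilde L$ is the Schouten tensor of $\tilde g$, and a vector $v$ is Weyl propagated along it if $\tilde\nabla_{\dot x}v=-\langle\beta,v\rangle\dot x-\langle\beta,\dot x\rangle v+\tilde g(v,\dot x)\beta^\sharp$. Then there are $\delta>0$ and a congruence of conformal geodesics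 with $\tau\in(-\delta,2)$, staying in $r>r_c$, one from each point $(t_\star,p)$ of $\{r=r_\star\}$ with $|t_\star|<t_\bullet+\delta$, $p\in\mathbb S^2$, with $\dot x=\sqrt{|D(r_\star)|}\,\partial_r$ (the future unit normal) and $\beta=0$ at $\tau=0$, and with $r\to\infty$ as $\tau\to2$. In the coordinates $(\tau,t_\star,p)$ the metric $g=\Theta^2\tilde g$ and the covector $f=\beta-\Theta^{-1}d\Theta$ extend smoothly from $\{\tau<2\}$ to $\mathcal N=(-\delta,2+\delta)\times(-t_\bullet-\delta,t_\bullet+\delta)\times\mathbb S^2$, a neighbourhood of $\mathcal M_\bullet\times\mathbb S^2$, where $\mathcal M_\bullet=[0,2]\times[-t_\bullet,t_\bullet]$; the conformal boundary is $\{\tau=2\}$, where $\Theta=0$. Moreover the Weyl tensor of $g$ is $C^c{}_{dab}=\Theta\,d^c{}_{dab}$ with $d^c{}_{dab}$ (the rescaled Weyl tensor) smooth on $\mathcal N$. Let $k_2,k_3$ be a smooth $\sigma$-orthonormal frame on an open set $U$ of a stereographic chart of $\mathbb S^2$ (projection from either pole), and choose a sign $\pm$. Then, over $U$, there is a smooth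 $g$-orthonormal frame $\{e_a\}$ on $\mathcal N$ with $e_0=\partial_\tau$ which for $\tau<2$ is Weyl propagated along the congruence and at $\tau=0$ satisfies $e_1=\pm|D(r_\star)|^{-1/2}\partial_t$, $e_2=r_\star^{-1}k_2$, $e_3=r_\star^{-1}k_3$. Let $\hat\nabla$ be the Weyl connection $\nabla+\mathbf S(f)$ (torsion-free, $\hat\nabla_ag_{bc}=-2f_ag_{bc}$; for $\tau<2$ it is $\tilde\nabla+\mathbf S(\beta)$), where $\nabla$ is the Levi-Civita connection of $g$ and $S_{ab}{}^{cd}=\delta_a{}^c\delta_b{}^d+\delta_a{}^d\delta_b{}^c-g_{ab}g^{cd}$. With respect to $\{e_a\}$, the connection coefficients $\hat\Gamma_a{}^b{}_c$ of $\hat\nabla$, the components of the rescaled Weyl tensor $d^a{}_{bcd}$, and the components of the Schouten tensor $\hat L_{ab}$ of $\hat\nabla$ are smooth on $\mathcal N$ over $U$, hence on $\mathcal M_\bullet$ including, and beyond, the conformal boundary. They solve there the extended conformal Einstein field equations $$[e_a,e_b]=(\hat\Gamma_a{}^c{}_b-\hat\Gamma_b{}^c{}_a)e_c,\qquad \hat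 R^c{}_{dab}=\Theta d^c{}_{dab}+2S_{d[a}{}^{ce}\hat L_{b]e},$$ $$\hat\nabla_c\hat L_{db}-\hat\nabla_d\hat L_{cb}=d_a\,d^a{}_{bcd},\qquad \hat\nabla_ad^a{}_{bcd}=f_a\,d^a{}_{bcd},$$ where $\hat R^c{}_{dab}$ is the curvature computed from $e_a$ and $\hat\Gamma_a{}^b{}_c$, $f_a=\tfrac14\hat\Gamma_a{}^b{}_b$, and $d_a=\Theta f_a+\nabla_a\Theta$. -/

import Mathlib

open Set Filter Topology
open scoped ContDiff

noncomputable section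

namespace ConformalSdS

/-! ### Coordinate differential geometry in dimension four

Index conventions: `christoffel g x a b c` is `Γ_a^b_c`, so that
`∇_a v^b = ∂_a v^b + Γ_a^b_c v^c`; `curvature Γ x c d a b` is `R^c_{dab}`, where
`(∇_a ∇_b - ∇_b ∇_a) v^c = R^c_{dab} v^d` for a torsion-free connection. -/

/-- Coordinate space. -/
abbrev Pt : Type := Fin 4 → ℝ

/-- A field of `4 × 4` matrices (components of a covariant 2-tensor field). -/
abbrev Field2 : Type := Pt → Matrix (Fin 4) (Fin 4) ℝ

/-- Connection coefficients. -/
abbrev Field3 : Type := Pt → Fin 4 → Fin 4 → Fin 4 → ℝ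

/-- Components of a 4-index tensor field. -/
abbrev Field4 : Type := Pt → Fin 4 → Fin 4 → Fin 4 → Fin 4 → ℝ

/-- Partial derivative in the `i`-th coordinate direction. -/
def pd (i : Fin 4) (F : Pt → ℝ) (x : Pt) : ℝ := fderiv ℝ F x (Pi.single i 1)

/-- Kronecker delta. -/
def kron (a b : Fin 4) : ℝ := if a = b then 1 else 0

/-- Christoffel symbols `Γ_a^b_c` of the Levi-Civita connection of `g`. -/
def christoffel (g : Field2) : Field3 := fun x a b c =>
  (1 / 2) * ∑ e, (g x)⁻¹ b e *
    (pd a (fun y => g y e c) x + pd c (fun y => g y e a) x - pd e (fun y => g y a c) x)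

/-- The tensor `S_{ac}^{bd} = δ_a^b δ_c^d + δ_a^d δ_c^b - h_{ac} h^{bd}` of a metric `h`. -/
def shift (h : Matrix (Fin 4) (Fin 4) ℝ) (a c b d : Fin 4) : ℝ :=
  kron a b * kron c d + kron a d * kron c b - h a c * h⁻¹ b d

/-- The Weyl connection `∇ + S(f)`, where `∇` is the Levi-Civita connection of `g` and `f` is
a covector field; it is torsion-free and satisfies `∇̂_a g_{bc} = -2 f_a g_{bc}`. -/
def weylConnection (g : Field2) (f : Pt → Pt) : Field3 := fun x a b c =>
  christoffel g x a b c + ∑ e, shift (g x) a c b e * f x e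

/-- Curvature tensor `R^c_{dab}` of a torsion-free connection given by its coefficients in a
coordinate basis. -/
def curvature (Γ : Field3) : Field4 := fun x c d a b =>
  pd a (fun y => Γ y b c d) x - pd b (fun y => Γ y a c d) x
    + ∑ e, (Γ x a c e * Γ x b e d - Γ x b c e * Γ x a e d)

/-- Ricci tensor `R_{db} = R^c_{dcb}` of a torsion-free connection. -/
def ricci (Γ : Field3) : Field2 := fun x d b => ∑ c, curvature Γ x c d c b

/-- Schouten tensor `L_{ab} = ½ (R_{(ab)} - ½ R_{[ab]} - ⅙ R g_{ab})` of a Weyl connection for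
the conformal class of `g`; for the Levi-Civita connection of `g` the Ricci tensor is symmetric
and this is `½ (R_{ab} - ⅙ R g_{ab})`. -/
def schouten (g : Field2) (Γ : Field3) : Field2 := fun x a b =>
  (1 / 2) * ((1 / 2) * (ricci Γ x a b + ricci Γ x b a)
      - (1 / 2) * ((1 / 2) * (ricci Γ x a b - ricci Γ x b a))
      - (1 / 6) * (∑ c, ∑ d, (g x)⁻¹ c d * ricci Γ x c d) * g x a b)

/-- Weyl tensor `C^c_{dab} = R^c_{dab} - 2 S_{d[a}^{ce} L_{b]e}` of the metric `g`. -/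
def weylTensor (g : Field2) : Field4 := fun x c d a b =>
  curvature (christoffel g) x c d a b
    - ∑ e, (shift (g x) d a c e * schouten g (christoffel g) x b e
          - shift (g x) d b c e * schouten g (christoffel g) x a e)

/-! ### Curves, conformal geodesics and Weyl propagation -/

/-- `∇_ẋ v` for a vector field `v` along the curve `x`. -/
def covDerivVec (g : Field2) (x v : ℝ → Pt) (τ : ℝ) : Pt := fun b =>
  deriv v τ b + ∑ a, ∑ c, christoffel g (x τ) a b c * deriv x τ a * v τ c

/-- `∇_ẋ β` for a covector field `β` along the curve `x`. -/
def covDerivCov (g : Field2) (x β : ℝ → Pt) (τ : ℝ) : Pt := fun b =>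
  deriv β τ b - ∑ a, ∑ c, christoffel g (x τ) a c b * deriv x τ a * β τ c

/-- The value `⟨β, v⟩`. -/
def pairing (β v : Pt) : ℝ := ∑ a, β a * v a

/-- The value `h(v, w)`. -/
def bil (h : Matrix (Fin 4) (Fin 4) ℝ) (v w : Pt) : ℝ := ∑ a, ∑ b, h a b * v a * w b

/-- The vector `β^♯`. -/
def sharp (h : Matrix (Fin 4) (Fin 4) ℝ) (β : Pt) : Pt := fun a => ∑ b, h⁻¹ a b * β b

/-- The covector `v^♭`. -/
def flat (h : Matrix (Fin 4) (Fin 4) ℝ) (v : Pt) : Pt := fun a => ∑ b, h a b * v b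

/-- `(x, β)` is a conformal geodesic of the metric `g` over the parameter set `I`:
`∇_ẋ ẋ = -2 ⟨β, ẋ⟩ ẋ + g(ẋ, ẋ) β^♯` and
`∇_ẋ β = ⟨β, ẋ⟩ β - ½ g^♯(β, β) ẋ^♭ + L(ẋ, ·)`. -/
structure IsConformalGeodesicOn (g : Field2) (I : Set ℝ) (x β : ℝ → Pt) : Prop where
  diff_x : ∀ τ ∈ I, DifferentiableAt ℝ x τ
  diff_dx : ∀ τ ∈ I, DifferentiableAt ℝ (deriv x) τ
  diff_β : ∀ τ ∈ I, DifferentiableAt ℝ β τ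
  eqn_x : ∀ τ ∈ I, covDerivVec g x (deriv x) τ =
    -(2 * pairing (β τ) (deriv x τ)) • deriv x τ
      + bil (g (x τ)) (deriv x τ) (deriv x τ) • sharp (g (x τ)) (β τ)
  eqn_β : ∀ τ ∈ I, covDerivCov g x β τ =
    pairing (β τ) (deriv x τ) • β τ
      - ((1 / 2) * pairing (β τ) (sharp (g (x τ)) (β τ))) • flat (g (x τ)) (deriv x τ)
      + fun b => ∑ a, schouten g (christoffel g) (x τ) a b * deriv x τ a

/-- The vector field `v` along `x` is Weyl propagated along `(x, β)` over `I`: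
`∇_ẋ v = -⟨β, v⟩ ẋ - ⟨β, ẋ⟩ v + g(v, ẋ) β^♯`. -/
structure IsWeylPropagatedOn (g : Field2) (I : Set ℝ) (x β v : ℝ → Pt) : Prop where
  diff_v : ∀ τ ∈ I, DifferentiableAt ℝ v τ
  eqn_v : ∀ τ ∈ I, covDerivVec g x v τ =
    -(pairing (β τ) (v τ)) • deriv x τ - pairing (β τ) (deriv x τ) • v τ
      + bil (g (x τ)) (v τ) (deriv x τ) • sharp (g (x τ)) (β τ)

/-! ### Change of coordinates -/

/-- Jacobian matrix `∂Ψ^i/∂x^μ`. -/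
def jac (Ψ : Pt → Pt) (p : Pt) : Matrix (Fin 4) (Fin 4) ℝ :=
  fun i μ => pd μ (fun q => Ψ q i) p

/-- Pull-back of a metric by `Ψ`. -/
def pullMetric (Ψ : Pt → Pt) (g : Field2) : Field2 := fun p =>
  (jac Ψ p).transpose * g (Ψ p) * jac Ψ p

/-- Push-forward by `Ψ` of a vector at `p`. -/
def push (Ψ : Pt → Pt) (p : Pt) (v : Pt) : Pt := (jac Ψ p).mulVec v

/-! ### The round sphere

The sphere is covered by the two stereographic charts `stereo 1` and `stereo (-1)`; in each of
them the round metric is `4 (du² + dv²) / (1 + u² + v²)²`. -/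

/-- Inverse stereographic projections of the unit sphere (`ε = ±1`). -/
def stereo (ε u v : ℝ) : Fin 3 → ℝ :=
  ![2 * u / (1 + u ^ 2 + v ^ 2), 2 * v / (1 + u ^ 2 + v ^ 2),
    ε * (u ^ 2 + v ^ 2 - 1) / (1 + u ^ 2 + v ^ 2)]

theorem stereo_unit (ε u v : ℝ) (hε : ε ^ 2 = 1) : ∑ i, stereo ε u v i ^ 2 = 1 := by
  have h : (1 + u ^ 2 + v ^ 2) ≠ 0 := by positivity
  simp only [stereo, Fin.sum_univ_three, Matrix.cons_val]
  field_simp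
  rw [hε]
  ring

/-- The two stereographic charts cover the sphere. -/
theorem stereo_cover (x : Fin 3 → ℝ) (hx : ∑ i, x i ^ 2 = 1) :
    ∃ ε u v : ℝ, (ε = 1 ∨ ε = -1) ∧ stereo ε u v = x := by
  simp only [Fin.sum_univ_three] at hx
  have key : ∀ ε : ℝ, ε ^ 2 = 1 → 1 - ε * x 2 ≠ 0 →
      stereo ε (x 0 / (1 - ε * x 2)) (x 1 / (1 - ε * x 2)) = x := by
    intro ε hε h
    have e1 : 1 + (x 0 / (1 - ε * x 2)) ^ 2 + (x 1 / (1 - ε * x 2)) ^ 2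
        = 2 / (1 - ε * x 2) := by
      field_simp
      linear_combination hx + (x 2) ^ 2 * hε
    have e2 : (x 0 / (1 - ε * x 2)) ^ 2 + (x 1 / (1 - ε * x 2)) ^ 2 - 1
        = 2 / (1 - ε * x 2) - 2 := by linarith
    funext i
    fin_cases i
    · simp [stereo, e1]; field_simp
    · simp [stereo, e1]; field_simp
    · simp [stereo, e1, e2]; field_simp; linear_combination (x 2) * hε
  rcases le_or_gt (x 2) 0 with h | h
  · exact ⟨1, _, _, Or.inl rfl, key 1 (by norm_num) (by linarith)⟩
  · exact ⟨-1, _, _, Or.inr rfl, key (-1) (by norm_num) (by linarith)⟩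

/-- The conformal factor of the round metric in a stereographic chart. -/
def sphereFactor (u v : ℝ) : ℝ := 4 / (1 + u ^ 2 + v ^ 2) ^ 2

/-- In both charts the Euclidean metric of `ℝ³` induces the conformally flat metric with factor
`sphereFactor`. -/
theorem stereo_metric (ε u v : ℝ) (hε : ε ^ 2 = 1) :
    (∑ i, deriv (fun a => stereo ε a v i) u ^ 2) = sphereFactor u v ∧
    (∑ i, deriv (fun b => stereo ε u b i) v ^ 2) = sphereFactor u v ∧
    (∑ i, deriv (fun a => stereo ε a v i) u * deriv (fun b => stereo ε u b i) v) = 0 := by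
  have h : (1 + u ^ 2 + v ^ 2) ≠ 0 := by positivity
  have hu : HasDerivAt (fun a : ℝ => 1 + a ^ 2 + v ^ 2) (2 * u) u := by
    simpa using ((hasDerivAt_pow 2 u).const_add 1).add_const (v ^ 2)
  have hv : HasDerivAt (fun b : ℝ => 1 + u ^ 2 + b ^ 2) (2 * v) v := by
    simpa using (hasDerivAt_pow 2 v).const_add (1 + u ^ 2)
  have nu : HasDerivAt (fun a : ℝ => ε * (a ^ 2 + v ^ 2 - 1)) (ε * (2 * u)) u := by
    simpa using (((hasDerivAt_pow 2 u).add_const (v ^ 2)).sub_const 1).const_mul ε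
  have nv : HasDerivAt (fun b : ℝ => ε * (u ^ 2 + b ^ 2 - 1)) (ε * (2 * v)) v := by
    simpa using (((hasDerivAt_pow 2 v).const_add (u ^ 2)).sub_const 1).const_mul ε
  have lu : HasDerivAt (fun a : ℝ => 2 * a) 2 u := by
    simpa using (hasDerivAt_id u).const_mul (2 : ℝ)
  have lv : HasDerivAt (fun b : ℝ => 2 * b) 2 v := by
    simpa using (hasDerivAt_id v).const_mul (2 : ℝ)
  have cu := hasDerivAt_const u (2 * v)
  have cv := hasDerivAt_const v (2 * u)
  have a0 := (lu.fun_div hu h).deriv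
  have a1 := (cu.fun_div hu h).deriv
  have a2 := (nu.fun_div hu h).deriv
  have b0 := (cv.fun_div hv h).deriv
  have b1 := (lv.fun_div hv h).deriv
  have b2 := (nv.fun_div hv h).deriv
  simp only [stereo, Fin.sum_univ_three, Matrix.cons_val, sphereFactor, a0, a1, a2, b0, b1, b2]
  refine ⟨?_, ?_, ?_⟩
  · field_simp
    ring_nf
    rw [hε]
    ring
  · field_simp
    ring_nf
    rw [hε]
    ring
  · field_simp
    ring_nf
    rw [hε]
    ring

/-- The round inner product of two tangent vectors at the point with coordinates `y`. -/
def sphereInner (y : ℝ × ℝ) (k l : ℝ × ℝ) : ℝ :=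
  sphereFactor y.1 y.2 * (k.1 * l.1 + k.2 * l.2)

/-! ### The Schwarzschild-de Sitter metric, normalised to `λ = 3` -/

/-- The function `D(r) = 1 - M/r - r²`. -/
def sdsD (M r : ℝ) : ℝ := 1 - M / r - r ^ 2

/-- The metric `-D dt² + D⁻¹ dr² + r² σ` in the coordinates `(t, r, u, v)`. -/
def sdsMetric (M : ℝ) : Field2 := fun x =>
  Matrix.diagonal ![-sdsD M (x 1), (sdsD M (x 1))⁻¹,
    (x 1) ^ 2 * sphereFactor (x 2) (x 3), (x 1) ^ 2 * sphereFactor (x 2) (x 3)]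

/-! ### The conformal Gaussian gauge

Gaussian coordinates are `(τ, t_⋆, u, v)`. -/

/-- The canonical conformal factor `Θ = 1 - τ²/4`; it vanishes at `τ = 2`. -/
def Theta (p : Pt) : ℝ := 1 - (p 0) ^ 2 / 4

/-- The `δ`-neighbourhood `(-δ, 2 + δ) × (-T - δ, T + δ)` of `[0, 2] × [-T, T]`, times an open
set `U` of points of the sphere. -/
def region (T δ : ℝ) (U : Set (ℝ × ℝ)) : Set Pt :=
  {p | -δ < p 0 ∧ p 0 < 2 + δ ∧ |p 1| < T + δ ∧ (p 2, p 3) ∈ U}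

/-- The part of `region` lying before the conformal boundary `τ = 2`. -/
def physRegion (T δ : ℝ) (U : Set (ℝ × ℝ)) : Set Pt := {p | p ∈ region T δ U ∧ p 0 < 2}

/-- `Ψ` (points, in coordinates `(t, r, u, v)`) and `β` (covectors, components in the same
coordinates) form the congruence of conformal geodesics of the Schwarzschild-de Sitter metric in
the region `r > r_c` which starts at `τ = 0` from the hypersurface `r = r_⋆` with `Θ = 1`,
`dΘ/dτ = 0`, `β = 0` and with the future unit normal as velocity.  The curves
run to infinity as `τ → 2`. -/
structure IsSdSCongruence (M rc rstar T δ : ℝ) (Ψ β : Pt → Pt) : Prop where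
  smooth_Ψ : ContDiffOn ℝ ∞ Ψ (physRegion T δ univ)
  smooth_β : ContDiffOn ℝ ∞ β (physRegion T δ univ)
  cosmological : ∀ p ∈ physRegion T δ univ, rc < Ψ p 1
  geodesic : ∀ t u v : ℝ, |t| < T + δ →
    IsConformalGeodesicOn (sdsMetric M) (Ioo (-δ) 2)
      (fun τ => Ψ ![τ, t, u, v]) (fun τ => β ![τ, t, u, v])
  initial_point : ∀ t u v : ℝ, |t| < T + δ → Ψ ![0, t, u, v] = ![t, rstar, u, v]
  initial_velocity : ∀ t u v : ℝ, |t| < T + δ →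
    deriv (fun τ => Ψ ![τ, t, u, v]) 0 = ![0, √(-sdsD M rstar), 0, 0]
  initial_β : ∀ t u v : ℝ, |t| < T + δ → β ![0, t, u, v] = 0
  escape : ∀ t u v : ℝ, |t| < T + δ →
    Tendsto (fun τ => Ψ ![τ, t, u, v] 1) (𝓝[<] 2) atTop

/-- `g` and `f` are smooth on the whole of `region`, across `τ = 2`, and before `τ = 2` they are
`g = Θ² Ψ^* g̃` and `f = Ψ^* β - Θ⁻¹ dΘ`, where `g̃` is the Schwarzschild-de Sitter metric. Thus,
before `τ = 2`, the Weyl connection `∇ + S(f)` is `∇̃ + S(β)`. -/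
structure IsUnphysicalExtension (M T δ : ℝ) (Ψ β : Pt → Pt) (g : Field2) (f : Pt → Pt) :
    Prop where
  smooth_g : ∀ μ ν, ContDiffOn ℝ ∞ (fun p => g p μ ν) (region T δ univ)
  smooth_f : ∀ μ, ContDiffOn ℝ ∞ (fun p => f p μ) (region T δ univ)
  eq_g : ∀ p ∈ physRegion T δ univ,
    g p = (Theta p) ^ 2 • pullMetric Ψ (sdsMetric M) p
  eq_f : ∀ p ∈ physRegion T δ univ, ∀ μ,
    f p μ = (∑ i, β p i * jac Ψ p i μ) - (Theta p)⁻¹ * pd μ Theta p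

/-- `d^c_{dab}` is the rescaled Weyl tensor: it is smooth across `τ = 2` and
`C^c_{dab} = Θ d^c_{dab}`. -/
structure IsRescaledWeyl (T δ : ℝ) (g : Field2) (d : Field4) : Prop where
  smooth_d : ∀ κ l μ ν, ContDiffOn ℝ ∞ (fun p => d p κ l μ ν) (region T δ univ)
  eq_d : ∀ p ∈ region T δ univ, ∀ κ l μ ν,
    weylTensor g p κ l μ ν = Theta p * d p κ l μ ν

/-! ### Frame components

A frame is a field of matrices `e p a μ = e_a^μ`. -/

/-- The Minkowski matrix. -/
def eta : Matrix (Fin 4) (Fin 4) ℝ := Matrix.diagonal ![-1, 1, 1, 1]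

/-- The coframe: `coframe e p b μ = ω^b_μ`, with `ω^b_μ e_a^μ = δ_a^b`. -/
def coframe (e : Field2) : Field2 := fun p b μ => (e p)⁻¹ μ b

/-- Directional derivative `∂_a F = e_a^μ ∂_μ F`. -/
def dirDeriv (e : Field2) (a : Fin 4) (F : Pt → ℝ) (p : Pt) : ℝ := ∑ μ, e p a μ * pd μ F p

/-- Components `f_a` of a covector. -/
def frameCov (e : Field2) (f : Pt → Pt) (p : Pt) (a : Fin 4) : ℝ := ∑ μ, e p a μ * f p μ

/-- Connection coefficients `Γ_a^b_c` with respect to the frame: `∇_a e_c = Γ_a^b_c e_b`. -/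
def frameConn (e : Field2) (Γ : Field3) : Field3 := fun p a b c =>
  ∑ ν, coframe e p b ν *
    ∑ μ, e p a μ * (pd μ (fun q => e q c ν) p + ∑ l, Γ p μ ν l * e p c l)

/-- Components `L_{ab}` of a covariant 2-tensor. -/
def frameTen2 (e : Field2) (L : Field2) : Field2 := fun p a b =>
  ∑ μ, ∑ ν, e p a μ * e p b ν * L p μ ν

/-- Components `d^a_{bcd}` of a tensor of type `(1, 3)`. -/
def frameTen4 (e : Field2) (d : Field4) : Field4 := fun p a b c h =>
  ∑ κ, ∑ l, ∑ μ, ∑ ν, coframe e p a κ * e p b l * e p c μ * e p h ν * d p κ l μ ν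

/-- `e` is the Weyl propagated frame on `region T δ U` determined by the orientation `s = ±1` of
its radial leg and by the orthonormal frame `k₂, k₃` on the set `U` of the sphere:
it is smooth across `τ = 2`, `g`-orthonormal (in particular nowhere degenerate), `e_0 = ∂_τ`, and
before `τ = 2` its legs are Weyl propagated along the congruence, with initial values
`e_1 = s |D(r_⋆)|^{-1/2} ∂_t`, `e_2 = r_⋆⁻¹ k₂`, `e_3 = r_⋆⁻¹ k₃`. -/
structure IsWeylFrame (M rstar T δ : ℝ) (U : Set (ℝ × ℝ)) (Ψ β : Pt → Pt) (g : Field2)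
    (s : ℝ) (k₂ k₃ : ℝ × ℝ → ℝ × ℝ) (e : Field2) : Prop where
  smooth_e : ∀ a μ, ContDiffOn ℝ ∞ (fun p => e p a μ) (region T δ U)
  orthonormal : ∀ p ∈ region T δ U, ∀ a b, bil (g p) (e p a) (e p b) = eta a b
  time_leg : ∀ p ∈ region T δ U, e p 0 = Pi.single 0 1
  propagated : ∀ a, ∀ t u v : ℝ, |t| < T + δ → (u, v) ∈ U →
    IsWeylPropagatedOn (sdsMetric M) (Ioo (-δ) 2)
      (fun τ => Ψ ![τ, t, u, v]) (fun τ => β ![τ, t, u, v])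
      (fun τ => push Ψ ![τ, t, u, v] (e ![τ, t, u, v] a))
  initial_e1 : ∀ t u v : ℝ, |t| < T + δ → (u, v) ∈ U →
    push Ψ ![0, t, u, v] (e ![0, t, u, v] 1) = ![s / √(-sdsD M rstar), 0, 0, 0]
  initial_e2 : ∀ t u v : ℝ, |t| < T + δ → (u, v) ∈ U →
    push Ψ ![0, t, u, v] (e ![0, t, u, v] 2) =
      ![0, 0, (k₂ (u, v)).1 / rstar, (k₂ (u, v)).2 / rstar]
  initial_e3 : ∀ t u v : ℝ, |t| < T + δ → (u, v) ∈ U →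
    push Ψ ![0, t, u, v] (e ![0, t, u, v] 3) =
      ![0, 0, (k₃ (u, v)).1 / rstar, (k₃ (u, v)).2 / rstar]

/-! ### The extended conformal Einstein field equations

The unknowns are a frame `e`, connection coefficients `Γ`, Schouten components `L` and
rescaled Weyl components `d`; `Ξ` and `dc` are the conformal gauge fields `Ξ`, `d_a`. -/

/-- `f_a = ¼ Γ_a^b_b`. -/
def traceCov (Γ : Field3) (p : Pt) (a : Fin 4) : ℝ := (1 / 4) * ∑ b, Γ p a b b

/-- Zero-quantity `Σ_a^c_b e_c = [e_a, e_b] - (Γ_a^c_b - Γ_b^c_a) e_c`, component `μ`. -/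
def zeroTorsion (e : Field2) (Γ : Field3) (p : Pt) (a b μ : Fin 4) : ℝ :=
  (dirDeriv e a (fun q => e q b μ) p - dirDeriv e b (fun q => e q a μ) p)
    - ∑ c, (Γ p a c b - Γ p b c a) * e p c μ

/-- The geometric curvature `R^c_{dab}` in the frame formalism. -/
def frameCurvature (e : Field2) (Γ : Field3) : Field4 := fun p c d a b =>
  dirDeriv e a (fun q => Γ q b c d) p - dirDeriv e b (fun q => Γ q a c d) p
    + ∑ f, (Γ p f c d * (Γ p b f a - Γ p a f b) + Γ p b f d * Γ p a c f - Γ p a f d * Γ p b c f)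

/-- The algebraic curvature `ρ^c_{dab} = Ξ d^c_{dab} + 2 S_{d[a}^{ce} L_{b]e}`. -/
def algCurvature (Ξ : Pt → ℝ) (L : Field2) (d : Field4) : Field4 := fun p c h a b =>
  Ξ p * d p c h a b + ∑ e, (shift eta h a c e * L p b e - shift eta h b c e * L p a e)

/-- `∇_c L_{ab}` in the frame. -/
def frameDerivTen2 (e : Field2) (Γ : Field3) (L : Field2) (p : Pt) (c a b : Fin 4) : ℝ :=
  dirDeriv e c (fun q => L q a b) p - ∑ f, (Γ p c f a * L p f b + Γ p c f b * L p a f)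

/-- `∇_h d^a_{bcf}` in the frame. -/
def frameDerivTen4 (e : Field2) (Γ : Field3) (d : Field4) (p : Pt) (h a b c f : Fin 4) : ℝ :=
  dirDeriv e h (fun q => d q a b c f) p
    + ∑ k, (Γ p h a k * d p k b c f - Γ p h k b * d p a k c f
          - Γ p h k c * d p a b k f - Γ p h k f * d p a b c k)

/-- Zero-quantity `Δ_{cdb} = ∇_c L_{db} - ∇_d L_{cb} - d_a d^a_{bcd}`. -/
def zeroCotton (e : Field2) (Γ : Field3) (L : Field2) (d : Field4) (dc : Pt → Pt) (p : Pt)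
    (c h b : Fin 4) : ℝ :=
  frameDerivTen2 e Γ L p c h b - frameDerivTen2 e Γ L p h c b - ∑ a, dc p a * d p a b c h

/-- Zero-quantity `Λ_{bcd} = ∇_a d^a_{bcd} - f_a d^a_{bcd}`. -/
def zeroBianchi (e : Field2) (Γ : Field3) (d : Field4) (p : Pt) (b c h : Fin 4) : ℝ :=
  (∑ a, frameDerivTen4 e Γ d p a a b c h) - ∑ a, traceCov Γ p a * d p a b c h

/-- The extended vacuum conformal Einstein field equations on the open set `N`, for the
coefficients `Γ` of a Weyl connection of the metric which makes `e` orthonormal. -/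
structure IsXCFESolutionOn (N : Set Pt) (e : Field2) (Γ : Field3) (L : Field2) (d : Field4)
    (Ξ : Pt → ℝ) (dc : Pt → Pt) : Prop where
  frame : ∀ p ∈ N, (e p).det ≠ 0
  weyl : ∀ p ∈ N, ∀ a b c,
    (∑ h, (Γ p a h b * eta h c + Γ p a h c * eta b h)) = 2 * traceCov Γ p a * eta b c
  torsion : ∀ p ∈ N, ∀ a b μ, zeroTorsion e Γ p a b μ = 0
  curv : ∀ p ∈ N, ∀ c h a b, frameCurvature e Γ p c h a b - algCurvature Ξ L d p c h a b = 0
  cotton : ∀ p ∈ N, ∀ c h b, zeroCotton e Γ L d dc p c h b = 0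
  bianchi : ∀ p ∈ N, ∀ b c h, zeroBianchi e Γ d p b c h = 0

/-- The gauge field `d_a = Ξ f_a + ∇_a Ξ`, components in the frame. -/
def gaugeCov (e : Field2) (Ξ : Pt → ℝ) (f : Pt → Pt) (p : Pt) : Pt := fun a =>
  Ξ p * frameCov e f p a + dirDeriv e a Ξ p

end ConformalSdS

end

/-!
The initial data `β = 0` and `ẋ` normal to `{r = r⋆}` are invariant under the isometries of the
Schwarzschild–de Sitter metric, and the metric is Einstein. The conformal geodesics are therefore
the radial metric geodesics `t, u, v = const`, reparametrised: with proper time `s`, the parameter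
satisfies `dτ = Θ ds` for `Θ = 1 - τ²/4`, and `β = Θ⁻¹ dΘ`, so that `f = 0` and the Weyl connection
is the Levi-Civita connection of `g = Θ² g̃`.

With `ρ = 1 / r`, the equation for the curves is `dρ/dτ = -ρ √(1 - ρ² + M ρ³) / Θ`, which is
singular at `τ = 2`. Separation of variables turns it into `F(ρ) = F(1 / r⋆) (2 - τ) / (2 + τ)`,
where `F` is smooth near `[0, 1 / r⋆]` with `F(0) = 0` and `F' > 0`. Hence `ρ` extends smoothly, with
a simple zero, through `τ = 2`, and so does `R = Θ / ρ`, which stays positive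
(`exists_radialProfile`). The radial equation has the regular form `R ρ = Θ`, `ρ' = -w / R`,
`w² = 1 - ρ² + M ρ³`, in which no quotient by `Θ` occurs.

In the coordinates `(τ, t, u, v)` the unphysical metric is the Kantowski–Sachs metric
`g = -dτ² + (R w)² dt² + R² σ`. For such a metric the Christoffel symbols and the curvature are
explicit: the curvature operator is diagonal on coordinate planes (`curvature_ksMetric`). By the
radial equations its Schouten tensor has eigenvalues that are smooth functions of `τ`, and its
Weyl tensor is `Θ M / R³` times a constant pattern of type D (`schouten_eq`, `weylTensor_eq`).
The rescaled Weyl tensor is thus regular across `Θ = 0`.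

The frame is `∂_τ, ± (R w)⁻¹ ∂_t, R⁻¹ k₂, R⁻¹ k₃`. It is adapted to the eigenspaces of all curvature
tensors, so that the components of these are constants times functions of `τ`
(`frame_schouten`, `frame_weyl`). The vanishing of the torsion and the curvature equation are
consequences of the covariance of the connection under a change of gauge
(`zeroTorsion_frameConn`, `frameCurvature_frameConn`). The Cotton and Bianchi equations involve
the connection coefficients only through the expansion rates of the legs: the rotation coefficients
of `k₂, k₃` drop out because the pattern is invariant under rotations of the last two legs
(`zeroCotton_adapted`, `zeroBianchi_adapted`), and they reduce to ordinary differential equations in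
`τ` for the eigenvalues and for `M / R³`.
-/

noncomputable section

namespace ConformalSdS

/-! ### The radial equation -/

/-- The radial profile of the congruence in terms of the conformal parameter `τ`: `ρ = 1 / r`,
`R = Θ r`, `P = dR/dτ` and `w = √(-D) / r = √(1 - ρ² + M ρ³)`, as functions on
`(-δ, 2 + δ)` that are regular across `τ = 2`, where `ρ = 0`. -/
structure RadialProfile (M rc rstar δ : ℝ) (R P ρ w : ℝ → ℝ) : Prop where
  δ_pos : 0 < δ
  R_pos : ∀ τ ∈ Ioo (-δ) (2 + δ), 0 < R τ
  w_pos : ∀ τ ∈ Ioo (-δ) (2 + δ), 0 < w τ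
  deriv_R : ∀ τ ∈ Ioo (-δ) (2 + δ), HasDerivAt R (P τ) τ
  deriv_P : ∀ τ ∈ Ioo (-δ) (2 + δ),
    HasDerivAt P ((1 + P τ ^ 2 - 2 * M * ρ τ) / (2 * R τ)) τ
  deriv_ρ : ∀ τ ∈ Ioo (-δ) (2 + δ), HasDerivAt ρ (-(w τ / R τ)) τ
  deriv_w : ∀ τ ∈ Ioo (-δ) (2 + δ),
    HasDerivAt w ((2 * ρ τ - 3 * M * ρ τ ^ 2) / (2 * R τ)) τ
  smooth_R : ContDiffOn ℝ ∞ R (Ioo (-δ) (2 + δ))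
  smooth_P : ContDiffOn ℝ ∞ P (Ioo (-δ) (2 + δ))
  smooth_ρ : ContDiffOn ℝ ∞ ρ (Ioo (-δ) (2 + δ))
  smooth_w : ContDiffOn ℝ ∞ w (Ioo (-δ) (2 + δ))
  R_mul_ρ : ∀ τ ∈ Ioo (-δ) (2 + δ), R τ * ρ τ = 1 - τ ^ 2 / 4
  w_eq : ∀ τ ∈ Ioo (-δ) (2 + δ), w τ = P τ * ρ τ + τ / 2
  w_sq : ∀ τ ∈ Ioo (-δ) (2 + δ), w τ ^ 2 = 1 - ρ τ ^ 2 + M * ρ τ ^ 3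
  ρ_pos : ∀ τ ∈ Ioo (-δ) 2, 0 < ρ τ
  ρ_lt : ∀ τ ∈ Ioo (-δ) 2, rc < (ρ τ)⁻¹
  ρ_zero : ρ 0 = rstar⁻¹
  R_zero : R 0 = rstar

/-- The polynomial `1 - x² + M x³`, which is `-D(r) / r²` for `x = 1 / r`. -/
def radialPoly (M x : ℝ) : ℝ := 1 - x ^ 2 + M * x ^ 3

/-- `D` is negative beyond its largest zero. -/
theorem sdsD_neg {M rc r : ℝ} (hM : 0 < M)
    (hrc : IsGreatest {r : ℝ | 0 < r ∧ sdsD M r = 0} rc) (hr : rc < r) : sdsD M r < 0 := by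
  have hrc0 : 0 < rc := hrc.1.1
  have hr0 : 0 < r := hrc0.trans hr
  have hone : ∀ x : ℝ, 1 ≤ x → sdsD M x < 0 := by
    intro x hx
    have : 0 < M / x := by positivity
    simp only [sdsD]
    nlinarith
  by_contra! h
  have h1 : r < 1 := by
    by_contra! h'
    exact absurd (hone r h') (not_lt.2 h)
  have hcont : ContinuousOn (sdsD M) (Icc r 1) := by
    intro x hx
    have hx0 : x ≠ 0 := (hr0.trans_le hx.1).ne'
    unfold sdsD
    exact ((continuousAt_const.sub (continuousAt_const.div continuousAt_id hx0)).sub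
      (continuousAt_id.pow 2)).continuousWithinAt
  obtain ⟨x, hx, hx0⟩ := intermediate_value_Icc' h1.le hcont ⟨(hone 1 le_rfl).le, h⟩
  exact absurd (hrc.2 ⟨hr0.trans_le hx.1, hx0⟩) (not_le.2 (hr.trans_le hx.1))

theorem radialPoly_inv {M r : ℝ} (hr : r ≠ 0) : radialPoly M r⁻¹ = -sdsD M r / r ^ 2 := by
  simp only [radialPoly, sdsD]
  field_simp
  ring

/-- The lower end `-1/2` only has to be negative, to leave room beyond `ρ = 0`, and large enough for
the polynomial to be positive for all `M < 1`. -/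
theorem radialPoly_pos {M rc x : ℝ} (hM : 0 < M) (hM1 : M < 1)
    (hrc : IsGreatest {r : ℝ | 0 < r ∧ sdsD M r = 0} rc) (hx : x ∈ Ioo (-(1 / 2)) rc⁻¹) :
    0 < radialPoly M x := by
  rcases le_or_gt x 0 with h | h
  · have h1 : x ^ 2 ≤ 1 / 4 := by nlinarith [hx.1]
    have h2 : -(1 / 2) ≤ M * x := by nlinarith [hx.1]
    simp only [radialPoly]
    nlinarith [sq_nonneg x]
  · have hr : rc < x⁻¹ := (lt_inv_comm₀ h hrc.1.1).1 hx.2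
    have := radialPoly_inv (M := M) (inv_ne_zero h.ne')
    rw [inv_inv] at this
    rw [this]
    have := sdsD_neg hM hrc hr
    exact div_pos (by linarith) (by positivity)

/-- The logarithmic derivative of `radialMap M x / x`. -/
def radialIntegrand (M x : ℝ) : ℝ :=
  x * (1 - M * x) / (√(radialPoly M x) * (1 + √(radialPoly M x)))

/-- The integral `∫₀ˣ (1 / √(1 - y² + M y³) - 1) dy / y`, with the removable singularity of the
integrand removed. -/
def radialIntegral (M x : ℝ) : ℝ := ∫ y in (0 : ℝ)..x, radialIntegrand M y

/-- The function `F` with `F(0) = 0`, `F'(0) = 1` and `F' / F = 1 / (x √(1 - x² + M x³))`: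
along a radial geodesic orthogonal to the hypersurfaces `r = const`, `F(1 / r)` decays exactly like
`exp (-s)` in proper time `s`. -/
def radialMap (M x : ℝ) : ℝ := x * Real.exp (radialIntegral M x)

section RadialMap

variable {M b : ℝ}

theorem contDiff_radialPoly : ContDiff ℝ ∞ (radialPoly M) := by
  unfold radialPoly
  fun_prop

theorem contDiffOn_sqrt_radialPoly (hpos : ∀ x ∈ Ioo (-(1 / 2)) b, 0 < radialPoly M x) :
    ContDiffOn ℝ ∞ (fun x => √(radialPoly M x)) (Ioo (-(1 / 2)) b) :=
  contDiff_radialPoly.contDiffOn.sqrt fun x hx => (hpos x hx).ne'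

theorem contDiffOn_radialIntegrand (hpos : ∀ x ∈ Ioo (-(1 / 2)) b, 0 < radialPoly M x) :
    ContDiffOn ℝ ∞ (radialIntegrand M) (Ioo (-(1 / 2)) b) := by
  have h := contDiffOn_sqrt_radialPoly hpos
  refine ContDiffOn.div (by fun_prop) (h.mul (contDiffOn_const.add h)) fun x hx => ?_
  have := Real.sqrt_pos.2 (hpos x hx)
  positivity

theorem hasDerivAt_radialIntegral (hb : 0 < b)
    (hpos : ∀ x ∈ Ioo (-(1 / 2)) b, 0 < radialPoly M x) {x : ℝ} (hx : x ∈ Ioo (-(1 / 2)) b) :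
    HasDerivAt (radialIntegral M) (radialIntegrand M x) x := by
  have hc := (contDiffOn_radialIntegrand hpos).continuousOn
  have h0 : (0 : ℝ) ∈ Ioo (-(1 / 2)) b := ⟨by norm_num, hb⟩
  have hsub : uIcc 0 x ⊆ Ioo (-(1 / 2)) b := OrdConnected.uIcc_subset ordConnected_Ioo h0 hx
  refine intervalIntegral.integral_hasDerivAt_right
    (hc.mono hsub).intervalIntegrable ?_ (hc.continuousAt (isOpen_Ioo.mem_nhds hx))
  exact hc.stronglyMeasurableAtFilter isOpen_Ioo x hx

theorem contDiffOn_radialIntegral (hb : 0 < b)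
    (hpos : ∀ x ∈ Ioo (-(1 / 2)) b, 0 < radialPoly M x) :
    ContDiffOn ℝ ∞ (radialIntegral M) (Ioo (-(1 / 2)) b) := by
  rw [contDiffOn_infty_iff_deriv_of_isOpen isOpen_Ioo]
  refine ⟨fun x hx => (hasDerivAt_radialIntegral hb hpos hx).differentiableAt.differentiableWithinAt,
    (contDiffOn_radialIntegrand hpos).congr fun x hx => (hasDerivAt_radialIntegral hb hpos hx).deriv⟩

theorem contDiffOn_radialMap (hb : 0 < b)
    (hpos : ∀ x ∈ Ioo (-(1 / 2)) b, 0 < radialPoly M x) :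
    ContDiffOn ℝ ∞ (radialMap M) (Ioo (-(1 / 2)) b) :=
  contDiffOn_id.mul (contDiffOn_radialIntegral hb hpos).exp

theorem hasDerivAt_radialMap (hb : 0 < b)
    (hpos : ∀ x ∈ Ioo (-(1 / 2)) b, 0 < radialPoly M x) {x : ℝ} (hx : x ∈ Ioo (-(1 / 2)) b) :
    HasDerivAt (radialMap M) (Real.exp (radialIntegral M x) / √(radialPoly M x)) x := by
  have h := (hasDerivAt_id x).mul (hasDerivAt_radialIntegral hb hpos hx).exp
  refine h.congr_deriv ?_
  have hs := Real.sqrt_pos.2 (hpos x hx)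
  have hsq := Real.sq_sqrt (hpos x hx).le
  simp only [radialIntegrand, id]
  set v := √(radialPoly M x)
  field_simp
  simp only [radialPoly] at hsq
  linear_combination hsq

theorem strictMonoOn_radialMap (hb : 0 < b)
    (hpos : ∀ x ∈ Ioo (-(1 / 2)) b, 0 < radialPoly M x) :
    StrictMonoOn (radialMap M) (Ioo (-(1 / 2)) b) := by
  refine strictMonoOn_of_deriv_pos (convex_Ioo _ _)
    (contDiffOn_radialMap hb hpos).continuousOn fun x hx => ?_
  rw [interior_Ioo] at hx
  rw [(hasDerivAt_radialMap hb hpos hx).deriv]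
  have := Real.sqrt_pos.2 (hpos x hx)
  positivity

/-- The inverse of `radialMap M` on the interval `(-1/2, b)`. -/
def radialInv (M b : ℝ) : ℝ → ℝ := Function.invFunOn (radialMap M) (Ioo (-(1 / 2)) b)

theorem contDiffAt_radialInv (hb : 0 < b)
    (hpos : ∀ x ∈ Ioo (-(1 / 2)) b, 0 < radialPoly M x) {x : ℝ} (hx : x ∈ Ioo (-(1 / 2)) b) :
    ContDiffAt ℝ ∞ (radialInv M b) (radialMap M x) := by
  have hF : ContDiffAt ℝ ∞ (radialMap M) x :=
    (contDiffOn_radialMap hb hpos).contDiffAt (isOpen_Ioo.mem_nhds hx)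
  have hs := Real.sqrt_pos.2 (hpos x hx)
  have hne : Real.exp (radialIntegral M x) / √(radialPoly M x) ≠ 0 := by positivity
  have hd : HasFDerivAt (radialMap M)
      (ContinuousLinearEquiv.unitsEquivAut ℝ (Units.mk0 _ hne) : ℝ →L[ℝ] ℝ) x := by
    refine (hasDerivAt_radialMap hb hpos hx).hasFDerivAt.congr_fderiv ?_
    ext
    simp
  have hl := hF.to_localInverse hd (by simp)
  have hst := hF.hasStrictFDerivAt' hd (by simp)
  refine hl.congr_of_eventuallyEq ?_
  have hcont : ContinuousAt (hF.localInverse hd (by simp)) (radialMap M x) := hl.continuousAt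
  have himg : hF.localInverse hd (by simp) (radialMap M x) = x := hst.localInverse_apply_image
  have hJ : ∀ᶠ y in 𝓝 (radialMap M x), hF.localInverse hd (by simp) y ∈ Ioo (-(1 / 2)) b :=
    hcont.eventually (by rw [himg]; exact isOpen_Ioo.mem_nhds hx)
  filter_upwards [hJ, hst.eventually_right_inverse] with y hy hy'
  have h1 : y ∈ radialMap M '' Ioo (-(1 / 2)) b := ⟨_, hy, hy'⟩
  refine (strictMonoOn_radialMap hb hpos).injOn (Function.invFunOn_mem h1) hy ?_
  exact (Function.invFunOn_eq h1).trans hy'.symm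

end RadialMap

/-- The solution `ρ` of `F(ρ) = F(1 / r_⋆) (2 - τ) / (2 + τ)`. Since `dτ = Θ ds`, the factor
`(2 - τ) / (2 + τ)` is `exp (-s)` in terms of the proper time `s`. -/
theorem exists_inverse_radius {M rc rstar : ℝ} (hM : 0 < M) (hM1 : M < 1)
    (hrc : IsGreatest {r : ℝ | 0 < r ∧ sdsD M r = 0} rc) (hrstar : rc < rstar) :
    ∃ (δ : ℝ) (ρ : ℝ → ℝ), 0 < δ ∧ δ < 2 ∧ ρ 0 = rstar⁻¹ ∧
      ∀ τ ∈ Ioo (-δ) (2 + δ), ρ τ ∈ Ioo (-(1 / 2)) rc⁻¹ ∧ ContDiffAt ℝ ∞ ρ τ ∧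
        radialMap M (ρ τ) = radialMap M rstar⁻¹ * ((2 - τ) / (2 + τ)) := by
  have hrc0 : 0 < rc := hrc.1.1
  have hb : 0 < rc⁻¹ := inv_pos.2 hrc0
  have hpos : ∀ x ∈ Ioo (-(1 / 2)) rc⁻¹, 0 < radialPoly M x :=
    fun x hx => radialPoly_pos hM hM1 hrc hx
  have hmono := strictMonoOn_radialMap hb hpos
  have hx0 : 0 < rstar⁻¹ := inv_pos.2 (hrc0.trans hrstar)
  have hx0b : rstar⁻¹ < rc⁻¹ := inv_strictAnti₀ hrc0 hrstar
  have hx0J : rstar⁻¹ ∈ Ioo (-(1 / 2)) rc⁻¹ := ⟨by linarith, hx0b⟩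
  obtain ⟨x1, hx1, hx1b⟩ := exists_between hx0b
  have hx1J : x1 ∈ Ioo (-(1 / 2)) rc⁻¹ := ⟨by linarith, hx1b⟩
  have hx2J : -(1 / 4) ∈ Ioo (-(1 / 2)) rc⁻¹ := ⟨by norm_num, by linarith⟩
  set c := radialMap M rstar⁻¹ with hc
  have hc0 : 0 < c := mul_pos hx0 (Real.exp_pos _)
  have hcx1 : c < radialMap M x1 := hmono hx0J hx1J hx1
  have hx2 : radialMap M (-(1 / 4)) < 0 := mul_neg_of_neg_of_pos (by norm_num) (Real.exp_pos _)
  obtain ⟨δ, ⟨hδ1, hδ2⟩, hδ0, hδ2'⟩ : ∃ δ : ℝ, (c * ((2 + δ) / (2 - δ)) < radialMap M x1 ∧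
      radialMap M (-(1 / 4)) < c * (-δ / (4 + δ))) ∧ 0 < δ ∧ δ < 2 := by
    have e1 : ContinuousAt (fun δ : ℝ => c * ((2 + δ) / (2 - δ))) 0 :=
      continuousAt_const.mul ((by fun_prop : ContinuousAt (fun δ : ℝ => 2 + δ) 0).div
        (by fun_prop) (by norm_num))
    have e2 : ContinuousAt (fun δ : ℝ => c * (-δ / (4 + δ))) 0 :=
      continuousAt_const.mul ((by fun_prop : ContinuousAt (fun δ : ℝ => -δ) 0).div
        (by fun_prop) (by norm_num))
    have h1 := e1.tendsto.eventually_lt_const (u := radialMap M x1) (by simpa using hcx1)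
    have h2 := e2.tendsto.eventually_const_lt (u := radialMap M (-(1 / 4))) (by simpa using hx2)
    have h3 : ∀ᶠ δ : ℝ in 𝓝[>] 0, 0 < δ ∧ δ < 2 := Ioo_mem_nhdsGT (by norm_num)
    exact (((h1.and h2).filter_mono nhdsWithin_le_nhds).and h3).exists
  refine ⟨δ, fun τ => radialInv M rc⁻¹ (c * ((2 - τ) / (2 + τ))), hδ0, hδ2', ?_, ?_⟩
  · have : c * ((2 - 0) / (2 + 0)) = radialMap M rstar⁻¹ := by rw [← hc]; norm_num
    simp only [this]
    exact hmono.injOn.leftInvOn_invFunOn hx0J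
  · intro τ hτ
    have h2τ : 0 < 2 + τ := by linarith [hτ.1]
    have hup : c * ((2 - τ) / (2 + τ)) ≤ radialMap M x1 := by
      refine le_trans (mul_le_mul_of_nonneg_left ?_ hc0.le) hδ1.le
      rw [div_le_div_iff₀ h2τ (by linarith)]
      nlinarith [hτ.1]
    have hlo : radialMap M (-(1 / 4)) ≤ c * ((2 - τ) / (2 + τ)) := by
      refine le_trans hδ2.le (mul_le_mul_of_nonneg_left ?_ hc0.le)
      rw [div_le_div_iff₀ (by linarith) h2τ]
      nlinarith [hτ.2]
    have hsub : Icc (-(1 / 4)) x1 ⊆ Ioo (-(1 / 2)) rc⁻¹ :=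
      fun y hy => ⟨hx2J.1.trans_le hy.1, hy.2.trans_lt hx1J.2⟩
    have himg : c * ((2 - τ) / (2 + τ)) ∈ radialMap M '' Ioo (-(1 / 2)) rc⁻¹ :=
      image_mono hsub (intermediate_value_Icc (by linarith)
        ((contDiffOn_radialMap hb hpos).continuousOn.mono hsub) ⟨hlo, hup⟩)
    have hmem := Function.invFunOn_mem himg
    have heq := Function.invFunOn_eq himg
    refine ⟨hmem, ?_, heq⟩
    have hφ := contDiffAt_radialInv hb hpos hmem
    rw [heq] at hφ
    refine ContDiffAt.comp τ hφ (contDiffAt_const.mul ?_)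
    exact ContDiffAt.div (by fun_prop) (by fun_prop) h2τ.ne'

/-- The radial equation has a solution that is regular across `τ = 2`. -/
theorem exists_radialProfile {M rc rstar : ℝ} (hM : 0 < M) (hM1 : M < 1)
    (hrc : IsGreatest {r : ℝ | 0 < r ∧ sdsD M r = 0} rc) (hrstar : rc < rstar) :
    ∃ (δ : ℝ) (R P ρ w : ℝ → ℝ), RadialProfile M rc rstar δ R P ρ w := by
  obtain ⟨δ, ρ, hδ0, hδ2, hρ0, hρ⟩ := exists_inverse_radius hM hM1 hrc hrstar
  have hrc0 : 0 < rc := hrc.1.1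
  have hb : 0 < rc⁻¹ := inv_pos.2 hrc0
  have hpos : ∀ x ∈ Ioo (-(1 / 2)) rc⁻¹, 0 < radialPoly M x :=
    fun x hx => radialPoly_pos hM hM1 hrc hx
  have hrs : 0 < rstar := hrc0.trans hrstar
  set c := radialMap M rstar⁻¹ with hc
  have hc0 : 0 < c := mul_pos (inv_pos.2 hrs) (Real.exp_pos _)
  set I := Ioo (-δ) (2 + δ) with hI
  have hT : ∀ τ ∈ I, 0 < 2 + τ := fun τ hτ => by linarith [hτ.1]
  have hρs : ContDiffOn ℝ ∞ ρ I := fun τ hτ => (hρ τ hτ).2.1.contDiffWithinAt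
  have hmaps : MapsTo ρ I (Ioo (-(1 / 2)) rc⁻¹) := fun τ hτ => (hρ τ hτ).1
  obtain ⟨w, hw⟩ : ∃ w : ℝ → ℝ, w = fun τ => √(radialPoly M (ρ τ)) := ⟨_, rfl⟩
  -- `Θ / ρ`, with `F(ρ) = ρ exp (∫ …)` used to cancel the zero of `ρ`
  obtain ⟨R, hR⟩ : ∃ R : ℝ → ℝ,
    R = fun τ => (2 + τ) ^ 2 / (4 * c) * Real.exp (radialIntegral M (ρ τ)) := ⟨_, rfl⟩
  -- `(1 - w) / ρ`, with the removable singularity at `ρ = 0` removed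
  obtain ⟨N, hN⟩ : ∃ N : ℝ → ℝ, N = fun τ => ρ τ * (1 - M * ρ τ) / (1 + w τ) := ⟨_, rfl⟩
  have hRpos : ∀ τ ∈ I, 0 < R τ := fun τ hτ => by
    have := hT τ hτ
    rw [hR]; positivity
  have hwpos : ∀ τ ∈ I, 0 < w τ := fun τ hτ => by
    rw [hw]; exact Real.sqrt_pos.2 (hpos _ (hmaps hτ))
  have hwsq : ∀ τ ∈ I, w τ ^ 2 = 1 - ρ τ ^ 2 + M * ρ τ ^ 3 := fun τ hτ => by
    rw [hw]; exact Real.sq_sqrt (hpos _ (hmaps hτ)).le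
  have hRρ : ∀ τ ∈ I, R τ * ρ τ = 1 - τ ^ 2 / 4 := fun τ hτ => by
    have h := (hρ τ hτ).2.2
    have hT' := hT τ hτ
    rw [radialMap] at h
    rw [hR]
    calc _ = (2 + τ) ^ 2 / (4 * c) * (ρ τ * Real.exp (radialIntegral M (ρ τ))) := by ring
      _ = _ := by rw [h]; field_simp; ring
  have dρ : ∀ τ ∈ I, HasDerivAt ρ (-(w τ / R τ)) τ := fun τ hτ => by
    have hT' := hT τ hτ
    have hd := ((hρ τ hτ).2.1.differentiableAt (by simp)).hasDerivAt
    have h1 := (hasDerivAt_radialMap hb hpos (hmaps hτ)).comp τ hd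
    have h2 : HasDerivAt (fun t : ℝ => c * ((2 - t) / (2 + t))) (c * (-4 / (2 + τ) ^ 2)) τ := by
      have e := (((hasDerivAt_id τ).const_sub 2).div ((hasDerivAt_id τ).const_add 2)
        hT'.ne').const_mul c
      refine e.congr_deriv ?_
      simp only [id]
      ring
    have h3 : radialMap M ∘ ρ =ᶠ[𝓝 τ] fun t : ℝ => c * ((2 - t) / (2 + t)) := by
      filter_upwards [isOpen_Ioo.mem_nhds hτ] with t ht using (hρ t ht).2.2
    have h4 := h1.unique (h2.congr_of_eventuallyEq h3)
    have hw' := hwpos τ hτ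
    rw [show √(radialPoly M (ρ τ)) = w τ by rw [hw]] at h4
    refine hd.congr_deriv ?_
    rw [hR]
    have he := Real.exp_pos (radialIntegral M (ρ τ))
    field_simp at h4 ⊢
    linarith
  have dw : ∀ τ ∈ I, HasDerivAt w ((2 * ρ τ - 3 * M * ρ τ ^ 2) / (2 * R τ)) τ := fun τ hτ => by
    have h := dρ τ hτ
    have h1 : HasDerivAt (fun t => radialPoly M (ρ t))
        (-(2 * ρ τ * -(w τ / R τ)) + M * (3 * ρ τ ^ 2 * -(w τ / R τ))) τ := by
      refine (((h.pow 2).const_sub 1).add ((h.pow 3).const_mul M)).congr_deriv ?_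
      norm_num
    have h2 := h1.sqrt (hpos _ (hmaps hτ)).ne'
    have hw' := hwpos τ hτ
    have hR' := hRpos τ hτ
    rw [show √(radialPoly M (ρ τ)) = w τ by rw [hw]] at h2
    rw [show w = fun y => √(radialPoly M (ρ y)) from hw]
    refine h2.congr_deriv ?_
    field_simp
    ring
  have dR : ∀ τ ∈ I, HasDerivAt R (2 * R τ / (2 + τ) - N τ) τ := fun τ hτ => by
    have hT' := hT τ hτ
    have h1 := (hasDerivAt_radialIntegral hb hpos (hmaps hτ)).comp τ (dρ τ hτ)
    have h2 := ((((hasDerivAt_id τ).const_add 2).pow 2).div_const (4 * c)).mul h1.exp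
    have hw' := hwpos τ hτ
    have hR' := hRpos τ hτ
    rw [show R = fun t => (2 + t) ^ 2 / (4 * c) * Real.exp (radialIntegral M (ρ t)) from hR]
    refine h2.congr_deriv ?_
    simp only [id, radialIntegrand, Function.comp, Pi.pow_apply]
    rw [show √(radialPoly M (ρ τ)) = w τ by rw [hw]]
    have hRe : R τ = (2 + τ) ^ 2 / (4 * c) * Real.exp (radialIntegral M (ρ τ)) := by rw [hR]
    rw [hN]
    rw [hRe] at hR' ⊢
    have he := Real.exp_pos (radialIntegral M (ρ τ))
    field_simp
    ring
  have dN : ∀ τ ∈ I, HasDerivAt N (-(1 + N τ ^ 2 - 2 * M * ρ τ) / (2 * R τ)) τ := fun τ hτ => by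
    have h1 := ((dρ τ hτ).mul (((dρ τ hτ).const_mul M).const_sub 1)).div
      ((dw τ hτ).const_add 1) (by have := hwpos τ hτ; positivity)
    have hw' := hwpos τ hτ
    have hR' := hRpos τ hτ
    have hs := hwsq τ hτ
    rw [show N = fun t => ρ t * (1 - M * ρ t) / (1 + w t) from hN]
    refine h1.congr_deriv ?_
    simp only [Pi.mul_apply]
    generalize w τ = W at *
    generalize ρ τ = x at *
    generalize R τ = r at *
    have hW1 : 1 + W ≠ 0 := by positivity
    field_simp
    linear_combination (2 * M * x - 1) * hs
  have hNP : ∀ τ ∈ I, w τ = (2 * R τ / (2 + τ) - N τ) * ρ τ + τ / 2 := fun τ hτ => by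
    have hT' := hT τ hτ
    have hw' := hwpos τ hτ
    have h1 : 2 * R τ / (2 + τ) * ρ τ = 1 - τ / 2 := by
      have := hRρ τ hτ
      field_simp
      linear_combination 4 * this
    have h2 : N τ * ρ τ = 1 - w τ := by
      rw [hN]
      field_simp
      linear_combination hwsq τ hτ
    linear_combination h2 - h1
  have sw : ContDiffOn ℝ ∞ w I := by
    rw [hw]; exact (contDiffOn_sqrt_radialPoly hpos).comp hρs hmaps
  have sR : ContDiffOn ℝ ∞ R I := by
    rw [hR]
    exact (by fun_prop : ContDiff ℝ ∞ fun τ : ℝ => (2 + τ) ^ 2 / (4 * c)).contDiffOn.mul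
      ((contDiffOn_radialIntegral hb hpos).comp hρs hmaps).exp
  have sN : ContDiffOn ℝ ∞ N I := by
    rw [hN]
    refine (hρs.mul (contDiffOn_const.sub (contDiffOn_const.mul hρs))).div
      (contDiffOn_const.add sw) fun τ hτ => ?_
    have := hwpos τ hτ
    positivity
  refine ⟨δ, R, fun τ => 2 * R τ / (2 + τ) - N τ, ρ, w, hδ0, hRpos, hwpos, dR, ?_, dρ, dw,
    sR, ?_, hρs, sw, hRρ, hNP, hwsq, ?_, ?_, hρ0, ?_⟩
  · intro τ hτ
    have hT' := hT τ hτ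
    have h := (((dR τ hτ).const_mul 2).div ((hasDerivAt_id τ).const_add 2) hT'.ne').sub (dN τ hτ)
    refine h.congr_deriv ?_
    simp only [id]
    have hR' := hRpos τ hτ
    have h1 := hRρ τ hτ
    field_simp
    ring
  · exact ((contDiffOn_const.mul sR).div (contDiffOn_const.add contDiffOn_id)
      fun τ hτ => (hT τ hτ).ne').sub sN
  · intro τ hτ
    have hτ' : τ ∈ I := ⟨hτ.1, by linarith [hτ.2]⟩
    have h1 := hRρ τ hτ'
    have h2 : 0 < 1 - τ ^ 2 / 4 := by nlinarith [hτ.1, hτ.2]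
    rw [← h1] at h2
    exact pos_of_mul_pos_right h2 (hRpos τ hτ').le
  · intro τ hτ
    have hτ' : τ ∈ I := ⟨hτ.1, by linarith [hτ.2]⟩
    have h1 := hRρ τ hτ'
    have h2 : 0 < 1 - τ ^ 2 / 4 := by nlinarith [hτ.1, hτ.2]
    rw [← h1] at h2
    have h3 := pos_of_mul_pos_right h2 (hRpos τ hτ').le
    exact (lt_inv_comm₀ h3 hrc0).1 (hmaps hτ').2
  · have h0 : (0 : ℝ) ∈ I := ⟨by linarith, by linarith⟩
    have h1 := hRρ 0 h0
    rw [hρ0] at h1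
    field_simp at h1
    linarith

/-! ### Partial derivatives of scalar and matrix fields -/

section PartialDerivatives

variable {x : Pt} {F G : Pt → ℝ}

theorem pd_congr (h : F =ᶠ[𝓝 x] G) (i : Fin 4) : pd i F x = pd i G x := by
  rw [pd, pd, h.fderiv_eq]

theorem pd_const (c : ℝ) (i : Fin 4) : pd i (fun _ => c) x = 0 := by
  simp [pd]

theorem pd_add (hF : DifferentiableAt ℝ F x) (hG : DifferentiableAt ℝ G x) (i : Fin 4) :
    pd i (fun y => F y + G y) x = pd i F x + pd i G x := by
  simp [pd, fderiv_fun_add hF hG]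

theorem pd_mul (hF : DifferentiableAt ℝ F x) (hG : DifferentiableAt ℝ G x) (i : Fin 4) :
    pd i (fun y => F y * G y) x = pd i F x * G x + F x * pd i G x := by
  simp [pd, fderiv_fun_mul hF hG]
  ring

theorem pd_sum {ι : Type*} (s : Finset ι) {H : ι → Pt → ℝ}
    (hH : ∀ j ∈ s, DifferentiableAt ℝ (H j) x) (i : Fin 4) :
    pd i (fun y => ∑ j ∈ s, H j y) x = ∑ j ∈ s, pd i (H j) x := by
  simp [pd, fderiv_fun_sum hH]

theorem ContDiffOn.pd {N : Set Pt} (hN : IsOpen N) (hF : ContDiffOn ℝ ∞ F N) (i : Fin 4) :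
    ContDiffOn ℝ ∞ (fun y => ConformalSdS.pd i F y) N :=
  (hF.fderiv_of_isOpen hN (by simp)).clm_apply contDiffOn_const

theorem pd_comm (hF : ContDiffAt ℝ ∞ F x) (i j : Fin 4) :
    pd i (fun y => pd j F y) x = pd j (fun y => pd i F y) x := by
  have hd : DifferentiableAt ℝ (fderiv ℝ F) x :=
    (hF.fderiv_right (m := 1) (by norm_cast)).differentiableAt (by simp)
  have h (k l : Fin 4) : pd k (fun y => pd l F y) x =
      fderiv ℝ (fderiv ℝ F) x (Pi.single k 1) (Pi.single l 1) := by
    simp only [pd]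
    rw [fderiv_clm_apply hd (differentiableAt_const _)]
    simp
  rw [h, h]
  exact (hF.isSymmSndFDerivAt (by simpa using ENat.LEInfty.out)) _ _

end PartialDerivatives

/-- Entrywise partial derivative of a matrix field. -/
def pdM (i : Fin 4) (F : Field2) (x : Pt) : Matrix (Fin 4) (Fin 4) ℝ :=
  Matrix.of fun a b => pd i (fun y => F y a b) x

/-- Entrywise differentiability of a matrix field. -/
def DiffM (F : Field2) (x : Pt) : Prop := ∀ a b, DifferentiableAt ℝ (fun y => F y a b) x

section MatrixFields

variable {x : Pt} {F G : Field2}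

theorem pdM_congr (h : F =ᶠ[𝓝 x] G) (i : Fin 4) : pdM i F x = pdM i G x := by
  ext a b
  exact pd_congr (h.mono fun y hy => by simp only [hy]) i

theorem pdM_add (hF : DiffM F x) (hG : DiffM G x) (i : Fin 4) :
    pdM i (fun y => F y + G y) x = pdM i F x + pdM i G x := by
  ext a b
  exact pd_add (hF a b) (hG a b) i

theorem DiffM.mul (hF : DiffM F x) (hG : DiffM G x) : DiffM (fun y => F y * G y) x := by
  intro a b
  simp only [Matrix.mul_apply]
  exact DifferentiableAt.fun_sum fun c _ => (hF a c).fun_mul (hG c b)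

theorem DiffM.transpose (hF : DiffM F x) : DiffM (fun y => (F y).transpose) x :=
  fun a b => hF b a

theorem pdM_mul (hF : DiffM F x) (hG : DiffM G x) (i : Fin 4) :
    pdM i (fun y => F y * G y) x = pdM i F x * G x + F x * pdM i G x := by
  ext a b
  simp only [pdM, Matrix.of_apply, Matrix.mul_apply, Matrix.add_apply]
  rw [pd_sum _ fun c _ => (hF a c).fun_mul (hG c b), ← Finset.sum_add_distrib]
  exact Finset.sum_congr rfl fun c _ => pd_mul (hF a c) (hG c b) i

theorem pdM_transpose (i : Fin 4) :
    pdM i (fun y => (F y).transpose) x = (pdM i F x).transpose := rfl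

theorem pdM_comm (hF : ∀ a b, ContDiffAt ℝ ∞ (fun y => F y a b) x) (i j : Fin 4) :
    pdM i (fun y => pdM j F y) x = pdM j (fun y => pdM i F y) x := by
  ext a b
  exact pd_comm (hF a b) i j

end MatrixFields

/-! ### Connections with respect to a frame -/

/-- The matrix `(Γ_μ)^ν_l` of connection coefficients in the direction `μ`. -/
def connMatrix (Γ : Field3) (μ : Fin 4) : Field2 := fun p => Matrix.of fun ν l => Γ p μ ν l

/-- The matrix `(Γ_μ)^b_c` of a connection with respect to a frame, along the coordinate
direction `μ`: `∇_μ e_c = (Γ_μ)^b_c e_b`. -/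
def mixedConn (e : Field2) (Γ : Field3) (μ : Fin 4) : Field2 := fun p =>
  coframe e p * (pdM μ (fun q => (e q).transpose) p + connMatrix Γ μ p * (e p).transpose)

theorem frameConn_eq_sum (e : Field2) (Γ : Field3) (p : Pt) (a b c : Fin 4) :
    frameConn e Γ p a b c = ∑ μ, e p a μ * mixedConn e Γ μ p b c := by
  simp only [frameConn, mixedConn, Matrix.mul_apply, Matrix.add_apply, pdM, connMatrix,
    Matrix.of_apply, Matrix.transpose_apply, Finset.mul_sum]
  rw [Finset.sum_comm]
  refine Finset.sum_congr rfl fun μ _ => Finset.sum_congr rfl fun ν _ => ?_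
  ring

section Frame

variable {N : Set Pt} {e : Field2} {Γ : Field3} {p : Pt}

theorem coframe_mul (h : (e p).det ≠ 0) : coframe e p * (e p).transpose = 1 := by
  have : coframe e p = ((e p)⁻¹).transpose := rfl
  rw [this, ← Matrix.transpose_mul, Matrix.mul_nonsing_inv _ (isUnit_iff_ne_zero.2 h),
    Matrix.transpose_one]

theorem mul_coframe (h : (e p).det ≠ 0) : (e p).transpose * coframe e p = 1 := by
  have : coframe e p = ((e p)⁻¹).transpose := rfl
  rw [this, ← Matrix.transpose_mul, Matrix.nonsing_inv_mul _ (isUnit_iff_ne_zero.2 h),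
    Matrix.transpose_one]

theorem transpose_mul_mixedConn (h : (e p).det ≠ 0) (μ : Fin 4) :
    (e p).transpose * mixedConn e Γ μ p =
      pdM μ (fun q => (e q).transpose) p + connMatrix Γ μ p * (e p).transpose := by
  rw [mixedConn, ← mul_assoc, mul_coframe h, one_mul]

/-- The covariant derivative of a frame vector, expanded in the frame. -/
theorem sum_frameConn (h : (e p).det ≠ 0) (a c ν : Fin 4) :
    ∑ b, e p b ν * frameConn e Γ p a b c =
      dirDeriv e a (fun q => e q c ν) p + ∑ μ, ∑ l, e p a μ * Γ p μ ν l * e p c l := by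
  have h1 (μ : Fin 4) : ∑ b, e p b ν * mixedConn e Γ μ p b c =
      pd μ (fun q => e q c ν) p + ∑ l, Γ p μ ν l * e p c l := by
    have := congrFun (congrFun (transpose_mul_mixedConn (Γ := Γ) h μ) ν) c
    simpa only [Matrix.mul_apply, Matrix.transpose_apply, Matrix.add_apply, pdM, connMatrix,
      Matrix.of_apply] using this
  simp only [frameConn_eq_sum, Finset.mul_sum]
  rw [Finset.sum_comm, dirDeriv, ← Finset.sum_add_distrib]
  refine Finset.sum_congr rfl fun μ _ => ?_
  calc _ = e p a μ * ∑ b, e p b ν * mixedConn e Γ μ p b c := by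
        rw [Finset.mul_sum]; exact Finset.sum_congr rfl fun b _ => by ring
    _ = _ := by
        rw [h1, mul_add, Finset.mul_sum]
        exact congrArg _ (Finset.sum_congr rfl fun l _ => by ring)

theorem zeroTorsion_frameConn (h : (e p).det ≠ 0)
    (hsymm : ∀ a b c, Γ p a b c = Γ p c b a) (a b μ : Fin 4) :
    zeroTorsion e (frameConn e Γ) p a b μ = 0 := by
  have h1 := sum_frameConn (Γ := Γ) h a b μ
  have h2 := sum_frameConn (Γ := Γ) h b a μ
  have h3 : ∑ k, ∑ l, e p a k * Γ p k μ l * e p b l = ∑ k, ∑ l, e p b k * Γ p k μ l * e p a l := by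
    rw [Finset.sum_comm]
    refine Finset.sum_congr rfl fun k _ => Finset.sum_congr rfl fun l _ => ?_
    rw [hsymm]; ring
  have h4 : ∑ c, (frameConn e Γ p a c b - frameConn e Γ p b c a) * e p c μ =
      ∑ c, e p c μ * frameConn e Γ p a c b - ∑ c, e p c μ * frameConn e Γ p b c a := by
    rw [← Finset.sum_sub_distrib]
    exact Finset.sum_congr rfl fun c _ => by ring
  rw [zeroTorsion, h4, h1, h2, h3]
  ring

variable (hN : IsOpen N) (he : ∀ a μ, ContDiffOn ℝ ∞ (fun q => e q a μ) N)
  (hω : ∀ a μ, ContDiffOn ℝ ∞ (fun q => coframe e q a μ) N)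
  (hΓ : ∀ a b c, ContDiffOn ℝ ∞ (fun q => Γ q a b c) N)

include hN he hω hΓ

theorem contDiffOn_mixedConn (μ a b : Fin 4) :
    ContDiffOn ℝ ∞ (fun q => mixedConn e Γ μ q a b) N := by
  simp only [mixedConn, Matrix.mul_apply, Matrix.add_apply, Matrix.transpose_apply, pdM,
    connMatrix, Matrix.of_apply]
  exact ContDiffOn.sum fun ν _ => (hω a ν).mul ((ContDiffOn.pd hN (he b ν) μ).add
    (ContDiffOn.sum fun l _ => (hΓ μ ν l).mul (he b l)))

theorem contDiffOn_frameConn (a b c : Fin 4) :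
    ContDiffOn ℝ ∞ (fun q => frameConn e Γ q a b c) N := by
  simp only [frameConn_eq_sum]
  exact ContDiffOn.sum fun μ _ => (he a μ).mul (contDiffOn_mixedConn hN he hω hΓ μ b c)

variable (hp : p ∈ N) (hdet : ∀ q ∈ N, (e q).det ≠ 0)

include hp hdet

/-- Change of gauge for the curvature: the curvature of the connection matrices with respect to
a frame is the conjugate of the curvature of the coordinate connection matrices. -/
theorem mixedConn_curvature (μ ν : Fin 4) :
    pdM μ (mixedConn e Γ ν) p - pdM ν (mixedConn e Γ μ) p
      + (mixedConn e Γ μ p * mixedConn e Γ ν p - mixedConn e Γ ν p * mixedConn e Γ μ p) =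
    coframe e p * (pdM μ (connMatrix Γ ν) p - pdM ν (connMatrix Γ μ) p
      + (connMatrix Γ μ p * connMatrix Γ ν p - connMatrix Γ ν p * connMatrix Γ μ p))
      * (e p).transpose := by
  have hnhds := hN.mem_nhds hp
  have diff {F : Pt → ℝ} (hF : ContDiffOn ℝ ∞ F N) : DifferentiableAt ℝ F p :=
    (hF.contDiffAt hnhds).differentiableAt (by simp)
  have dF : DiffM (fun q => (e q).transpose) p := fun a b => diff (he b a)
  have dΩ (k : Fin 4) : DiffM (mixedConn e Γ k) p :=
    fun a b => diff (contDiffOn_mixedConn hN he hω hΓ k a b)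
  have dΓ (k : Fin 4) : DiffM (connMatrix Γ k) p := fun a b => diff (hΓ k a b)
  have dpF (k : Fin 4) : DiffM (fun q => pdM k (fun q => (e q).transpose) q) p :=
    fun a b => diff (ContDiffOn.pd hN (he b a) k)
  have key (k l : Fin 4) : pdM l (fun q => (e q).transpose) p * mixedConn e Γ k p
      + (e p).transpose * pdM l (mixedConn e Γ k) p =
      pdM l (fun q => pdM k (fun q => (e q).transpose) q) p
        + (pdM l (connMatrix Γ k) p * (e p).transpose
          + connMatrix Γ k p * pdM l (fun q => (e q).transpose) p) := by
    rw [← pdM_mul dF (dΩ k), ← pdM_mul (dΓ k) dF, ← pdM_add (dpF k) ((dΓ k).mul dF)]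
    refine pdM_congr ?_ l
    filter_upwards [hnhds] with q hq using transpose_mul_mixedConn (hdet q hq) k
  have hsymm := pdM_comm (F := fun q => (e q).transpose)
    (fun a b => (he b a).contDiffAt hnhds) μ ν
  have hd (k : Fin 4) : pdM k (fun q => (e q).transpose) p =
      (e p).transpose * mixedConn e Γ k p - connMatrix Γ k p * (e p).transpose :=
    eq_sub_of_add_eq (transpose_mul_mixedConn (hdet p hp) k).symm
  have k1 := key ν μ
  have k2 := key μ ν
  rw [hd] at k1 k2
  rw [hsymm] at k1
  have main : (e p).transpose * (pdM μ (mixedConn e Γ ν) p - pdM ν (mixedConn e Γ μ) p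
      + (mixedConn e Γ μ p * mixedConn e Γ ν p - mixedConn e Γ ν p * mixedConn e Γ μ p)) =
      (pdM μ (connMatrix Γ ν) p - pdM ν (connMatrix Γ μ) p
      + (connMatrix Γ μ p * connMatrix Γ ν p - connMatrix Γ ν p * connMatrix Γ μ p))
      * (e p).transpose := by
    have k3 := congrArg₂ (· - ·) k1 k2
    simp only at k3
    rw [← sub_eq_zero] at k3 ⊢
    rw [← k3]
    noncomm_ring
  rw [mul_assoc, ← main, ← mul_assoc, coframe_mul (hdet p hp), one_mul]

/-- The curvature computed from frame connection coefficients has the frame components of the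
coordinate curvature tensor. -/
theorem frameCurvature_frameConn (hsymm : ∀ q ∈ N, ∀ a b c, Γ q a b c = Γ q c b a)
    (c d a b : Fin 4) :
    frameCurvature e (frameConn e Γ) p c d a b = frameTen4 e (curvature Γ) p c d a b := by
  have hnhds := hN.mem_nhds hp
  have diff {F : Pt → ℝ} (hF : ContDiffOn ℝ ∞ F N) : DifferentiableAt ℝ F p :=
    (hF.contDiffAt hnhds).differentiableAt (by simp)
  have hde (k l : Fin 4) := diff (he k l)
  have hdΩ (k m n : Fin 4) := diff (contDiffOn_mixedConn hN he hω hΓ k m n)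
  have hD (m n k l : Fin 4) : dirDeriv e m (fun q => frameConn e Γ q n k l) p =
      ∑ ν, dirDeriv e m (fun q => e q n ν) p * mixedConn e Γ ν p k l
        + ∑ μ, ∑ ν, e p m μ * e p n ν * pd μ (fun q => mixedConn e Γ ν q k l) p := by
    have hk (μ : Fin 4) : pd μ (fun q => frameConn e Γ q n k l) p =
        ∑ ν, (pd μ (fun q => e q n ν) p * mixedConn e Γ ν p k l
          + e p n ν * pd μ (fun q => mixedConn e Γ ν q k l) p) := by
      simp only [frameConn_eq_sum]
      rw [pd_sum _ fun j _ => (hde n j).fun_mul (hdΩ j k l)]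
      exact Finset.sum_congr rfl fun j _ => pd_mul (hde n j) (hdΩ j k l) μ
    simp only [dirDeriv, hk, Finset.sum_add_distrib, mul_add, Finset.mul_sum, Finset.sum_mul]
    congr 1
    · rw [Finset.sum_comm]
      exact Finset.sum_congr rfl fun _ _ => Finset.sum_congr rfl fun _ _ => by ring
    · exact Finset.sum_congr rfl fun _ _ => Finset.sum_congr rfl fun _ _ => by ring
  have htor (ν : Fin 4) := zeroTorsion_frameConn (hdet p hp) (hsymm p hp) a b ν
  have hbr : ∑ ν, dirDeriv e a (fun q => e q b ν) p * mixedConn e Γ ν p c d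
      - ∑ ν, dirDeriv e b (fun q => e q a ν) p * mixedConn e Γ ν p c d =
      ∑ f, (frameConn e Γ p a f b - frameConn e Γ p b f a) * frameConn e Γ p f c d := by
    rw [← Finset.sum_sub_distrib]
    simp only [frameConn_eq_sum e Γ p _ c d, Finset.mul_sum]
    rw [Finset.sum_comm]
    refine Finset.sum_congr rfl fun ν _ => ?_
    have := htor ν
    rw [zeroTorsion, sub_eq_zero] at this
    rw [← sub_mul, this, Finset.sum_mul]
    exact Finset.sum_congr rfl fun f _ => by ring
  have hquad (m n : Fin 4) : ∑ f, frameConn e Γ p m c f * frameConn e Γ p n f d =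
      ∑ μ, ∑ ν, e p m μ * e p n ν * (mixedConn e Γ μ p * mixedConn e Γ ν p) c d := by
    simp_rw [frameConn_eq_sum, Matrix.mul_apply, Finset.sum_mul_sum, Finset.mul_sum]
    rw [Finset.sum_comm]
    refine Finset.sum_congr rfl fun μ _ => ?_
    rw [Finset.sum_comm]
    exact Finset.sum_congr rfl fun _ _ => Finset.sum_congr rfl fun _ _ => by ring
  have hsum : ∑ f, (frameConn e Γ p f c d * (frameConn e Γ p b f a - frameConn e Γ p a f b)
      + frameConn e Γ p b f d * frameConn e Γ p a c f
      - frameConn e Γ p a f d * frameConn e Γ p b c f) =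
      -∑ f, (frameConn e Γ p a f b - frameConn e Γ p b f a) * frameConn e Γ p f c d
      + ∑ f, frameConn e Γ p a c f * frameConn e Γ p b f d
      - ∑ f, frameConn e Γ p b c f * frameConn e Γ p a f d := by
    rw [← Finset.sum_neg_distrib, ← Finset.sum_add_distrib, ← Finset.sum_sub_distrib]
    exact Finset.sum_congr rfl fun f _ => by ring
  have hswap (H : Fin 4 → Fin 4 → ℝ) : ∑ μ, ∑ ν, e p b μ * e p a ν * H μ ν =
      ∑ μ, ∑ ν, e p a μ * e p b ν * H ν μ := by
    rw [Finset.sum_comm]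
    exact Finset.sum_congr rfl fun _ _ => Finset.sum_congr rfl fun _ _ => by ring
  have hcurv (μ ν : Fin 4) := congrFun (congrFun
    (mixedConn_curvature hN he hω hΓ hp hdet μ ν) c) d
  have hten : frameTen4 e (curvature Γ) p c d a b = ∑ μ, ∑ ν, e p a μ * e p b ν *
      (coframe e p * (pdM μ (connMatrix Γ ν) p - pdM ν (connMatrix Γ μ) p
      + (connMatrix Γ μ p * connMatrix Γ ν p - connMatrix Γ ν p * connMatrix Γ μ p))
      * (e p).transpose) c d := by
    have hR (κ l μ ν : Fin 4) : curvature Γ p κ l μ ν =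
        (pdM μ (connMatrix Γ ν) p - pdM ν (connMatrix Γ μ) p
        + (connMatrix Γ μ p * connMatrix Γ ν p - connMatrix Γ ν p * connMatrix Γ μ p)) κ l := by
      simp only [curvature, Matrix.add_apply, Matrix.sub_apply, Matrix.mul_apply, pdM, connMatrix,
        Matrix.of_apply, Finset.sum_sub_distrib]
    simp only [frameTen4, hR]
    generalize (fun μ ν => pdM μ (connMatrix Γ ν) p - pdM ν (connMatrix Γ μ) p
        + (connMatrix Γ μ p * connMatrix Γ ν p - connMatrix Γ ν p * connMatrix Γ μ p)) = Q
    simp only [Matrix.mul_apply, Matrix.transpose_apply, Finset.sum_mul, Finset.mul_sum]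
    have h1 (H : Fin 4 → Fin 4 → Fin 4 → Fin 4 → ℝ) : ∑ κ, ∑ l, ∑ μ, ∑ ν, H κ l μ ν =
        ∑ μ, ∑ ν, ∑ l, ∑ κ, H κ l μ ν := by
      calc _ = ∑ κ, ∑ μ, ∑ l, ∑ ν, H κ l μ ν := Finset.sum_congr rfl fun _ _ => Finset.sum_comm
        _ = ∑ μ, ∑ κ, ∑ l, ∑ ν, H κ l μ ν := Finset.sum_comm
        _ = ∑ μ, ∑ κ, ∑ ν, ∑ l, H κ l μ ν :=
          Finset.sum_congr rfl fun _ _ => Finset.sum_congr rfl fun _ _ => Finset.sum_comm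
        _ = ∑ μ, ∑ ν, ∑ κ, ∑ l, H κ l μ ν := Finset.sum_congr rfl fun _ _ => Finset.sum_comm
        _ = _ := Finset.sum_congr rfl fun _ _ => Finset.sum_congr rfl fun _ _ => Finset.sum_comm
    rw [h1]
    exact Finset.sum_congr rfl fun _ _ => Finset.sum_congr rfl fun _ _ =>
      Finset.sum_congr rfl fun _ _ => Finset.sum_congr rfl fun _ _ => by ring
  rw [hten]
  simp only [← hcurv]
  rw [frameCurvature, hD, hD, hsum, hquad, hquad, hswap, hswap, ← hbr]
  simp only [Matrix.add_apply, Matrix.sub_apply, mul_add, mul_sub, Finset.sum_add_distrib,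
    Finset.sum_sub_distrib, pdM, Matrix.of_apply]
  ring

omit hω hΓ in
/-- A connection compatible with `g` has antisymmetric connection coefficients with respect to a
`g`-orthonormal frame. -/
theorem frameConn_antisymm {g : Field2} (hg : DiffM g p)
    (hcompat : ∀ μ, pdM μ g p = (connMatrix Γ μ p).transpose * g p + g p * connMatrix Γ μ p)
    (horth : ∀ q ∈ N, e q * g q * (e q).transpose = eta) (a b c : Fin 4) :
    ∑ h, (frameConn e Γ p a h b * eta h c + frameConn e Γ p a h c * eta b h) = 0 := by
  have hnhds := hN.mem_nhds hp
  have dF : DiffM e p := fun a b => ((he a b).contDiffAt hnhds).differentiableAt (by simp)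
  have hmix (μ : Fin 4) : (mixedConn e Γ μ p).transpose * eta + eta * mixedConn e Γ μ p = 0 := by
    have h1 : pdM μ (fun q => e q * g q * (e q).transpose) p = 0 := by
      rw [pdM_congr (G := fun _ => eta) (by filter_upwards [hnhds] with q hq using horth q hq)]
      ext i j
      exact pd_const _ _
    rw [pdM_mul (dF.mul hg) dF.transpose, pdM_mul dF hg, hcompat] at h1
    have hd : pdM μ (fun q => (e q).transpose) p =
        (e p).transpose * mixedConn e Γ μ p - connMatrix Γ μ p * (e p).transpose :=
      eq_sub_of_add_eq (transpose_mul_mixedConn (hdet p hp) μ).symm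
    have hd' : pdM μ e p = (mixedConn e Γ μ p).transpose * e p
        - e p * (connMatrix Γ μ p).transpose := by
      have := congrArg Matrix.transpose hd
      rwa [pdM_transpose, Matrix.transpose_transpose, Matrix.transpose_sub, Matrix.transpose_mul,
        Matrix.transpose_mul, Matrix.transpose_transpose] at this
    rw [hd, hd'] at h1
    have h2 := horth p hp
    rw [← h1, ← h2]
    noncomm_ring
  have hent (μ : Fin 4) := congrFun (congrFun (hmix μ) b) c
  simp only [Matrix.add_apply, Matrix.mul_apply, Matrix.transpose_apply, Matrix.zero_apply,
    ← Finset.sum_add_distrib] at hent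
  have : ∑ h, (frameConn e Γ p a h b * eta h c + frameConn e Γ p a h c * eta b h) =
      ∑ μ, e p a μ * ∑ h, (mixedConn e Γ μ p h b * eta h c + eta b h * mixedConn e Γ μ p h c) := by
    simp only [frameConn_eq_sum, Finset.mul_sum, Finset.sum_mul, ← Finset.sum_add_distrib]
    rw [Finset.sum_comm]
    exact Finset.sum_congr rfl fun _ _ => Finset.sum_congr rfl fun _ _ => by ring
  rw [this]
  simp [hent]

end Frame

/-! ### Diagonal metrics -/

theorem pd_comp {x : Pt} {F : Pt → ℝ} {f : ℝ → ℝ} {f' : ℝ} (hf : HasDerivAt f f' (F x))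
    (hF : DifferentiableAt ℝ F x) (i : Fin 4) : pd i (fun y => f (F y)) x = f' * pd i F x := by
  have h := hf.comp_hasFDerivAt x hF.hasFDerivAt
  rw [pd, show (fun y => f (F y)) = f ∘ F from rfl, h.fderiv]
  simp [pd]

theorem differentiableAt_coord {x : Pt} (j : Fin 4) : DifferentiableAt ℝ (fun y : Pt => y j) x := by
  fun_prop

theorem pd_coord {x : Pt} (i j : Fin 4) : pd i (fun y => y j) x = if i = j then 1 else 0 := by
  have h : HasFDerivAt (fun y : Pt => y j)
      (ContinuousLinearMap.proj (R := ℝ) (φ := fun _ : Fin 4 => ℝ) j) x :=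
    hasFDerivAt_apply j x
  rw [pd, h.fderiv]
  simp [Pi.single_apply, eq_comm]

/-- The derivative of a function of one coordinate. -/
theorem pd_of_coord {x : Pt} {f : ℝ → ℝ} {f' : ℝ} {j : Fin 4} (hf : HasDerivAt f f' (x j))
    (i : Fin 4) : pd i (fun y => f (y j)) x = if i = j then f' else 0 := by
  rw [pd_comp (F := fun y => y j) hf (differentiableAt_coord j), pd_coord]
  simp

theorem inv_diagonal_of_ne_zero {v : Fin 4 → ℝ} (hv : ∀ i, v i ≠ 0) :
    (Matrix.diagonal v)⁻¹ = Matrix.diagonal fun i => (v i)⁻¹ := by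
  refine Matrix.inv_eq_right_inv ?_
  rw [Matrix.diagonal_mul_diagonal, ← Matrix.diagonal_one]
  congr 1
  ext i
  exact mul_inv_cancel₀ (hv i)

theorem pd_diagonal {x : Pt} (h : Pt → Fin 4 → ℝ) (i a b : Fin 4) :
    pd i (fun y => Matrix.diagonal (h y) a b) x = if a = b then pd i (fun y => h y a) x else 0 := by
  rcases eq_or_ne a b with rfl | hab
  · simp
  · simp [hab, Matrix.diagonal_apply_ne, pd_const]

theorem christoffel_diagonal {x : Pt} {h : Pt → Fin 4 → ℝ} (hne : ∀ i, h x i ≠ 0)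
    (a b c : Fin 4) :
    christoffel (fun y => Matrix.diagonal (h y)) x a b c =
      (if b = c then pd a (fun y => h y b) x / (2 * h x b) else 0)
        + (if b = a then pd c (fun y => h y b) x / (2 * h x b) else 0)
        - (if a = c then pd b (fun y => h y a) x / (2 * h x b) else 0) := by
  simp only [christoffel, inv_diagonal_of_ne_zero hne, pd_diagonal]
  rw [Finset.sum_eq_single b (fun e _ he => by rw [Matrix.diagonal_apply_ne _ he.symm, zero_mul])
    (by simp), Matrix.diagonal_apply_eq]
  have := hne b
  split_ifs <;> field_simp <;> ring

/-- The Levi-Civita connection of a diagonal metric is compatible with the metric. -/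
theorem christoffel_compat {x : Pt} {h : Pt → Fin 4 → ℝ} (hne : ∀ i, h x i ≠ 0) (μ : Fin 4) :
    pdM μ (fun y => Matrix.diagonal (h y)) x =
      (connMatrix (christoffel fun y => Matrix.diagonal (h y)) μ x).transpose
          * Matrix.diagonal (h x)
        + Matrix.diagonal (h x) * connMatrix (christoffel fun y => Matrix.diagonal (h y)) μ x := by
  ext a b
  simp only [pdM, Matrix.of_apply, pd_diagonal, Matrix.add_apply, Matrix.mul_diagonal,
    Matrix.diagonal_mul, Matrix.transpose_apply, connMatrix, christoffel_diagonal hne]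
  have ha := hne a
  have hb := hne b
  by_cases hab : a = b
  · subst hab
    by_cases hμ : μ = a
    · subst hμ; simp; field_simp; norm_num
    · simp [hμ, Ne.symm hμ]; field_simp; norm_num
  · by_cases hμ : μ = a
    · subst hμ; simp [hab, Ne.symm hab]; field_simp; norm_num
    · by_cases hμ' : μ = b
      · subst hμ'; simp [hab, Ne.symm hab]; field_simp; norm_num
      · simp [hab, Ne.symm hab, hμ, hμ', Ne.symm hμ, Ne.symm hμ']

/-- The general form of the Christoffel symbols of a diagonal metric `h_a δ_{ab}`:
`q_{ba} = ∂_a h_b / (2 h_b)` and `m_{ab} = ∂_b h_a / (2 h_b)`. -/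
def diagConn (q m : Pt → Matrix (Fin 4) (Fin 4) ℝ) : Field3 := fun x a b c =>
  (if b = c then q x b a else 0) + (if b = a then q x b c else 0) - (if a = c then m x a b else 0)

theorem pd_diagConn {x : Pt} {q m : Pt → Matrix (Fin 4) (Fin 4) ℝ} (hq : DiffM q x)
    (hm : DiffM m x) (i a b c : Fin 4) :
    pd i (fun y => diagConn q m y a b c) x =
      (if b = c then pdM i q x b a else 0) + (if b = a then pdM i q x b c else 0)
        - (if a = c then pdM i m x a b else 0) := by
  have h1 (k l : Fin 4) := (hq k l).hasFDerivAt
  have h2 (k l : Fin 4) := (hm k l).hasFDerivAt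
  have e1 : HasFDerivAt (fun y => if b = c then q y b a else 0)
      (if b = c then fderiv ℝ (fun y => q y b a) x else 0) x := by
    split_ifs
    exacts [h1 b a, hasFDerivAt_const _ _]
  have e2 : HasFDerivAt (fun y => if b = a then q y b c else 0)
      (if b = a then fderiv ℝ (fun y => q y b c) x else 0) x := by
    split_ifs
    exacts [h1 b c, hasFDerivAt_const _ _]
  have e3 : HasFDerivAt (fun y => if a = c then m y a b else 0)
      (if a = c then fderiv ℝ (fun y => m y a b) x else 0) x := by
    split_ifs
    exacts [h2 a b, hasFDerivAt_const _ _]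
  have := ((e1.add e2).sub e3).fderiv
  rw [pd, show (fun y => diagConn q m y a b c) = (((fun y => if b = c then q y b a else 0) +
    fun y => if b = a then q y b c else 0) - fun y => if a = c then m y a b else 0) from rfl, this]
  simp only [pdM, Matrix.of_apply, pd]
  split_ifs <;> simp

/-! ### The conformally flat metric of the sphere -/

/-- `1 + u² + v²` as a function on coordinate space. -/
def sphN (x : Pt) : ℝ := 1 + x 2 ^ 2 + x 3 ^ 2

theorem sphN_pos (x : Pt) : 0 < sphN x := by unfold sphN; positivity

theorem contDiff_sphN : ContDiff ℝ ∞ sphN := by unfold sphN; fun_prop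

theorem pd_sphN {x : Pt} (i : Fin 4) : pd i sphN x = ![0, 0, 2 * x 2, 2 * x 3] i := by
  have h2 : HasDerivAt (fun t : ℝ => t ^ 2) (2 * x 2) (x 2) := by simpa using hasDerivAt_pow 2 (x 2)
  have h3 : HasDerivAt (fun t : ℝ => t ^ 2) (2 * x 3) (x 3) := by simpa using hasDerivAt_pow 2 (x 3)
  unfold sphN
  rw [pd_add (by fun_prop) (by fun_prop), pd_add (by fun_prop) (by fun_prop), pd_const,
    pd_of_coord h2, pd_of_coord h3]
  fin_cases i <;> simp

/-- The factor of the round metric as a function on coordinate space. -/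
def sphS (x : Pt) : ℝ := sphereFactor (x 2) (x 3)

theorem sphS_eq (x : Pt) : sphS x = 4 / sphN x ^ 2 := rfl

theorem sphS_pos (x : Pt) : 0 < sphS x := by
  rw [sphS_eq]; have := sphN_pos x; positivity

theorem contDiff_sphS : ContDiff ℝ ∞ sphS :=
  contDiff_const.div (contDiff_sphN.pow 2) fun x => (pow_pos (sphN_pos x) 2).ne'

/-- Half the logarithmic derivatives of the factor of the round metric. -/
def sphLog (i : Fin 4) (x : Pt) : ℝ := ![0, 0, -2 * x 2 / sphN x, -2 * x 3 / sphN x] i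

theorem pd_sphS {x : Pt} (i : Fin 4) : pd i sphS x = 2 * sphS x * sphLog i x := by
  have hN := (sphN_pos x).ne'
  have h : HasDerivAt (fun t : ℝ => 4 / t ^ 2) (-8 / sphN x ^ 3) (sphN x) := by
    have := ((hasDerivAt_pow 2 (sphN x)).fun_inv (pow_ne_zero 2 hN)).const_mul 4
    refine (this.congr_deriv ?_).congr_of_eventuallyEq (Eventually.of_forall fun t => ?_)
    · field_simp; push_cast; ring
    · simp [div_eq_mul_inv]
  rw [show sphS = fun y => 4 / sphN y ^ 2 from rfl,
    pd_comp h (contDiff_sphN.differentiable (by simp) x), pd_sphN]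
  simp only [sphLog]
  fin_cases i <;> simp <;> field_simp <;> ring

/-- First derivatives of `sphLog`. -/
def sphHess (x : Pt) : Matrix (Fin 4) (Fin 4) ℝ :=
  ![![0, 0, 0, 0], ![0, 0, 0, 0],
    ![0, 0, -2 / sphN x + 4 * x 2 ^ 2 / sphN x ^ 2, 4 * x 2 * x 3 / sphN x ^ 2],
    ![0, 0, 4 * x 2 * x 3 / sphN x ^ 2, -2 / sphN x + 4 * x 3 ^ 2 / sphN x ^ 2]]

theorem contDiff_sphLog (i : Fin 4) : ContDiff ℝ ∞ (sphLog i) := by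
  have h (j : Fin 4) : ContDiff ℝ ∞ fun x : Pt => -2 * x j / sphN x :=
    ContDiff.div (by fun_prop) contDiff_sphN fun x => (sphN_pos x).ne'
  unfold sphLog
  fin_cases i
  exacts [contDiff_const, contDiff_const, h 2, h 3]

theorem pd_sphLog {x : Pt} (i j : Fin 4) : pd i (sphLog j) x = sphHess x i j := by
  have hN := (sphN_pos x).ne'
  have h : HasDerivAt (fun t : ℝ => t⁻¹) (-1 / sphN x ^ 2) (sphN x) := by
    simpa [neg_div] using hasDerivAt_inv hN
  have hNd := contDiff_sphN.differentiable (by simp) x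
  have hj (j : Fin 4) : pd i (fun y => -2 * y j / sphN y) x =
      (if i = j then -2 else 0) * (sphN x)⁻¹
        + -2 * x j * (-1 / sphN x ^ 2 * ![0, 0, 2 * x 2, 2 * x 3] i) := by
    have h2 : HasDerivAt (fun t : ℝ => -2 * t) (-2) (x j) := by
      simpa using (hasDerivAt_id (x j)).const_mul (-2)
    simp only [div_eq_mul_inv]
    rw [pd_mul (by fun_prop) (hNd.fun_inv hN), pd_of_coord h2, pd_comp h hNd, pd_sphN,
      div_eq_mul_inv]
  have h2 : sphLog 2 = fun y => -2 * y 2 / sphN y := rfl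
  have h3 : sphLog 3 = fun y => -2 * y 3 / sphN y := rfl
  have h0 : sphLog 0 = fun _ => 0 := rfl
  have h1 : sphLog 1 = fun _ => 0 := rfl
  fin_cases j
  · simp only [Fin.zero_eta, h0, pd_const]; fin_cases i <;> simp [sphHess]
  · simp only [Fin.mk_one, h1, pd_const]; fin_cases i <;> simp [sphHess]
  · simp only [Fin.reduceFinMk, h2, hj]
    fin_cases i <;> simp [sphHess] <;> field_simp <;> ring
  · simp only [Fin.reduceFinMk, h3, hj]
    fin_cases i <;> simp [sphHess] <;> field_simp <;> ring

/-- The sphere has curvature one. -/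
theorem sphHess_trace (x : Pt) : sphHess x 2 2 + sphHess x 3 3 = -sphS x := by
  have hN := (sphN_pos x).ne'
  have h : sphN x = 1 + x 2 ^ 2 + x 3 ^ 2 := rfl
  rw [sphS_eq]
  simp [sphHess]
  field_simp
  rw [h]
  ring

/-! ### Curvature of a Kantowski–Sachs metric -/

/-- The diagonal entries of the metric `-dτ² + A(τ)² dt² + R(τ)² σ`. -/
def ksDiag (A R : ℝ → ℝ) (x : Pt) : Fin 4 → ℝ :=
  ![-1, A (x 0) ^ 2, R (x 0) ^ 2 * sphS x, R (x 0) ^ 2 * sphS x]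

/-- The metric `-dτ² + A(τ)² dt² + R(τ)² σ` in the coordinates `(τ, t, u, v)`. -/
def ksMetric (A R : ℝ → ℝ) : Field2 := fun x => Matrix.diagonal (ksDiag A R x)

/-- The coefficients `q` of the Christoffel symbols of `ksMetric`, see `diagConn`. -/
def ksQ (A B R P : ℝ → ℝ) : Field2 := fun x =>
  ![![0, 0, 0, 0], ![B (x 0) / A (x 0), 0, 0, 0],
    ![P (x 0) / R (x 0), 0, sphLog 2 x, sphLog 3 x],
    ![P (x 0) / R (x 0), 0, sphLog 2 x, sphLog 3 x]]

/-- The coefficients `m` of the Christoffel symbols of `ksMetric`, see `diagConn`. -/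
def ksM (A B R P : ℝ → ℝ) : Field2 := fun x =>
  ![![0, 0, 0, 0], ![-(A (x 0) * B (x 0)), 0, 0, 0],
    ![-(R (x 0) * P (x 0)) * sphS x, 0, sphLog 2 x, sphLog 3 x],
    ![-(R (x 0) * P (x 0)) * sphS x, 0, sphLog 2 x, sphLog 3 x]]

/-- The sectional curvatures of the coordinate planes of `ksMetric`. -/
def ksSectional (A B C R P Q : ℝ → ℝ) (τ : ℝ) : Matrix (Fin 4) (Fin 4) ℝ :=
  ![![0, C τ / A τ, Q τ / R τ, Q τ / R τ],
    ![C τ / A τ, 0, B τ * P τ / (A τ * R τ), B τ * P τ / (A τ * R τ)],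
    ![Q τ / R τ, B τ * P τ / (A τ * R τ), 0, (1 + P τ ^ 2) / R τ ^ 2],
    ![Q τ / R τ, B τ * P τ / (A τ * R τ), (1 + P τ ^ 2) / R τ ^ 2, 0]]

theorem curvature_swap (Γ : Field3) (x : Pt) (c d a b : Fin 4) :
    curvature Γ x c d a b = -curvature Γ x c d b a := by
  simp only [curvature, Finset.sum_sub_distrib]
  ring

theorem curvature_self (Γ : Field3) (x : Pt) (c d a : Fin 4) : curvature Γ x c d a a = 0 := by
  simp [curvature]

/-- The 4-index tensor `K_{ab} (δ^c_a h_{db} - δ^c_b h_{da})`. -/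
def planeTensor (K h : Matrix (Fin 4) (Fin 4) ℝ) (c d a b : Fin 4) : ℝ :=
  K a b * (kron c a * h d b - kron c b * h d a)

section

variable {I : Set ℝ} {A B C R P Q : ℝ → ℝ} {x : Pt}

theorem ksDiag_ne (hA : A (x 0) ≠ 0) (hR : R (x 0) ≠ 0) (i : Fin 4) : ksDiag A R x i ≠ 0 := by
  have := (sphS_pos x).ne'
  fin_cases i <;> simp [ksDiag, hA, hR, this]

theorem pd_coord_mul_sphS {f : ℝ → ℝ} {f' : ℝ} {j : Fin 4} (hf : HasDerivAt f f' (x j))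
    (i : Fin 4) : pd i (fun y => f (y j) * sphS y) x =
      (if i = j then f' else 0) * sphS x + f (x j) * (2 * sphS x * sphLog i x) := by
  rw [pd_mul (hf.differentiableAt.fun_comp' x (differentiableAt_coord j))
    (contDiff_sphS.differentiable (by simp) x), pd_of_coord hf, pd_sphS]

theorem pd_ksDiag (dA : HasDerivAt A (B (x 0)) (x 0)) (dR : HasDerivAt R (P (x 0)) (x 0))
    (i b : Fin 4) : pd i (fun y => ksDiag A R y b) x =
      ![0, if i = 0 then 2 * A (x 0) * B (x 0) else 0,
        (if i = 0 then 2 * R (x 0) * P (x 0) else 0) * sphS x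
          + R (x 0) ^ 2 * (2 * sphS x * sphLog i x),
        (if i = 0 then 2 * R (x 0) * P (x 0) else 0) * sphS x
          + R (x 0) ^ 2 * (2 * sphS x * sphLog i x)] b := by
  have hA : HasDerivAt (fun t => A t ^ 2) (2 * A (x 0) * B (x 0)) (x 0) := by simpa using dA.fun_pow 2
  have hR : HasDerivAt (fun t => R t ^ 2) (2 * R (x 0) * P (x 0)) (x 0) := by simpa using dR.fun_pow 2
  fin_cases b
  · exact pd_const _ _
  · exact pd_of_coord hA i
  · exact pd_coord_mul_sphS hR i
  · exact pd_coord_mul_sphS hR i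

theorem christoffel_ksMetric (hA : A (x 0) ≠ 0) (hR : R (x 0) ≠ 0)
    (dA : HasDerivAt A (B (x 0)) (x 0)) (dR : HasDerivAt R (P (x 0)) (x 0)) :
    christoffel (ksMetric A R) x = diagConn (ksQ A B R P) (ksM A B R P) x := by
  have hS := (sphS_pos x).ne'
  have hq (b a : Fin 4) : pd a (fun y => ksDiag A R y b) x / (2 * ksDiag A R x b) =
      ksQ A B R P x b a := by
    rw [pd_ksDiag dA dR]
    fin_cases b <;> fin_cases a <;> simp [ksDiag, ksQ, sphLog] <;> field_simp
  have hm (a b : Fin 4) : pd b (fun y => ksDiag A R y a) x / (2 * ksDiag A R x b) =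
      ksM A B R P x a b := by
    rw [pd_ksDiag dA dR]
    fin_cases b <;> fin_cases a <;> simp [ksDiag, ksM, sphLog] <;> field_simp
  funext a b c
  rw [show ksMetric A R = fun y => Matrix.diagonal (ksDiag A R y) from rfl,
    christoffel_diagonal (ksDiag_ne hA hR), diagConn]
  simp only [hq, hm]

theorem diffM_ksQ (hA : A (x 0) ≠ 0) (hR : R (x 0) ≠ 0)
    (dA : HasDerivAt A (B (x 0)) (x 0)) (dB : HasDerivAt B (C (x 0)) (x 0))
    (dR : HasDerivAt R (P (x 0)) (x 0)) (dP : HasDerivAt P (Q (x 0)) (x 0)) :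
    DiffM (ksQ A B R P) x := by
  have h1 : DifferentiableAt ℝ (fun y : Pt => B (y 0) / A (y 0)) x :=
    (dB.fun_div dA hA).differentiableAt.fun_comp' x (differentiableAt_coord 0)
  have h2 : DifferentiableAt ℝ (fun y : Pt => P (y 0) / R (y 0)) x :=
    (dP.fun_div dR hR).differentiableAt.fun_comp' x (differentiableAt_coord 0)
  have h3 (j : Fin 4) : DifferentiableAt ℝ (fun y : Pt => sphLog j y) x :=
    (contDiff_sphLog j).differentiable (by simp) x
  have h0 : DifferentiableAt ℝ (fun _ : Pt => (0 : ℝ)) x := differentiableAt_const _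
  intro b a
  fin_cases b <;> fin_cases a <;> first | exact h0 | exact h1 | exact h2 | exact h3 2 | exact h3 3

theorem diffM_ksM (dA : HasDerivAt A (B (x 0)) (x 0)) (dB : HasDerivAt B (C (x 0)) (x 0))
    (dR : HasDerivAt R (P (x 0)) (x 0)) (dP : HasDerivAt P (Q (x 0)) (x 0)) :
    DiffM (ksM A B R P) x := by
  have h1 : DifferentiableAt ℝ (fun y : Pt => -(A (y 0) * B (y 0))) x :=
    DifferentiableAt.fun_comp' (g := fun t => -(A t * B t)) x
      (dA.fun_mul dB).fun_neg.differentiableAt (differentiableAt_coord 0)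
  have h2 : DifferentiableAt ℝ (fun y : Pt => -(R (y 0) * P (y 0)) * sphS y) x :=
    (DifferentiableAt.fun_comp' (g := fun t => -(R t * P t)) x
      (dR.fun_mul dP).fun_neg.differentiableAt (differentiableAt_coord 0)).fun_mul
      (contDiff_sphS.differentiable (by simp) x)
  have h3 (j : Fin 4) : DifferentiableAt ℝ (fun y : Pt => sphLog j y) x :=
    (contDiff_sphLog j).differentiable (by simp) x
  have h0 : DifferentiableAt ℝ (fun _ : Pt => (0 : ℝ)) x := differentiableAt_const _
  intro b a
  fin_cases b <;> fin_cases a <;> first | exact h0 | exact h1 | exact h2 | exact h3 2 | exact h3 3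

theorem pdM_ksQ (hA : A (x 0) ≠ 0) (hR : R (x 0) ≠ 0)
    (dA : HasDerivAt A (B (x 0)) (x 0)) (dB : HasDerivAt B (C (x 0)) (x 0))
    (dR : HasDerivAt R (P (x 0)) (x 0)) (dP : HasDerivAt P (Q (x 0)) (x 0)) (i : Fin 4) :
    pdM i (ksQ A B R P) x =
      ![![0, 0, 0, 0],
        ![if i = 0 then C (x 0) / A (x 0) - (B (x 0) / A (x 0)) ^ 2 else 0, 0, 0, 0],
        ![if i = 0 then Q (x 0) / R (x 0) - (P (x 0) / R (x 0)) ^ 2 else 0, 0,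
          sphHess x i 2, sphHess x i 3],
        ![if i = 0 then Q (x 0) / R (x 0) - (P (x 0) / R (x 0)) ^ 2 else 0, 0,
          sphHess x i 2, sphHess x i 3]] := by
  have h1 : HasDerivAt (fun t => B t / A t) (C (x 0) / A (x 0) - (B (x 0) / A (x 0)) ^ 2) (x 0) :=
    (dB.fun_div dA hA).congr_deriv (by field_simp)
  have h2 : HasDerivAt (fun t => P t / R t) (Q (x 0) / R (x 0) - (P (x 0) / R (x 0)) ^ 2) (x 0) :=
    (dP.fun_div dR hR).congr_deriv (by field_simp)
  ext b a
  fin_cases b <;> fin_cases a <;> first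
    | exact pd_const 0 i
    | exact pd_of_coord h1 i
    | exact pd_of_coord h2 i
    | exact pd_sphLog i 2
    | exact pd_sphLog i 3

theorem pdM_ksM (dA : HasDerivAt A (B (x 0)) (x 0)) (dB : HasDerivAt B (C (x 0)) (x 0))
    (dR : HasDerivAt R (P (x 0)) (x 0)) (dP : HasDerivAt P (Q (x 0)) (x 0)) (i : Fin 4) :
    pdM i (ksM A B R P) x =
      ![![0, 0, 0, 0],
        ![if i = 0 then -(B (x 0) * B (x 0) + A (x 0) * C (x 0)) else 0, 0, 0, 0],
        ![(if i = 0 then -(P (x 0) * P (x 0) + R (x 0) * Q (x 0)) else 0) * sphS x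
          + -(R (x 0) * P (x 0)) * (2 * sphS x * sphLog i x), 0, sphHess x i 2, sphHess x i 3],
        ![(if i = 0 then -(P (x 0) * P (x 0) + R (x 0) * Q (x 0)) else 0) * sphS x
          + -(R (x 0) * P (x 0)) * (2 * sphS x * sphLog i x), 0,
          sphHess x i 2, sphHess x i 3]] := by
  have h1 := (dA.fun_mul dB).fun_neg
  have h2 := (dR.fun_mul dP).fun_neg
  ext b a
  fin_cases b <;> fin_cases a <;> first
    | exact pd_const 0 i
    | exact pd_of_coord h1 i
    | exact pd_coord_mul_sphS h2 i
    | exact pd_sphLog i 2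
    | exact pd_sphLog i 3

variable (hI : IsOpen I) (hA : ∀ τ ∈ I, A τ ≠ 0) (hR : ∀ τ ∈ I, R τ ≠ 0)
  (dA : ∀ τ ∈ I, HasDerivAt A (B τ) τ) (dB : ∀ τ ∈ I, HasDerivAt B (C τ) τ)
  (dR : ∀ τ ∈ I, HasDerivAt R (P τ) τ) (dP : ∀ τ ∈ I, HasDerivAt P (Q τ) τ)

include hI hA hR dA dB dR dP in
theorem curvature_ksMetric (hx : x 0 ∈ I) (c d a b : Fin 4) :
    curvature (christoffel (ksMetric A R)) x c d a b =
      planeTensor (ksSectional A B C R P Q (x 0)) (ksMetric A R x) c d a b := by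
  have hK (a b : Fin 4) : ksSectional A B C R P Q (x 0) a b = ksSectional A B C R P Q (x 0) b a := by
    fin_cases a <;> fin_cases b <;> rfl
  wlog hab : a < b generalizing a b with H
  · rcases (not_lt.1 hab).eq_or_lt with rfl | hba
    · rw [curvature_self, planeTensor]
      ring
    · rw [curvature_swap, H b a hba, planeTensor, planeTensor, hK]
      ring
  have hnhds : ∀ᶠ y : Pt in 𝓝 x, y 0 ∈ I :=
    (continuous_apply 0).continuousAt.eventually (hI.mem_nhds hx)
  have hpd (i a b c : Fin 4) : pd i (fun y => christoffel (ksMetric A R) y a b c) x =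
      (if b = c then pdM i (ksQ A B R P) x b a else 0)
        + (if b = a then pdM i (ksQ A B R P) x b c else 0)
        - (if a = c then pdM i (ksM A B R P) x a b else 0) := by
    rw [← pd_diagConn (diffM_ksQ (hA _ hx) (hR _ hx) (dA _ hx) (dB _ hx) (dR _ hx) (dP _ hx))
      (diffM_ksM (dA _ hx) (dB _ hx) (dR _ hx) (dP _ hx))]
    refine pd_congr ?_ i
    filter_upwards [hnhds] with y hy
    rw [christoffel_ksMetric (hA _ hy) (hR _ hy) (dA _ hy) (dR _ hy)]
  have hA' := hA _ hx
  have hR' := hR _ hx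
  have hS := sphHess_trace x
  rw [curvature, hpd, hpd, christoffel_ksMetric hA' hR' (dA _ hx) (dR _ hx),
    pdM_ksQ hA' hR' (dA _ hx) (dB _ hx) (dR _ hx) (dP _ hx),
    pdM_ksQ hA' hR' (dA _ hx) (dB _ hx) (dR _ hx) (dP _ hx),
    pdM_ksM (dA _ hx) (dB _ hx) (dR _ hx) (dP _ hx),
    pdM_ksM (dA _ hx) (dB _ hx) (dR _ hx) (dP _ hx)]
  have hsym : sphHess x 3 2 = sphHess x 2 3 := rfl
  have hz (i : Fin 4) : sphHess x 0 i = 0 ∧ sphHess x 1 i = 0 := by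
    fin_cases i <;> exact ⟨rfl, rfl⟩
  have hl : sphLog 0 x = 0 ∧ sphLog 1 x = 0 := ⟨rfl, rfl⟩
  have h22 : sphHess x 2 2 = -sphS x - sphHess x 3 3 := by linarith
  simp only [planeTensor, diagConn, ksMetric, ksDiag, ksSectional, ksQ, ksM, kron,
    Fin.sum_univ_four]
  generalize A (x 0) = A0 at *
  generalize B (x 0) = B0 at *
  generalize C (x 0) = C0 at *
  generalize R (x 0) = R0 at *
  generalize P (x 0) = P0 at *
  generalize Q (x 0) = Q0 at *
  generalize sphHess x = H at *
  generalize sphS x = S0 at *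
  clear hnhds hpd
  fin_cases a <;> fin_cases b <;> first
    | exact absurd hab (by decide)
    | (fin_cases c <;> fin_cases d <;>
        simp [hsym, (hz _).1, (hz _).2, hl.1, hl.2, h22] <;> (try field_simp) <;> (try ring))

end

/-! ### Schouten and Weyl tensors of diagonal metrics with diagonal curvature -/

section PlaneTensor

variable {v : Fin 4 → ℝ}

theorem planeTensor_self (K h : Matrix (Fin 4) (Fin 4) ℝ) (c d a : Fin 4) :
    planeTensor K h c d a a = 0 := by
  simp [planeTensor]

/-- The Schouten part `2 S_{d[a}^{ce} L_{b]e}` of the curvature for `L_{ab} = ℓ_a h_{ab}`. -/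
theorem shift_schouten_eq_planeTensor (hv : ∀ i, v i ≠ 0) (l : Fin 4 → ℝ)
    {L : Matrix (Fin 4) (Fin 4) ℝ} (hL : ∀ a b, L a b = l a * Matrix.diagonal v a b)
    (c d a b : Fin 4) :
    ∑ e, (shift (Matrix.diagonal v) d a c e * L b e - shift (Matrix.diagonal v) d b c e * L a e) =
      planeTensor (fun a b => l a + l b) (Matrix.diagonal v) c d a b := by
  have h1 (F : Fin 4 → ℝ) (b : Fin 4) : ∑ e, F e * L b e = F b * (l b * v b) := by
    rw [Finset.sum_eq_single b (fun e _ he => by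
      rw [hL, Matrix.diagonal_apply_ne _ he.symm, mul_zero, mul_zero]) (by simp), hL,
      Matrix.diagonal_apply_eq]
  rw [Finset.sum_sub_distrib, h1, h1]
  simp only [shift, planeTensor, inv_diagonal_of_ne_zero hv, kron, Matrix.diagonal_apply]
  have hc := hv c
  by_cases hab : a = b
  · subst hab; ring
  by_cases hca : c = a
  · subst hca
    by_cases hdb : d = b
    · subst hdb
      simp [hab, Ne.symm hab]
      field_simp
      ring
    · by_cases hdc : d = c
      · subst hdc
        simp [hab, Ne.symm hab]
      · simp [hab, hdb, hdc]
  · by_cases hcb : c = b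
    · subst hcb
      by_cases hda : d = a
      · subst hda
        simp [hab]
        field_simp
        ring
      · by_cases hdc : d = c
        · subst hdc
          simp [hca, hab]
        · simp [hda, hdc, hca]
    · simp [hca, hcb, Ne.symm hca, Ne.symm hcb, hab, Ne.symm hab]

theorem schouten_of_planeTensor {g : Field2} {Γ : Field3} {x : Pt}
    {K : Matrix (Fin 4) (Fin 4) ℝ} (hv : ∀ i, v i ≠ 0) (hK0 : ∀ a, K a a = 0)
    (hK : ∀ a b, K a b = K b a) (hg : g x = Matrix.diagonal v)
    (hΓ : ∀ c d a b, curvature Γ x c d a b = planeTensor K (g x) c d a b) (a b : Fin 4) :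
    schouten g Γ x a b =
      (1 / 2) * (∑ c, K c a - (1 / 6) * ∑ c, ∑ d, K c d) * g x a b := by
  have hric (d b : Fin 4) : ricci Γ x d b = (∑ c, K c b) * Matrix.diagonal v d b := by
    simp only [ricci, hΓ, planeTensor, hg, mul_sub, Finset.sum_sub_distrib, Finset.sum_mul]
    have : ∑ c, K c b * (kron c b * Matrix.diagonal v d c) = 0 := by
      refine Finset.sum_eq_zero fun c _ => ?_
      rcases eq_or_ne c b with rfl | h
      · simp [hK0]
      · simp [kron, h]
    rw [this, sub_zero]
    exact Finset.sum_congr rfl fun c _ => by simp [kron]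
  have hsymm : ricci Γ x b a = ricci Γ x a b := by
    rw [hric, hric]
    rcases eq_or_ne a b with rfl | h
    · rfl
    · rw [Matrix.diagonal_apply_ne _ h, Matrix.diagonal_apply_ne _ h.symm, mul_zero, mul_zero]
  have hscal : ∑ c, ∑ d, (g x)⁻¹ c d * ricci Γ x c d = ∑ c, ∑ d, K c d := by
    refine Finset.sum_congr rfl fun c _ => ?_
    rw [hg, inv_diagonal_of_ne_zero hv, Finset.sum_eq_single c (fun d _ hd => by
      rw [Matrix.diagonal_apply_ne _ hd.symm, zero_mul]) (by simp), hric, Matrix.diagonal_apply_eq,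
      Matrix.diagonal_apply_eq, mul_comm, mul_assoc, mul_inv_cancel₀ (hv c), mul_one]
    exact Finset.sum_congr rfl fun d _ => hK _ _
  rw [schouten, hsymm, hscal, hric, hg]
  rcases eq_or_ne a b with rfl | h
  · ring
  · rw [Matrix.diagonal_apply_ne _ h]; ring

theorem weylTensor_of_planeTensor {g : Field2} {x : Pt} {K : Matrix (Fin 4) (Fin 4) ℝ}
    {l : Fin 4 → ℝ} (hv : ∀ i, v i ≠ 0) (hg : g x = Matrix.diagonal v)
    (hΓ : ∀ c d a b, curvature (christoffel g) x c d a b = planeTensor K (g x) c d a b)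
    (hL : ∀ a b, schouten g (christoffel g) x a b = l a * g x a b) (c d a b : Fin 4) :
    weylTensor g x c d a b = planeTensor (fun a b => K a b - (l a + l b)) (g x) c d a b := by
  rw [weylTensor, hΓ, hg, shift_schouten_eq_planeTensor hv l (fun a b => by rw [hL, hg])]
  simp only [planeTensor]
  ring

end PlaneTensor

/-! ### The unphysical metric -/

/-- The pattern of the Weyl tensor of type D: `1` on the planes of `(τ, t)` and of the sphere,
`-1/2` on the mixed coordinate planes. The diagonal entries are immaterial in `planeTensor`; they are
chosen so that the pattern is constant on the blocks `{0, 1}` and `{2, 3}`. -/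
def weylPattern : Matrix (Fin 4) (Fin 4) ℝ :=
  ![![1, 1, -1 / 2, -1 / 2], ![1, 1, -1 / 2, -1 / 2], ![-1 / 2, -1 / 2, 1, 1],
    ![-1 / 2, -1 / 2, 1, 1]]

/-- The eigenvalues of the Schouten tensor of the unphysical metric. -/
def schoutenEig (M : ℝ) (R P ρ w : ℝ → ℝ) (τ : ℝ) : Fin 4 → ℝ :=
  ![0, (P τ ^ 2 - 1 + 2 * M * ρ τ + P τ * ρ τ * (2 - 3 * M * ρ τ) / w τ) / (2 * R τ ^ 2),
    (1 + P τ ^ 2 - M * ρ τ) / (2 * R τ ^ 2), (1 + P τ ^ 2 - M * ρ τ) / (2 * R τ ^ 2)]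

/-- The derivative of `R w`. -/
def lapseDeriv (M : ℝ) (P ρ w : ℝ → ℝ) (τ : ℝ) : ℝ :=
  P τ * w τ + ρ τ - 3 / 2 * M * ρ τ ^ 2

/-- The second derivative of `R w`. -/
def lapseDeriv₂ (M : ℝ) (R P ρ w : ℝ → ℝ) (τ : ℝ) : ℝ :=
  (w τ * (-1 + P τ ^ 2 + 4 * M * ρ τ) + P τ * ρ τ * (2 - 3 * M * ρ τ)) / (2 * R τ)

/-- The second derivative of `R`. -/
def radiusDeriv₂ (M : ℝ) (R P ρ : ℝ → ℝ) (τ : ℝ) : ℝ :=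
  (1 + P τ ^ 2 - 2 * M * ρ τ) / (2 * R τ)

/-- The unphysical metric `-dτ² + (R w)² dt² + R² σ`. -/
def confMetric (R w : ℝ → ℝ) : Field2 := ksMetric (fun τ => R τ * w τ) R

/-- The rescaled Weyl tensor, of size `M / R³`. -/
def confWeyl (M : ℝ) (R w : ℝ → ℝ) : Field4 := fun x =>
  planeTensor ((M / R (x 0) ^ 3) • weylPattern) (confMetric R w x)

namespace RadialProfile

variable {M rc rstar δ : ℝ} {R P ρ w : ℝ → ℝ}

section

variable (h : RadialProfile M rc rstar δ R P ρ w) {τ : ℝ} (hτ : τ ∈ Ioo (-δ) (2 + δ))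

include h hτ

theorem lapse_ne : R τ * w τ ≠ 0 := (mul_pos (h.R_pos τ hτ) (h.w_pos τ hτ)).ne'

theorem deriv_lapse : HasDerivAt (fun τ => R τ * w τ) (lapseDeriv M P ρ w τ) τ := by
  refine ((h.deriv_R τ hτ).fun_mul (h.deriv_w τ hτ)).congr_deriv ?_
  have := h.R_pos τ hτ
  rw [lapseDeriv]
  field_simp
  ring

theorem deriv_lapseDeriv : HasDerivAt (lapseDeriv M P ρ w) (lapseDeriv₂ M R P ρ w τ) τ := by
  have := (((h.deriv_P τ hτ).fun_mul (h.deriv_w τ hτ)).fun_add (h.deriv_ρ τ hτ)).fun_sub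
    (((h.deriv_ρ τ hτ).fun_pow 2).const_mul (3 / 2 * M))
  refine this.congr_deriv ?_
  have := h.R_pos τ hτ
  rw [lapseDeriv₂]
  field_simp
  push_cast
  ring

theorem curvature_eq {x : Pt} (hx : x 0 = τ) (c d a b : Fin 4) :
    curvature (christoffel (confMetric R w)) x c d a b =
      planeTensor (ksSectional (fun τ => R τ * w τ) (lapseDeriv M P ρ w) (lapseDeriv₂ M R P ρ w)
        R P (radiusDeriv₂ M R P ρ) τ) (confMetric R w x) c d a b := by
  rw [← hx] at hτ ⊢
  exact curvature_ksMetric isOpen_Ioo (fun τ hτ => h.lapse_ne hτ) (fun τ hτ => (h.R_pos τ hτ).ne')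
    (fun τ hτ => h.deriv_lapse hτ) (fun τ hτ => h.deriv_lapseDeriv hτ) h.deriv_R h.deriv_P hτ c d a b

theorem diag_ne {x : Pt} (hx : x 0 = τ) (i : Fin 4) : ksDiag (fun τ => R τ * w τ) R x i ≠ 0 := by
  rw [← hx] at hτ
  exact ksDiag_ne (h.lapse_ne hτ) (h.R_pos _ hτ).ne' i

/-- The radial equations turn the Schouten tensor into an expression without a quotient by `Θ`. -/
theorem schouten_eq {x : Pt} (hx : x 0 = τ) (a b : Fin 4) :
    schouten (confMetric R w) (christoffel (confMetric R w)) x a b =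
      schoutenEig M R P ρ w τ a * confMetric R w x a b := by
  rw [schouten_of_planeTensor (g := confMetric R w) (h.diag_ne hτ hx) ?_ ?_ rfl (h.curvature_eq hτ hx)]
  · congr 1
    have hR := h.R_pos τ hτ
    have hw := h.w_pos τ hτ
    fin_cases a <;>
      simp [Fin.sum_univ_four, ksSectional, schoutenEig, lapseDeriv, lapseDeriv₂, radiusDeriv₂] <;>
      field_simp <;> ring
  · intro a; fin_cases a <;> rfl
  · intro a b; fin_cases a <;> fin_cases b <;> rfl

/-- Splitting of the sectional curvatures into a multiple of the type D pattern, which carries the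
factor `Θ = R ρ`, and a Schouten part. -/
theorem sectional_eq {a b : Fin 4} (hab : a ≠ b) :
    ksSectional (fun τ => R τ * w τ) (lapseDeriv M P ρ w) (lapseDeriv₂ M R P ρ w)
        R P (radiusDeriv₂ M R P ρ) τ a b =
      (1 - τ ^ 2 / 4) * ((M / R τ ^ 3) • weylPattern) a b
        + (schoutenEig M R P ρ w τ a + schoutenEig M R P ρ w τ b) := by
  have hR := h.R_pos τ hτ
  have hw := h.w_pos τ hτ
  rw [← h.R_mul_ρ τ hτ, Matrix.smul_apply]
  fin_cases a <;> fin_cases b <;> first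
    | exact absurd rfl hab
    | (simp [weylPattern, ksSectional, schoutenEig, lapseDeriv, lapseDeriv₂, radiusDeriv₂]
       field_simp
       ring)

/-- The curvature, decomposed into its Weyl and Schouten parts. -/
theorem curvature_eq_weyl_add_schouten {x : Pt} (hx : x 0 = τ) (c d a b : Fin 4) :
    curvature (christoffel (confMetric R w)) x c d a b =
      planeTensor (fun a b => Theta x * ((M / R τ ^ 3) • weylPattern) a b
        + (schoutenEig M R P ρ w τ a + schoutenEig M R P ρ w τ b)) (confMetric R w x) c d a b := by
  rw [h.curvature_eq hτ hx]
  rcases eq_or_ne a b with rfl | hab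
  · exact (planeTensor_self _ _ c d a).trans (planeTensor_self _ _ c d a).symm
  · simp only [planeTensor, Theta, hx, h.sectional_eq hτ hab]

/-- The Weyl tensor of the unphysical metric is `Θ` times a tensor that is regular at `Θ = 0`. -/
theorem weylTensor_eq {x : Pt} (hx : x 0 = τ) (c d a b : Fin 4) :
    weylTensor (confMetric R w) x c d a b = Theta x * confWeyl M R w x c d a b := by
  rw [weylTensor_of_planeTensor (g := confMetric R w) (h.diag_ne hτ hx) rfl (h.curvature_eq hτ hx)
    (h.schouten_eq hτ hx)]
  rcases eq_or_ne a b with rfl | hab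
  · exact (planeTensor_self _ _ c d a).trans (by rw [confWeyl, planeTensor_self, mul_zero])
  · simp only [confWeyl, planeTensor, Theta, hx, h.sectional_eq hτ hab]
    ring

/-- The evolution of the Schouten eigenvalues, in the form required by the Cotton equation with
`dΘ/dτ = -τ/2`. -/
theorem deriv_schoutenEig (a : Fin 4) : HasDerivAt (fun τ => schoutenEig M R P ρ w τ a)
    (![0, -(τ / 2 * (M / R τ ^ 3))
        - schoutenEig M R P ρ w τ 1 * (lapseDeriv M P ρ w τ / (R τ * w τ)),
      τ / 4 * (M / R τ ^ 3) - schoutenEig M R P ρ w τ 2 * (P τ / R τ),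
      τ / 4 * (M / R τ ^ 3) - schoutenEig M R P ρ w τ 3 * (P τ / R τ)] a) τ := by
  have hR := h.R_pos τ hτ
  have hw := h.w_pos τ hτ
  have dR := h.deriv_R τ hτ
  have dP := h.deriv_P τ hτ
  have dρ := h.deriv_ρ τ hτ
  have dw := h.deriv_w τ hτ
  have hτ2 : τ = 2 * (w τ - P τ * ρ τ) := by linarith [h.w_eq τ hτ]
  have d2 : HasDerivAt (fun τ => (1 + P τ ^ 2 - M * ρ τ) / (2 * R τ ^ 2))
      (τ / 4 * (M / R τ ^ 3) - (1 + P τ ^ 2 - M * ρ τ) / (2 * R τ ^ 2) * (P τ / R τ)) τ := by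
    refine ((((dP.fun_pow 2).const_add 1).fun_sub (dρ.const_mul M)).fun_div
      ((dR.fun_pow 2).const_mul 2) (by positivity)).congr_deriv ?_
    generalize hT : τ / 4 = T
    have : T = (w τ - P τ * ρ τ) / 2 := by linarith
    subst this
    field_simp
    push_cast
    ring
  fin_cases a
  · exact hasDerivAt_const _ _
  · have d1 := ((((dP.fun_pow 2).sub_const 1).fun_add (dρ.const_mul (2 * M))).fun_add
      (((dP.fun_mul dρ).fun_mul ((dρ.const_mul (3 * M)).const_sub 2)).fun_div dw hw.ne')).fun_div
      ((dR.fun_pow 2).const_mul 2) (by positivity)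
    refine d1.congr_deriv ?_
    simp only [schoutenEig, lapseDeriv, Fin.mk_one, Matrix.cons_val_one, Matrix.cons_val_zero]
    generalize hT : τ / 2 = T
    have : T = w τ - P τ * ρ τ := by linarith
    subst this
    clear d1 d2 dw dρ dR dP hT hτ2
    generalize R τ = R0 at *
    generalize P τ = P0 at *
    generalize ρ τ = x at *
    generalize w τ = W at *
    field_simp
    push_cast
    ring
  · exact d2
  · exact d2

end

end RadialProfile

/-! ### Tensors in an orthonormal frame -/

section FrameComponents

variable {e g : Field2} {p : Pt}

theorem mul_mul_transpose_of_bil (horth : ∀ a b, bil (g p) (e p a) (e p b) = eta a b) :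
    e p * g p * (e p).transpose = eta := by
  ext a b
  rw [← horth, bil, Matrix.mul_apply, Finset.sum_comm]
  refine Finset.sum_congr rfl fun ν _ => ?_
  rw [Matrix.mul_apply, Finset.sum_mul]
  refine Finset.sum_congr rfl fun μ _ => ?_
  rw [Matrix.transpose_apply]
  ring

theorem det_eta : eta.det = -1 := by
  simp [eta, Matrix.det_diagonal, Fin.prod_univ_four]

theorem eta_mul_eta : eta * eta = 1 := by
  rw [eta, Matrix.diagonal_mul_diagonal, ← Matrix.diagonal_one]
  congr 1
  ext i
  fin_cases i <;> simp

theorem frame_det_ne_zero (horth : e p * g p * (e p).transpose = eta) : (e p).det ≠ 0 := by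
  intro h0
  have := congrArg Matrix.det horth
  rw [Matrix.det_mul, Matrix.det_mul, h0, det_eta] at this
  norm_num at this

/-- The coframe of an orthonormal frame is obtained by lowering and raising indices. -/
theorem coframe_eq (hg : (g p).transpose = g p) (horth : e p * g p * (e p).transpose = eta) :
    coframe e p = eta * e p * g p := by
  have h1 : e p * (g p * (e p).transpose * eta) = 1 := by
    rw [← mul_assoc, ← mul_assoc, horth, eta_mul_eta]
  have h2 : (e p)⁻¹ = g p * (e p).transpose * eta := Matrix.inv_eq_right_inv h1
  have h3 : coframe e p = ((e p)⁻¹).transpose := rfl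
  have heta : eta.transpose = eta := by rw [eta, Matrix.diagonal_transpose]
  rw [h3, h2, Matrix.transpose_mul, Matrix.transpose_mul, hg, heta, Matrix.transpose_transpose,
    mul_assoc]

theorem sum_coframe_mul (hdet : (e p).det ≠ 0) (a b : Fin 4) :
    ∑ κ, coframe e p a κ * e p b κ = kron a b := by
  have := congrFun (congrFun (coframe_mul hdet) a) b
  rw [Matrix.mul_apply, Matrix.one_apply] at this
  simpa [kron] using this

/-- A frame adapted to the eigenspaces of `L` diagonalises it. -/
theorem frameTen2_of_eigen {L : Field2} {l : Fin 4 → ℝ}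
    (horth : ∀ a b, bil (g p) (e p a) (e p b) = eta a b)
    (hL : ∀ a b, L p a b = l a * g p a b) (hl : ∀ a μ, e p a μ * l μ = e p a μ * l a)
    (a b : Fin 4) : frameTen2 e L p a b = l a * eta a b := by
  rw [← horth, frameTen2, bil, Finset.mul_sum]
  refine Finset.sum_congr rfl fun μ _ => ?_
  rw [Finset.mul_sum]
  refine Finset.sum_congr rfl fun ν _ => ?_
  rw [hL]
  linear_combination e p b ν * g p μ ν * hl a μ

/-- Frame components of a `planeTensor`. -/
theorem frameTen4_planeTensor {T : Field4} {K : Matrix (Fin 4) (Fin 4) ℝ}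
    (hdet : (e p).det ≠ 0) (horth : ∀ a b, bil (g p) (e p a) (e p b) = eta a b)
    (hT : ∀ c d a b, T p c d a b = planeTensor K (g p) c d a b)
    (hK : ∀ a b μ ν, e p a μ * e p b ν * K μ ν = e p a μ * e p b ν * K a b) (c d a b : Fin 4) :
    frameTen4 e T p c d a b = planeTensor K eta c d a b := by
  have h1 : frameTen4 e T p c d a b = K a b * (∑ κ, ∑ l, ∑ μ, ∑ ν,
      (if κ = μ then coframe e p c κ * e p a μ * (g p l ν * e p d l * e p b ν) else 0)
      - K a b * 0) - K a b * (∑ κ, ∑ l, ∑ μ, ∑ ν,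
      (if κ = ν then coframe e p c κ * e p b ν * (g p l μ * e p d l * e p a μ) else 0)) := by
    simp only [mul_zero, sub_zero, frameTen4, Finset.mul_sum, ← Finset.sum_sub_distrib]
    refine Finset.sum_congr rfl fun κ _ => Finset.sum_congr rfl fun l _ =>
      Finset.sum_congr rfl fun μ _ => Finset.sum_congr rfl fun ν _ => ?_
    rw [hT, planeTensor]
    simp only [kron]
    have := hK a b μ ν
    split_ifs
    · linear_combination coframe e p c κ * e p d l * (g p l ν - g p l μ) * this
    · linear_combination coframe e p c κ * e p d l * (g p l ν) * this
    · linear_combination coframe e p c κ * e p d l * (- g p l μ) * this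
    · ring
  have h2 (a b : Fin 4) : ∑ κ, ∑ l, ∑ μ, ∑ ν,
      (if κ = μ then coframe e p c κ * e p a μ * (g p l ν * e p d l * e p b ν) else 0) =
      kron c a * eta d b := by
    rw [← sum_coframe_mul hdet c a, ← horth, bil, Finset.sum_mul]
    refine Finset.sum_congr rfl fun κ _ => ?_
    rw [Finset.mul_sum]
    refine Finset.sum_congr rfl fun l _ => ?_
    rw [Finset.mul_sum, Finset.sum_comm]
    refine Finset.sum_congr rfl fun ν _ => ?_
    simp
  have h3 : ∑ κ, ∑ l, ∑ μ, ∑ ν,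
      (if κ = ν then coframe e p c κ * e p b ν * (g p l μ * e p d l * e p a μ) else 0) =
      kron c b * eta d a := by
    rw [← h2]
    exact Finset.sum_congr rfl fun κ _ => Finset.sum_congr rfl fun l _ => Finset.sum_comm
  simp only [mul_zero, sub_zero] at h1
  rw [h1, h2, h3, planeTensor]
  ring

end FrameComponents

/-! ### The field equations for an adapted frame -/

/-- The frame connection coefficients of the unphysical metric: the legs `e_a` expand at the rates
`H_a`, and `x_a` is the rotation of the sphere legs. -/
def adaptedConn (H x : Fin 4 → ℝ) (a b c : Fin 4) : ℝ :=
  (if a = b ∧ c = 0 then H a else 0) + (if a = c ∧ b = 0 then H a else 0)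
    + x a * ((if b = 2 ∧ c = 3 then 1 else 0) - (if b = 3 ∧ c = 2 then 1 else 0))

section Adapted

variable {N : Set Pt} {e : Field2} {Γ : Field3} {p : Pt}

theorem dirDeriv_of_time (hN : IsOpen N) (hp : p ∈ N) (he : ∀ a, e p a 0 = kron a 0) {F : Pt → ℝ}
    {f : ℝ → ℝ} {f' : ℝ} (hF : ∀ q ∈ N, F q = f (q 0)) (hf : HasDerivAt f f' (p 0)) (a : Fin 4) :
    dirDeriv e a F p = kron a 0 * f' := by
  have : ∀ μ, pd μ F p = if μ = 0 then f' else 0 := fun μ => by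
    rw [pd_congr (G := fun q => f (q 0)) (by filter_upwards [hN.mem_nhds hp] with q hq using hF q hq),
      pd_of_coord hf]
  simp [dirDeriv, this, he]

/-- For an adapted frame the Cotton equation reduces to the evolution of the eigenvalues `l` of the
Schouten tensor: the rotation coefficients drop out since `l₂ = l₃`. -/
theorem zeroCotton_adapted {L : Field2} {d : Field4} {dc : Pt → Pt} {H x dl : Fin 4 → ℝ}
    {l : ℝ → Fin 4 → ℝ} {ψ : ℝ} (hN : IsOpen N) (hp : p ∈ N)
    (he : ∀ a, e p a 0 = kron a 0) (hΓ : ∀ a b c, Γ p a b c = adaptedConn H x a b c)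
    (hx : x 0 = 0 ∧ x 1 = 0) (hH : H 0 = 0 ∧ H 3 = H 2)
    (hL : ∀ q ∈ N, ∀ a b, L q a b = l (q 0) a * eta a b)
    (hl : ∀ a, HasDerivAt (fun t => l t a) (dl a) (p 0))
    (hd : ∀ c h a b, d p c h a b = planeTensor (ψ • weylPattern) eta c h a b)
    (hdc : ∀ a, dc p a = kron a 0 * -(p 0 / 2)) (hl0 : l (p 0) 0 = 0 ∧ l (p 0) 3 = l (p 0) 2)
    (hdl : dl 0 = 0 ∧ dl 3 = dl 2 ∧ dl 1 = -(p 0 / 2 * ψ) - l (p 0) 1 * H 1 ∧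
      dl 2 = p 0 / 4 * ψ - l (p 0) 2 * H 2) (c h b : Fin 4) :
    zeroCotton e Γ L d dc p c h b = 0 := by
  have hder (c a b : Fin 4) : dirDeriv e c (fun q => L q a b) p = kron c 0 * (dl a * eta a b) :=
    dirDeriv_of_time hN hp he (f := fun t => l t a * eta a b) (fun q hq => hL q hq a b)
      ((hl a).mul_const _) c
  simp only [zeroCotton, frameDerivTen2, hder, hL p hp, hΓ, hd, hdc, Fin.sum_univ_four,
    planeTensor, Matrix.smul_apply]
  obtain ⟨d0, d3, d1, d2⟩ := hdl
  fin_cases c <;> fin_cases h <;> fin_cases b <;>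
    simp [adaptedConn, kron, eta, weylPattern, hx.1, hx.2, hH.1, hH.2, hl0.1, hl0.2, d0, d3, d1, d2]
    <;> ring

set_option maxHeartbeats 2000000 in
/-- For an adapted frame the Bianchi equation reduces to `ψ' = -3 H₂ ψ` for the size `ψ` of the
rescaled Weyl tensor. -/
theorem zeroBianchi_adapted {d : Field4} {H x : Fin 4 → ℝ} {ψ : ℝ → ℝ} (hN : IsOpen N)
    (hp : p ∈ N) (he : ∀ a, e p a 0 = kron a 0)
    (hΓ : ∀ a b c, Γ p a b c = adaptedConn H x a b c)
    (hx : x 0 = 0 ∧ x 1 = 0) (hH : H 0 = 0 ∧ H 3 = H 2)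
    (hd : ∀ q ∈ N, ∀ c h a b, d q c h a b = planeTensor (ψ (q 0) • weylPattern) eta c h a b)
    (hψ : HasDerivAt ψ (-(3 * ψ (p 0) * H 2)) (p 0)) (b c h : Fin 4) :
    zeroBianchi e Γ d p b c h = 0 := by
  have hder (k a b c h : Fin 4) : dirDeriv e k (fun q => d q a b c h) p =
      kron k 0 * (-(3 * ψ (p 0) * H 2) * planeTensor weylPattern eta a b c h) :=
    dirDeriv_of_time hN hp he (f := fun t => ψ t * planeTensor weylPattern eta a b c h)
      (fun q hq => by
        rw [hd q hq, planeTensor, planeTensor, Matrix.smul_apply, smul_eq_mul]; ring)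
      (hψ.mul_const _) k
  have htr (a : Fin 4) : traceCov Γ p a = 0 := by
    simp only [traceCov, hΓ, Fin.sum_univ_four]
    fin_cases a <;> simp [adaptedConn, hH.1]
  simp only [zeroBianchi, frameDerivTen4, hder, hd p hp, hΓ, htr, Fin.sum_univ_four,
    planeTensor, Matrix.smul_apply]
  fin_cases b <;> fin_cases c <;> fin_cases h <;>
    simp [adaptedConn, kron, eta, weylPattern, hx.1, hx.2, hH.1, hH.2] <;> ring

end Adapted

/-! ### The Schwarzschild–de Sitter metric -/

/-- The derivative of `sdsD`. -/
def sdsD' (M r : ℝ) : ℝ := M / r ^ 2 - 2 * r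

theorem hasDerivAt_sdsD {M r : ℝ} (hr : r ≠ 0) : HasDerivAt (sdsD M) (sdsD' M r) r := by
  have h := ((hasDerivAt_inv hr).const_mul M).const_sub 1 |>.fun_sub (hasDerivAt_pow 2 r)
  refine (h.congr_of_eventuallyEq (Eventually.of_forall fun t => ?_)).congr_deriv ?_
  · simp [sdsD, div_eq_mul_inv]
  · rw [sdsD']; field_simp; push_cast; ring

theorem hasDerivAt_sdsD' {M r : ℝ} (hr : r ≠ 0) :
    HasDerivAt (sdsD' M) (-6 - 2 * sdsD' M r / r) r := by
  have h := (((hasDerivAt_pow 2 r).fun_inv (pow_ne_zero 2 hr)).const_mul M).fun_sub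
    ((hasDerivAt_id r).const_mul 2)
  refine (h.congr_of_eventuallyEq (Eventually.of_forall fun t => ?_)).congr_deriv ?_
  · simp [sdsD', div_eq_mul_inv]
  · rw [sdsD']; field_simp; push_cast; ring

theorem sdsD'_eq {M r : ℝ} (hr : r ≠ 0) : sdsD' M r = (1 - sdsD M r - 3 * r ^ 2) / r := by
  rw [sdsD', sdsD]
  field_simp
  ring

/-- The diagonal entries of the Schwarzschild–de Sitter metric. -/
def sdsDiag (M : ℝ) (x : Pt) : Fin 4 → ℝ :=
  ![-sdsD M (x 1), (sdsD M (x 1))⁻¹, (x 1) ^ 2 * sphS x, (x 1) ^ 2 * sphS x]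

/-- The coefficients `q` of the Christoffel symbols of `sdsMetric`, see `diagConn`. -/
def sdsQ (M : ℝ) : Field2 := fun x =>
  ![![0, sdsD' M (x 1) / (2 * sdsD M (x 1)), 0, 0],
    ![0, -(sdsD' M (x 1) / (2 * sdsD M (x 1))), 0, 0],
    ![0, (x 1)⁻¹, sphLog 2 x, sphLog 3 x], ![0, (x 1)⁻¹, sphLog 2 x, sphLog 3 x]]

/-- The coefficients `m` of the Christoffel symbols of `sdsMetric`, see `diagConn`. -/
def sdsMCoeff (M : ℝ) : Field2 := fun x =>
  ![![0, -(sdsD' M (x 1) * sdsD M (x 1) / 2), 0, 0],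
    ![0, -(sdsD' M (x 1) / (2 * sdsD M (x 1))), 0, 0],
    ![0, x 1 * sdsD M (x 1) * sphS x, sphLog 2 x, sphLog 3 x],
    ![0, x 1 * sdsD M (x 1) * sphS x, sphLog 2 x, sphLog 3 x]]

/-- The sectional curvatures of the coordinate planes of the Schwarzschild–de Sitter metric. -/
def sdsSectional (M r : ℝ) : Matrix (Fin 4) (Fin 4) ℝ :=
  ![![0, 3 + sdsD' M r / r, -(sdsD' M r / (2 * r)), -(sdsD' M r / (2 * r))],
    ![3 + sdsD' M r / r, 0, -(sdsD' M r / (2 * r)), -(sdsD' M r / (2 * r))],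
    ![-(sdsD' M r / (2 * r)), -(sdsD' M r / (2 * r)), 0, (1 - sdsD M r) / r ^ 2],
    ![-(sdsD' M r / (2 * r)), -(sdsD' M r / (2 * r)), (1 - sdsD M r) / r ^ 2, 0]]

section

variable {M : ℝ} {x : Pt}

theorem sdsDiag_ne (hr : x 1 ≠ 0) (hD : sdsD M (x 1) ≠ 0) (i : Fin 4) : sdsDiag M x i ≠ 0 := by
  have := (sphS_pos x).ne'
  fin_cases i <;> simp [sdsDiag, hr, hD, this]

theorem pd_sdsDiag (hr : x 1 ≠ 0) (hD : sdsD M (x 1) ≠ 0) (i b : Fin 4) :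
    pd i (fun y => sdsDiag M y b) x =
      ![if i = 1 then -sdsD' M (x 1) else 0,
        if i = 1 then -sdsD' M (x 1) / sdsD M (x 1) ^ 2 else 0,
        (if i = 1 then 2 * x 1 else 0) * sphS x + (x 1) ^ 2 * (2 * sphS x * sphLog i x),
        (if i = 1 then 2 * x 1 else 0) * sphS x + (x 1) ^ 2 * (2 * sphS x * sphLog i x)] b := by
  have h2 : HasDerivAt (fun t : ℝ => t ^ 2) (2 * x 1) (x 1) := by simpa using hasDerivAt_pow 2 (x 1)
  fin_cases b
  · exact pd_of_coord (hasDerivAt_sdsD hr).fun_neg i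
  · exact pd_of_coord ((hasDerivAt_sdsD hr).fun_inv hD) i
  · exact pd_coord_mul_sphS h2 i
  · exact pd_coord_mul_sphS h2 i

theorem christoffel_sdsMetric (hr : x 1 ≠ 0) (hD : sdsD M (x 1) ≠ 0) :
    christoffel (sdsMetric M) x = diagConn (sdsQ M) (sdsMCoeff M) x := by
  have hS := (sphS_pos x).ne'
  have hq (b a : Fin 4) : pd a (fun y => sdsDiag M y b) x / (2 * sdsDiag M x b) =
      sdsQ M x b a := by
    rw [pd_sdsDiag hr hD]
    fin_cases b <;> fin_cases a <;> simp [sdsDiag, sdsQ, sphLog] <;> field_simp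
  have hm (a b : Fin 4) : pd b (fun y => sdsDiag M y a) x / (2 * sdsDiag M x b) =
      sdsMCoeff M x a b := by
    rw [pd_sdsDiag hr hD]
    fin_cases b <;> fin_cases a <;> simp [sdsDiag, sdsMCoeff, sphLog] <;> field_simp
  funext a b c
  rw [show sdsMetric M = fun y => Matrix.diagonal (sdsDiag M y) from rfl,
    christoffel_diagonal (sdsDiag_ne hr hD), diagConn]
  simp only [hq, hm]

theorem hasDerivAt_sds_coeff {r : ℝ} (hr : r ≠ 0) (hD : sdsD M r ≠ 0) :
    HasDerivAt (fun t => sdsD' M t / (2 * sdsD M t))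
      ((-6 - 2 * sdsD' M r / r) / (2 * sdsD M r) - (sdsD' M r / sdsD M r) ^ 2 / 2) r := by
  refine ((hasDerivAt_sdsD' hr).fun_div ((hasDerivAt_sdsD hr).const_mul 2)
    (mul_ne_zero two_ne_zero hD)).congr_deriv ?_
  field_simp

theorem diffM_sdsQ (hr : x 1 ≠ 0) (hD : sdsD M (x 1) ≠ 0) : DiffM (sdsQ M) x := by
  have hc := (hasDerivAt_sds_coeff hr hD).differentiableAt
  have h1 : DifferentiableAt ℝ (fun y : Pt => sdsD' M (y 1) / (2 * sdsD M (y 1))) x :=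
    hc.fun_comp' x (differentiableAt_coord 1)
  have h2 : DifferentiableAt ℝ (fun y : Pt => (y 1)⁻¹) x :=
    (differentiableAt_coord 1).fun_inv hr
  have h3 (j : Fin 4) : DifferentiableAt ℝ (fun y : Pt => sphLog j y) x :=
    (contDiff_sphLog j).differentiable (by simp) x
  have h0 : DifferentiableAt ℝ (fun _ : Pt => (0 : ℝ)) x := differentiableAt_const _
  intro b a
  fin_cases b <;> fin_cases a <;>
    first | exact h0 | exact h1 | exact h1.fun_neg | exact h2 | exact h3 2 | exact h3 3

theorem diffM_sdsMCoeff (hr : x 1 ≠ 0) (hD : sdsD M (x 1) ≠ 0) : DiffM (sdsMCoeff M) x := by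
  have hc := (hasDerivAt_sds_coeff hr hD).differentiableAt
  have h1 : DifferentiableAt ℝ (fun y : Pt => sdsD' M (y 1) / (2 * sdsD M (y 1))) x :=
    hc.fun_comp' x (differentiableAt_coord 1)
  have h2 : DifferentiableAt ℝ (fun y : Pt => -(sdsD' M (y 1) * sdsD M (y 1) / 2)) x :=
    DifferentiableAt.fun_comp' (g := fun t => -(sdsD' M t * sdsD M t / 2)) x
      (((hasDerivAt_sdsD' hr).fun_mul (hasDerivAt_sdsD hr)).div_const 2).fun_neg.differentiableAt
      (differentiableAt_coord 1)
  have h4 : DifferentiableAt ℝ (fun y : Pt => y 1 * sdsD M (y 1) * sphS y) x :=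
    (DifferentiableAt.fun_comp' (g := fun t => t * sdsD M t) x
      ((hasDerivAt_id (x 1)).fun_mul (hasDerivAt_sdsD hr)).differentiableAt
      (differentiableAt_coord 1)).fun_mul (contDiff_sphS.differentiable (by simp) x)
  have h3 (j : Fin 4) : DifferentiableAt ℝ (fun y : Pt => sphLog j y) x :=
    (contDiff_sphLog j).differentiable (by simp) x
  have h0 : DifferentiableAt ℝ (fun _ : Pt => (0 : ℝ)) x := differentiableAt_const _
  intro b a
  fin_cases b <;> fin_cases a <;>
    first | exact h0 | exact h1.fun_neg | exact h2 | exact h4 | exact h3 2 | exact h3 3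

theorem pdM_sdsQ (hr : x 1 ≠ 0) (hD : sdsD M (x 1) ≠ 0) (i : Fin 4) :
    pdM i (sdsQ M) x =
      ![![0, if i = 1 then (-6 - 2 * sdsD' M (x 1) / x 1) / (2 * sdsD M (x 1))
          - (sdsD' M (x 1) / sdsD M (x 1)) ^ 2 / 2 else 0, 0, 0],
        ![0, if i = 1 then -((-6 - 2 * sdsD' M (x 1) / x 1) / (2 * sdsD M (x 1))
          - (sdsD' M (x 1) / sdsD M (x 1)) ^ 2 / 2) else 0, 0, 0],
        ![0, if i = 1 then -(x 1 ^ 2)⁻¹ else 0, sphHess x i 2, sphHess x i 3],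
        ![0, if i = 1 then -(x 1 ^ 2)⁻¹ else 0, sphHess x i 2, sphHess x i 3]] := by
  have h1 := hasDerivAt_sds_coeff hr hD
  ext b a
  fin_cases b <;> fin_cases a <;> first
    | exact pd_const 0 i
    | exact pd_of_coord h1 i
    | exact pd_of_coord h1.fun_neg i
    | exact pd_of_coord (hasDerivAt_inv hr) i
    | exact pd_sphLog i 2
    | exact pd_sphLog i 3

theorem pdM_sdsMCoeff (hr : x 1 ≠ 0) (hD : sdsD M (x 1) ≠ 0) (i : Fin 4) :
    pdM i (sdsMCoeff M) x =
      ![![0, if i = 1 then -(((-6 - 2 * sdsD' M (x 1) / x 1) * sdsD M (x 1)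
          + sdsD' M (x 1) * sdsD' M (x 1)) / 2) else 0, 0, 0],
        ![0, if i = 1 then -((-6 - 2 * sdsD' M (x 1) / x 1) / (2 * sdsD M (x 1))
          - (sdsD' M (x 1) / sdsD M (x 1)) ^ 2 / 2) else 0, 0, 0],
        ![0, (if i = 1 then 1 * sdsD M (x 1) + x 1 * sdsD' M (x 1) else 0) * sphS x
          + x 1 * sdsD M (x 1) * (2 * sphS x * sphLog i x), sphHess x i 2, sphHess x i 3],
        ![0, (if i = 1 then 1 * sdsD M (x 1) + x 1 * sdsD' M (x 1) else 0) * sphS x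
          + x 1 * sdsD M (x 1) * (2 * sphS x * sphLog i x), sphHess x i 2, sphHess x i 3]] := by
  have h1 := (hasDerivAt_sds_coeff hr hD).fun_neg
  have h2 := (((hasDerivAt_sdsD' (M := M) hr).fun_mul (hasDerivAt_sdsD (M := M) hr)).div_const 2).fun_neg
  have h3 := (hasDerivAt_id' (x 1)).fun_mul (hasDerivAt_sdsD (M := M) hr)
  ext b a
  fin_cases b <;> fin_cases a <;> first
    | exact pd_const 0 i
    | exact pd_of_coord h1 i
    | exact pd_of_coord h2 i
    | exact pd_coord_mul_sphS h3 i
    | exact pd_sphLog i 2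
    | exact pd_sphLog i 3

theorem continuousAt_sdsD_coord (hr : x 1 ≠ 0) : ContinuousAt (fun y : Pt => sdsD M (y 1)) x :=
  ContinuousAt.comp (g := sdsD M) (hasDerivAt_sdsD hr).continuousAt
    (continuous_apply 1).continuousAt

theorem curvature_sdsMetric (hr : x 1 ≠ 0) (hD : sdsD M (x 1) ≠ 0) (c d a b : Fin 4) :
    curvature (christoffel (sdsMetric M)) x c d a b =
      planeTensor (sdsSectional M (x 1)) (sdsMetric M x) c d a b := by
  have hK (a b : Fin 4) : sdsSectional M (x 1) a b = sdsSectional M (x 1) b a := by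
    fin_cases a <;> fin_cases b <;> rfl
  wlog hab : a < b generalizing a b with H
  · rcases (not_lt.1 hab).eq_or_lt with rfl | hba
    · rw [curvature_self, planeTensor]
      ring
    · rw [curvature_swap, H b a hba, planeTensor, planeTensor, hK]
      ring
  have hnhds : ∀ᶠ y : Pt in 𝓝 x, y 1 ≠ 0 ∧ sdsD M (y 1) ≠ 0 :=
    ((continuous_apply 1).continuousAt.eventually_ne hr).and
      ((continuousAt_sdsD_coord hr).eventually_ne hD)
  have hpd (i a b c : Fin 4) : pd i (fun y => christoffel (sdsMetric M) y a b c) x =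
      (if b = c then pdM i (sdsQ M) x b a else 0)
        + (if b = a then pdM i (sdsQ M) x b c else 0)
        - (if a = c then pdM i (sdsMCoeff M) x a b else 0) := by
    rw [← pd_diagConn (diffM_sdsQ hr hD) (diffM_sdsMCoeff hr hD)]
    refine pd_congr ?_ i
    filter_upwards [hnhds] with y hy
    rw [christoffel_sdsMetric hy.1 hy.2]
  have hS := sphHess_trace x
  have hg : sdsMetric M x = Matrix.diagonal (sdsDiag M x) := rfl
  rw [curvature, hpd, hpd, christoffel_sdsMetric hr hD, pdM_sdsQ hr hD, pdM_sdsQ hr hD,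
    pdM_sdsMCoeff hr hD, pdM_sdsMCoeff hr hD]
  have hsym : sphHess x 3 2 = sphHess x 2 3 := rfl
  have hz (i : Fin 4) : sphHess x 0 i = 0 ∧ sphHess x 1 i = 0 := by
    fin_cases i <;> exact ⟨rfl, rfl⟩
  have hl : sphLog 0 x = 0 ∧ sphLog 1 x = 0 := ⟨rfl, rfl⟩
  have h22 : sphHess x 2 2 = -sphS x - sphHess x 3 3 := by linarith
  simp only [planeTensor, diagConn, hg, sdsDiag, sdsSectional, sdsQ, sdsMCoeff, kron,
    Fin.sum_univ_four]
  generalize sphHess x = H at *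
  generalize sphS x = S0 at *
  generalize sdsD' M (x 1) = E0 at *
  generalize sdsD M (x 1) = D0 at *
  generalize x 1 = r at *
  clear hnhds hpd
  fin_cases a <;> fin_cases b <;> first
    | exact absurd hab (by decide)
    | (fin_cases c <;> fin_cases d <;>
        simp [hsym, (hz _).1, (hz _).2, hl.1, hl.2, h22] <;> (try field_simp) <;> (try ring))

/-- The Schwarzschild–de Sitter metric is Einstein: its Schouten tensor is half the metric. -/
theorem schouten_sdsMetric (hr : x 1 ≠ 0) (hD : sdsD M (x 1) ≠ 0) (a b : Fin 4) :
    schouten (sdsMetric M) (christoffel (sdsMetric M)) x a b = 1 / 2 * sdsMetric M x a b := by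
  rw [schouten_of_planeTensor (g := sdsMetric M) (K := sdsSectional M (x 1)) (sdsDiag_ne hr hD)
    ?_ ?_ rfl (curvature_sdsMetric hr hD)]
  · congr 1
    have h := sdsD'_eq (M := M) hr
    fin_cases a <;> simp [Fin.sum_univ_four, sdsSectional, h] <;> field_simp <;> ring
  · intro a; fin_cases a <;> rfl
  · intro a b; fin_cases a <;> fin_cases b <;> rfl

end

/-! ### The congruence of conformal geodesics -/

/-- The congruence in the coordinates `(t, r, u, v)`: the curves are radial, with `r = 1 / ρ(τ)`. -/
def radialCongruence (ρ : ℝ → ℝ) : Pt → Pt := fun p => ![p 1, (ρ (p 0))⁻¹, p 2, p 3]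

/-- The covector `β = Θ⁻¹ dΘ` of the congruence, in the coordinates `(t, r, u, v)`. -/
def radialCovector (ρ w : ℝ → ℝ) : Pt → Pt := fun p => ![0, -(p 0 * ρ (p 0)) / (2 * w (p 0)), 0, 0]

/-- Covariant differentiation along a radial curve only involves the coefficients `q_{b1}`. -/
theorem covDerivVec_radial {M r' : ℝ} {x v : ℝ → Pt} {τ : ℝ} (hr : x τ 1 ≠ 0)
    (hD : sdsD M (x τ 1) ≠ 0) (hx : deriv x τ = ![0, r', 0, 0]) (b : Fin 4) :
    covDerivVec (sdsMetric M) x v τ b = deriv v τ b + sdsQ M (x τ) b 1 * r' * v τ b := by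
  rw [covDerivVec, christoffel_sdsMetric hr hD, hx]
  congr 1
  fin_cases b <;> simp [diagConn, Fin.sum_univ_four, sdsQ, sdsMCoeff]

theorem covDerivCov_radial {M r' : ℝ} {x v : ℝ → Pt} {τ : ℝ} (hr : x τ 1 ≠ 0)
    (hD : sdsD M (x τ 1) ≠ 0) (hx : deriv x τ = ![0, r', 0, 0]) (b : Fin 4) :
    covDerivCov (sdsMetric M) x v τ b = deriv v τ b - sdsQ M (x τ) b 1 * r' * v τ b := by
  rw [covDerivCov, christoffel_sdsMetric hr hD, hx]
  congr 1
  fin_cases b <;> simp [diagConn, Fin.sum_univ_four, sdsQ, sdsMCoeff]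

namespace RadialProfile

variable {M rc rstar δ : ℝ} {R P ρ w : ℝ → ℝ} (h : RadialProfile M rc rstar δ R P ρ w) {τ : ℝ}

include h

theorem phys_subset (hτ : τ ∈ Ioo (-δ) 2) : τ ∈ Ioo (-δ) (2 + δ) :=
  ⟨hτ.1, by linarith [hτ.2, h.δ_pos]⟩

section

variable (hτ : τ ∈ Ioo (-δ) 2)

include hτ

theorem sdsD_eq : sdsD M (ρ τ)⁻¹ = -(w τ ^ 2 / ρ τ ^ 2) := by
  have hρ := h.ρ_pos τ hτ
  rw [h.w_sq τ (h.phys_subset hτ), sdsD]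
  field_simp
  ring

theorem sdsD_ne : sdsD M (ρ τ)⁻¹ ≠ 0 := by
  have hρ := h.ρ_pos τ hτ
  have hw := h.w_pos τ (h.phys_subset hτ)
  rw [h.sdsD_eq hτ]
  exact neg_ne_zero.2 (by positivity)

/-- The velocity `dr/dτ`. -/
theorem deriv_radius : HasDerivAt (fun τ => (ρ τ)⁻¹) (w τ / (R τ * ρ τ ^ 2)) τ := by
  have hρ := h.ρ_pos τ hτ
  have hτ' := h.phys_subset hτ
  have hR := h.R_pos τ hτ'
  refine ((h.deriv_ρ τ hτ').fun_inv hρ.ne').congr_deriv ?_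
  field_simp

theorem deriv_curve (t u v : ℝ) :
    HasDerivAt (fun τ => ![t, (ρ τ)⁻¹, u, v]) (![0, w τ / (R τ * ρ τ ^ 2), 0, 0] : Pt) τ := by
  rw [hasDerivAt_pi]
  intro i
  fin_cases i
  · exact hasDerivAt_const _ _
  · exact h.deriv_radius hτ
  · exact hasDerivAt_const _ _
  · exact hasDerivAt_const _ _

/-- The rate of `r'` is `-Θ'/Θ` up to the Christoffel term. -/
theorem deriv_velocity : HasDerivAt (fun τ => w τ / (R τ * ρ τ ^ 2))
    (τ / (2 * (R τ * ρ τ)) * (w τ / (R τ * ρ τ ^ 2))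
      + sdsD' M (ρ τ)⁻¹ / (2 * sdsD M (ρ τ)⁻¹) * (w τ / (R τ * ρ τ ^ 2))
        * (w τ / (R τ * ρ τ ^ 2))) τ := by
  have hρ := h.ρ_pos τ hτ
  have hτ' := h.phys_subset hτ
  have hR := h.R_pos τ hτ'
  have hw := h.w_pos τ hτ'
  have hs := h.w_sq τ hτ'
  have hτ2 : τ / (2 * (R τ * ρ τ)) = (w τ - P τ * ρ τ) / (R τ * ρ τ) := by
    rw [div_eq_div_iff (by positivity) (by positivity)]
    linear_combination (-2) * (R τ * ρ τ) * h.w_eq τ hτ'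
  refine ((h.deriv_w τ hτ').fun_div ((h.deriv_R τ hτ').fun_mul ((h.deriv_ρ τ hτ').fun_pow 2))
    (by positivity)).congr_deriv ?_
  rw [hτ2, h.sdsD_eq hτ, sdsD']
  generalize R τ = R0 at *
  generalize P τ = P0 at *
  generalize ρ τ = y at *
  generalize w τ = W at *
  field_simp
  push_cast
  linear_combination (2 * y) * hs

theorem deriv_covector : HasDerivAt (fun τ => -(τ * ρ τ) / (2 * w τ))
    (-(sdsD' M (ρ τ)⁻¹ / (2 * sdsD M (ρ τ)⁻¹) * (w τ / (R τ * ρ τ ^ 2))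
        * (-(τ * ρ τ) / (2 * w τ)))
      - ρ τ / (2 * w τ)) τ := by
  have hρ := h.ρ_pos τ hτ
  have hτ' := h.phys_subset hτ
  have hR := h.R_pos τ hτ'
  have hw := h.w_pos τ hτ'
  have hs := h.w_sq τ hτ'
  refine (((hasDerivAt_id' τ).fun_mul (h.deriv_ρ τ hτ')).fun_neg.fun_div
    ((h.deriv_w τ hτ').const_mul 2) (by positivity)).congr_deriv ?_
  rw [h.sdsD_eq hτ, sdsD']
  generalize R τ = R0 at *
  generalize P τ = P0 at *
  generalize ρ τ = y at *
  generalize w τ = W at *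
  field_simp
  linear_combination (2 * τ) * hs

/-- Along the radial curves, Weyl propagation multiplies each component by the rate
`-Θ'/Θ = τ / (2 Θ)`, up to the Christoffel term. -/
theorem weyl_rhs (v : Pt) (b : Fin 4) (t u u' : ℝ) :
    (-(pairing ![0, -(τ * ρ τ) / (2 * w τ), 0, 0] v) • (![0, w τ / (R τ * ρ τ ^ 2), 0, 0] : Pt)
      - pairing ![0, -(τ * ρ τ) / (2 * w τ), 0, 0] ![0, w τ / (R τ * ρ τ ^ 2), 0, 0] • v
      + bil (sdsMetric M ![t, (ρ τ)⁻¹, u, u']) v ![0, w τ / (R τ * ρ τ ^ 2), 0, 0]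
        • sharp (sdsMetric M ![t, (ρ τ)⁻¹, u, u']) ![0, -(τ * ρ τ) / (2 * w τ), 0, 0]) b =
      τ / (2 * (R τ * ρ τ)) * v b := by
  have hρ := h.ρ_pos τ hτ
  have hτ' := h.phys_subset hτ
  have hR := h.R_pos τ hτ'
  have hw := h.w_pos τ hτ'
  have hD := h.sdsD_ne hτ
  have hg : sdsMetric M ![t, (ρ τ)⁻¹, u, u'] =
    Matrix.diagonal (sdsDiag M ![t, (ρ τ)⁻¹, u, u']) := rfl
  have hinv := inv_diagonal_of_ne_zero
    (sdsDiag_ne (M := M) (x := ![t, (ρ τ)⁻¹, u, u']) (inv_ne_zero hρ.ne') hD)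
  have h11 : sdsDiag M ![t, (ρ τ)⁻¹, u, u'] 1 = (sdsD M (ρ τ)⁻¹)⁻¹ := rfl
  rw [hg]
  simp only [sharp, hinv, bil, pairing, Fin.sum_univ_four, Pi.add_apply, Pi.sub_apply,
    Pi.smul_apply, smul_eq_mul]
  fin_cases b <;> simp [h11] <;>
    (generalize sdsD M (ρ τ)⁻¹ = D at *; field_simp <;> ring)

end

/-- A vector field along a radial curve whose components have the right rates is Weyl
propagated. -/
theorem weylPropagated {t u u' : ℝ} {v : ℝ → Pt} (hv : ∀ τ ∈ Ioo (-δ) 2, HasDerivAt v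
    (fun b => τ / (2 * (R τ * ρ τ)) * v τ b
      - sdsQ M ![t, (ρ τ)⁻¹, u, u'] b 1 * (w τ / (R τ * ρ τ ^ 2)) * v τ b) τ) :
    IsWeylPropagatedOn (sdsMetric M) (Ioo (-δ) 2) (fun τ => radialCongruence ρ ![τ, t, u, u'])
      (fun τ => radialCovector ρ w ![τ, t, u, u']) v := by
  refine ⟨fun τ hτ => (hv τ hτ).differentiableAt, fun τ hτ => ?_⟩
  have hd : deriv (fun τ => radialCongruence ρ ![τ, t, u, u']) τ =
      ![0, w τ / (R τ * ρ τ ^ 2), 0, 0] := (h.deriv_curve hτ t u u').deriv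
  have hρ := h.ρ_pos τ hτ
  funext b
  rw [covDerivVec_radial (inv_ne_zero hρ.ne') (h.sdsD_ne hτ) hd, (hv τ hτ).deriv]
  rw [hd]
  refine Eq.trans ?_ (h.weyl_rhs hτ (v τ) b t u u').symm
  simp [radialCongruence]

theorem isConformalGeodesicOn (t u u' : ℝ) :
    IsConformalGeodesicOn (sdsMetric M) (Ioo (-δ) 2) (fun τ => radialCongruence ρ ![τ, t, u, u'])
      (fun τ => radialCovector ρ w ![τ, t, u, u']) := by
  have hderiv : ∀ τ ∈ Ioo (-δ) 2, deriv (fun τ => radialCongruence ρ ![τ, t, u, u']) τ =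
      ![0, w τ / (R τ * ρ τ ^ 2), 0, 0] := fun τ hτ => (h.deriv_curve hτ t u u').deriv
  have hacc : ∀ τ ∈ Ioo (-δ) 2, HasDerivAt (deriv fun τ => radialCongruence ρ ![τ, t, u, u'])
      (fun b => τ / (2 * (R τ * ρ τ)) * deriv (fun τ => radialCongruence ρ ![τ, t, u, u']) τ b
        - sdsQ M ![t, (ρ τ)⁻¹, u, u'] b 1 * (w τ / (R τ * ρ τ ^ 2))
          * deriv (fun τ => radialCongruence ρ ![τ, t, u, u']) τ b) τ := fun τ hτ => by
    have e : deriv (fun τ => radialCongruence ρ ![τ, t, u, u']) =ᶠ[𝓝 τ]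
        fun τ => ![0, w τ / (R τ * ρ τ ^ 2), 0, 0] := by
      filter_upwards [isOpen_Ioo.mem_nhds hτ] with s hs using hderiv s hs
    refine HasDerivAt.congr_of_eventuallyEq ?_ e
    rw [hderiv τ hτ, hasDerivAt_pi]
    intro b
    fin_cases b
    · simpa using hasDerivAt_const τ (0 : ℝ)
    · refine (h.deriv_velocity hτ).congr_deriv ?_
      simp [sdsQ]
    · simpa using hasDerivAt_const τ (0 : ℝ)
    · simpa using hasDerivAt_const τ (0 : ℝ)
  have hβ : ∀ τ ∈ Ioo (-δ) 2, HasDerivAt (fun τ => radialCovector ρ w ![τ, t, u, u'])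
      ![0, -(sdsD' M (ρ τ)⁻¹ / (2 * sdsD M (ρ τ)⁻¹) * (w τ / (R τ * ρ τ ^ 2))
        * (-(τ * ρ τ) / (2 * w τ))) - ρ τ / (2 * w τ), 0, 0] τ := fun τ hτ => by
    rw [hasDerivAt_pi]
    intro b
    fin_cases b
    · exact hasDerivAt_const _ _
    · exact h.deriv_covector hτ
    · exact hasDerivAt_const _ _
    · exact hasDerivAt_const _ _
  refine ⟨fun τ hτ => (h.deriv_curve hτ t u u').differentiableAt,
    fun τ hτ => (hacc τ hτ).differentiableAt, fun τ hτ => (hβ τ hτ).differentiableAt,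
    fun τ hτ => ?_, fun τ hτ => ?_⟩
  · -- the velocity is itself Weyl propagated
    rw [(h.weylPropagated hacc).eqn_v τ hτ]
    module
  · have hρ := h.ρ_pos τ hτ
    have hτ' := h.phys_subset hτ
    have hR := h.R_pos τ hτ'
    have hw := h.w_pos τ hτ'
    have hD := h.sdsD_ne hτ
    have hr : ![t, (ρ τ)⁻¹, u, u'] 1 ≠ 0 := inv_ne_zero hρ.ne'
    have hx : radialCongruence ρ ![τ, t, u, u'] = ![t, (ρ τ)⁻¹, u, u'] := rfl
    have hb : radialCovector ρ w ![τ, t, u, u'] = ![0, -(τ * ρ τ) / (2 * w τ), 0, 0] := rfl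
    have hg : sdsMetric M ![t, (ρ τ)⁻¹, u, u'] =
      Matrix.diagonal (sdsDiag M ![t, (ρ τ)⁻¹, u, u']) := rfl
    have hinv := inv_diagonal_of_ne_zero
      (sdsDiag_ne (M := M) (x := ![t, (ρ τ)⁻¹, u, u']) (inv_ne_zero hρ.ne') hD)
    have h11 : sdsDiag M ![t, (ρ τ)⁻¹, u, u'] 1 = (sdsD M (ρ τ)⁻¹)⁻¹ := rfl
    have hDe := h.sdsD_eq hτ
    have hΘ := h.R_mul_ρ τ hτ'
    funext b
    rw [covDerivCov_radial (inv_ne_zero hρ.ne') hD (hderiv τ hτ), (hβ τ hτ).deriv, hderiv τ hτ, hx,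
      hb]
    simp only [Pi.add_apply, Pi.sub_apply, Pi.smul_apply, smul_eq_mul, schouten_sdsMetric hr hD]
    rw [hg]
    simp only [sharp, flat, hinv, pairing, Fin.sum_univ_four]
    fin_cases b <;> simp [h11, sdsQ]
    rw [hDe]
    generalize sdsD' M (ρ τ)⁻¹ = E0
    field_simp
    linear_combination (-4 * w τ) * hΘ

end RadialProfile

/-! ### Regularity of the unphysical fields -/

theorem isOpen_region {T δ : ℝ} {U : Set (ℝ × ℝ)} (hU : IsOpen U) : IsOpen (region T δ U) := by
  have h0 : Continuous fun p : Pt => p 0 := continuous_apply 0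
  have h1 : Continuous fun p : Pt => |p 1| := (continuous_apply 1).abs
  have h2 : Continuous fun p : Pt => (p 2, p 3) := by fun_prop
  exact (isOpen_lt continuous_const h0).inter ((isOpen_lt h0 continuous_const).inter
    ((isOpen_lt h1 continuous_const).inter (hU.preimage h2)))

theorem ContDiffOn.of_time {f : ℝ → ℝ} {I : Set ℝ} {N : Set Pt} (hf : ContDiffOn ℝ ∞ f I)
    (hN : ∀ p ∈ N, p 0 ∈ I) : ContDiffOn ℝ ∞ (fun p : Pt => f (p 0)) N :=
  hf.comp (contDiff_apply ℝ ℝ (0 : Fin 4)).contDiffOn hN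

namespace RadialProfile

variable {M rc rstar δ : ℝ} {R P ρ w : ℝ → ℝ} (h : RadialProfile M rc rstar δ R P ρ w)

include h

theorem smooth_lapse : ContDiffOn ℝ ∞ (fun τ => R τ * w τ) (Ioo (-δ) (2 + δ)) :=
  h.smooth_R.mul h.smooth_w

theorem smooth_lapseDeriv : ContDiffOn ℝ ∞ (lapseDeriv M P ρ w) (Ioo (-δ) (2 + δ)) :=
  ((h.smooth_P.mul h.smooth_w).add h.smooth_ρ).sub (contDiffOn_const.mul (h.smooth_ρ.pow 2))

theorem smooth_schoutenEig (a : Fin 4) :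
    ContDiffOn ℝ ∞ (fun τ => schoutenEig M R P ρ w τ a) (Ioo (-δ) (2 + δ)) := by
  have hR : ∀ τ ∈ Ioo (-δ) (2 + δ), 2 * R τ ^ 2 ≠ 0 := fun τ hτ => by
    have := h.R_pos τ hτ
    positivity
  have h2 : ContDiffOn ℝ ∞ (fun τ => (1 + P τ ^ 2 - M * ρ τ) / (2 * R τ ^ 2))
      (Ioo (-δ) (2 + δ)) :=
    ((contDiffOn_const.add (h.smooth_P.pow 2)).sub (contDiffOn_const.mul h.smooth_ρ)).div
      (contDiffOn_const.mul (h.smooth_R.pow 2)) hR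
  fin_cases a
  · exact contDiffOn_const
  · exact ((((h.smooth_P.pow 2).sub contDiffOn_const).add (contDiffOn_const.mul h.smooth_ρ)).add
      (((h.smooth_P.mul h.smooth_ρ).mul (contDiffOn_const.sub
        (contDiffOn_const.mul h.smooth_ρ))).div h.smooth_w fun τ hτ => (h.w_pos τ hτ).ne')).div
      (contDiffOn_const.mul (h.smooth_R.pow 2)) hR
  · exact h2
  · exact h2

theorem smooth_weylScale : ContDiffOn ℝ ∞ (fun τ => M / R τ ^ 3) (Ioo (-δ) (2 + δ)) :=
  contDiffOn_const.div (h.smooth_R.pow 3) fun τ hτ => pow_ne_zero 3 (h.R_pos τ hτ).ne'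

variable {N : Set Pt} (hN : ∀ p ∈ N, p 0 ∈ Ioo (-δ) (2 + δ))

include hN

theorem smooth_confMetric (a b : Fin 4) : ContDiffOn ℝ ∞ (fun p => confMetric R w p a b) N := by
  rcases eq_or_ne a b with rfl | hab
  · simp only [confMetric, ksMetric, Matrix.diagonal_apply_eq]
    have h1 := ContDiffOn.of_time (h.smooth_lapse.pow 2) hN
    have h2 := (ContDiffOn.of_time (h.smooth_R.pow 2) hN).mul (contDiff_sphS.contDiffOn (s := N))
    fin_cases a
    exacts [contDiffOn_const, h1, h2, h2]
  · simp only [confMetric, ksMetric, Matrix.diagonal_apply_ne _ hab]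
    exact contDiffOn_const

theorem smooth_confWeyl (c d a b : Fin 4) :
    ContDiffOn ℝ ∞ (fun p => confWeyl M R w p c d a b) N := by
  simp only [confWeyl, planeTensor, Matrix.smul_apply, smul_eq_mul]
  exact ((ContDiffOn.of_time h.smooth_weylScale hN).mul contDiffOn_const).mul
    ((contDiffOn_const.mul (h.smooth_confMetric hN d b)).sub
      (contDiffOn_const.mul (h.smooth_confMetric hN d a)))

theorem christoffel_eq {p : Pt} (hp : p ∈ N) : christoffel (confMetric R w) p =
    diagConn (ksQ (fun τ => R τ * w τ) (lapseDeriv M P ρ w) R P)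
      (ksM (fun τ => R τ * w τ) (lapseDeriv M P ρ w) R P) p :=
  christoffel_ksMetric (h.lapse_ne (hN p hp)) (h.R_pos _ (hN p hp)).ne' (h.deriv_lapse (hN p hp))
    (h.deriv_R _ (hN p hp))

theorem smooth_christoffel (a b c : Fin 4) :
    ContDiffOn ℝ ∞ (fun p => christoffel (confMetric R w) p a b c) N := by
  have h0 : ContDiffOn ℝ ∞ (fun _ : Pt => (0 : ℝ)) N := contDiffOn_const
  have h1 := ContDiffOn.of_time (h.smooth_lapseDeriv.div h.smooth_lapse
    fun τ hτ => h.lapse_ne hτ) hN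
  have h2 := ContDiffOn.of_time (h.smooth_P.div h.smooth_R fun τ hτ => (h.R_pos τ hτ).ne') hN
  have h3 (j : Fin 4) : ContDiffOn ℝ ∞ (fun p => sphLog j p) N := (contDiff_sphLog j).contDiffOn
  have h4 := ContDiffOn.of_time (h.smooth_lapse.mul h.smooth_lapseDeriv).neg hN
  have h5 := (ContDiffOn.of_time (h.smooth_R.mul h.smooth_P).neg hN).mul
    (contDiff_sphS.contDiffOn (s := N))
  have hq (i j : Fin 4) : ContDiffOn ℝ ∞
      (fun p => ksQ (fun τ => R τ * w τ) (lapseDeriv M P ρ w) R P p i j) N := by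
    fin_cases i <;> fin_cases j <;>
      first | exact h0 | exact h1 | exact h2 | exact h3 2 | exact h3 3
  have hm (i j : Fin 4) : ContDiffOn ℝ ∞
      (fun p => ksM (fun τ => R τ * w τ) (lapseDeriv M P ρ w) R P p i j) N := by
    fin_cases i <;> fin_cases j <;>
      first | exact h0 | exact h4 | exact h5 | exact h3 2 | exact h3 3
  refine ContDiffOn.congr (f := fun p => diagConn (ksQ (fun τ => R τ * w τ) (lapseDeriv M P ρ w) R P)
      (ksM (fun τ => R τ * w τ) (lapseDeriv M P ρ w) R P) p a b c) ?_
    fun p hp => by rw [h.christoffel_eq hN hp]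
  unfold diagConn
  refine ((?_ : ContDiffOn ℝ ∞ _ N).add ?_).sub ?_ <;> split_ifs
  exacts [hq _ _, h0, hq _ _, h0, hm _ _, h0]

end RadialProfile

/-! ### The adapted frame -/

/-- A leg tangent to the sphere, rescaled to be of unit length in the unphysical metric. -/
def sphereLeg (R : ℝ → ℝ) (k : ℝ × ℝ → ℝ × ℝ) (p : Pt) : Pt :=
  ![0, 0, (k (p 2, p 3)).1 / R (p 0), (k (p 2, p 3)).2 / R (p 0)]

/-- The frame `∂_τ, s A⁻¹ ∂_t, R⁻¹ k₂, R⁻¹ k₃` with `A = R w`. -/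
def adaptedFrame (R w : ℝ → ℝ) (s : ℝ) (k₂ k₃ : ℝ × ℝ → ℝ × ℝ) : Field2 := fun p =>
  ![Pi.single 0 1, ![0, s / (R (p 0) * w (p 0)), 0, 0], sphereLeg R k₂ p, sphereLeg R k₃ p]

/-- The components of `∇_{e_a} X`. -/
def covAlong (e : Field2) (Γ : Field3) (p : Pt) (a : Fin 4) (X : Pt → Pt) (ν : Fin 4) : ℝ :=
  ∑ μ, e p a μ * (pd μ (fun q => X q ν) p + ∑ l, Γ p μ ν l * X p l)

theorem frameConn_eq_covAlong (e : Field2) (Γ : Field3) (p : Pt) (a b c : Fin 4) :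
    frameConn e Γ p a b c = ∑ ν, coframe e p b ν * covAlong e Γ p a (fun q => e q c) ν := rfl

/-- A function on the sphere is constant along `∂_τ` and `∂_t`. -/
theorem pd_of_sphere {F : ℝ × ℝ → ℝ} {p : Pt} (hF : DifferentiableAt ℝ F (p 2, p 3)) {i : Fin 4}
    (hi : i = 0 ∨ i = 1) : pd i (fun q => F (q 2, q 3)) p = 0 := by
  have hg : HasFDerivAt (fun q : Pt => (q 2, q 3))
      ((ContinuousLinearMap.proj (R := ℝ) (φ := fun _ : Fin 4 => ℝ) 2).prod
        (ContinuousLinearMap.proj (R := ℝ) (φ := fun _ : Fin 4 => ℝ) 3)) p :=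
    (hasFDerivAt_apply 2 p).prodMk (hasFDerivAt_apply 3 p)
  have := (HasFDerivAt.comp (f := fun q : Pt => (q 2, q 3)) p hF.hasFDerivAt hg).fderiv
  rw [pd, show (fun q : Pt => F (q 2, q 3)) = F ∘ fun q : Pt => (q 2, q 3) from rfl, this]
  rcases hi with rfl | rfl <;> simp <;> exact map_zero _

theorem pd_sphereLeg {R : ℝ → ℝ} {R' : ℝ} {k : ℝ × ℝ → ℝ × ℝ} {p : Pt} (hR : R (p 0) ≠ 0)
    (dR : HasDerivAt R R' (p 0)) (hk : DifferentiableAt ℝ k (p 2, p 3)) (ν : Fin 4) :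
    pd 0 (fun q => sphereLeg R k q ν) p = -(R' / R (p 0)) * sphereLeg R k p ν ∧
      pd 1 (fun q => sphereLeg R k q ν) p = 0 := by
  have key {F : ℝ × ℝ → ℝ} (hF : DifferentiableAt ℝ F (p 2, p 3)) :
      pd 0 (fun q => F (q 2, q 3) / R (q 0)) p = -(R' / R (p 0)) * (F (p 2, p 3) / R (p 0)) ∧
      pd 1 (fun q => F (q 2, q 3) / R (q 0)) p = 0 := by
    have h1 : DifferentiableAt ℝ (fun q : Pt => F (q 2, q 3)) p :=
      DifferentiableAt.fun_comp' (g := F) (f := fun q : Pt => (q 2, q 3)) p hF (by fun_prop)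
    have h2 : DifferentiableAt ℝ (fun q : Pt => (R (q 0))⁻¹) p :=
      DifferentiableAt.fun_comp' (g := fun t => (R t)⁻¹) p (dR.fun_inv hR).differentiableAt
        (differentiableAt_coord 0)
    simp only [div_eq_mul_inv]
    rw [pd_mul h1 h2, pd_mul h1 h2, pd_of_sphere hF (Or.inl rfl), pd_of_sphere hF (Or.inr rfl),
      pd_of_coord (dR.fun_inv hR), pd_of_coord (dR.fun_inv hR)]
    constructor
    · simp; field_simp
    · simp
  have hz : pd 0 (fun _ : Pt => (0 : ℝ)) p = -(R' / R (p 0)) * 0 ∧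
      pd 1 (fun _ : Pt => (0 : ℝ)) p = 0 := by
    rw [pd_const, pd_const]; simp
  fin_cases ν
  exacts [hz, hz, key hk.fst, key hk.snd]

namespace RadialProfile

variable {M rc rstar δ T s : ℝ} {R P ρ w : ℝ → ℝ} {U : Set (ℝ × ℝ)} {k₂ k₃ : ℝ × ℝ → ℝ × ℝ}

theorem region_time {p : Pt} (hp : p ∈ region T δ U) : p 0 ∈ Ioo (-δ) (2 + δ) := ⟨hp.1, hp.2.1⟩

theorem adaptedFrame_time (p : Pt) (a : Fin 4) : adaptedFrame R w s k₂ k₃ p a 0 = kron a 0 := by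
  fin_cases a <;> simp [adaptedFrame, sphereLeg, kron]

section

variable (h : RadialProfile M rc rstar δ R P ρ w) {p : Pt} (hp : p ∈ region T δ U)

include h hp

theorem adaptedFrame_orthonormal (hs : s = 1 ∨ s = -1)
    (hk : ∀ y ∈ U, sphereInner y (k₂ y) (k₂ y) = 1 ∧ sphereInner y (k₃ y) (k₃ y) = 1 ∧
      sphereInner y (k₂ y) (k₃ y) = 0) (a b : Fin 4) :
    bil (confMetric R w p) (adaptedFrame R w s k₂ k₃ p a) (adaptedFrame R w s k₂ k₃ p b) =
      eta a b := by
  have hτ := region_time hp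
  have hR := h.R_pos _ hτ
  have hw := h.w_pos _ hτ
  have hs2 : s * s = 1 := by rcases hs with rfl | rfl <;> norm_num
  obtain ⟨h22, h33, h23⟩ := hk _ hp.2.2.2
  simp only [sphereInner] at h22 h33 h23
  change sphS p * _ = 1 at h22
  change sphS p * _ = 1 at h33
  change sphS p * _ = 0 at h23
  have hbil (v w' : Pt) : bil (confMetric R w p) v w' =
      ∑ i, ksDiag (fun τ => R τ * w τ) R p i * v i * w' i := by
    rw [bil]
    refine Finset.sum_congr rfl fun i _ => ?_
    rw [Finset.sum_eq_single i (fun j _ hj => ?_) (by simp)]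
    · rw [confMetric, ksMetric, Matrix.diagonal_apply_eq]
    · rw [confMetric, ksMetric, Matrix.diagonal_apply_ne _ hj.symm, zero_mul, zero_mul]
  rw [hbil, Fin.sum_univ_four]
  fin_cases a <;> fin_cases b <;> simp [ksDiag, adaptedFrame, sphereLeg, eta] <;> field_simp <;>
    (first | linear_combination hs2 | linear_combination h22 | linear_combination h33 |
      linear_combination h23)

theorem covAlong_time (a ν : Fin 4) :
    covAlong (adaptedFrame R w s k₂ k₃) (christoffel (confMetric R w)) p a
      (fun q => adaptedFrame R w s k₂ k₃ q 0) ν =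
      ![0, lapseDeriv M P ρ w (p 0) / (R (p 0) * w (p 0)), P (p 0) / R (p 0), P (p 0) / R (p 0)] a
        * adaptedFrame R w s k₂ k₃ p a ν := by
  have hc (μ : Fin 4) : pd μ (fun q => adaptedFrame R w s k₂ k₃ q 0 ν) p = 0 := by
    simp only [adaptedFrame, Matrix.cons_val_zero, pd_const]
  simp only [covAlong, hc, h.christoffel_eq (N := region T δ U) (fun p hp => region_time hp) hp,
    Fin.sum_univ_four, diagConn]
  fin_cases a <;> fin_cases ν <;> simp [adaptedFrame, sphereLeg, ksQ, ksM] <;> ring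

theorem covAlong_lapse (hs : s = 1 ∨ s = -1) (a ν : Fin 4) :
    covAlong (adaptedFrame R w s k₂ k₃) (christoffel (confMetric R w)) p a
      (fun q => adaptedFrame R w s k₂ k₃ q 1) ν =
      if a = 1 ∧ ν = 0 then lapseDeriv M P ρ w (p 0) / (R (p 0) * w (p 0)) else 0 := by
  have hτ := region_time hp
  have hA := h.lapse_ne hτ
  have hs2 : s ^ 2 = 1 := by rcases hs with rfl | rfl <;> norm_num
  have hd := ((h.deriv_lapse hτ).fun_inv hA).const_mul s
  simp only [← div_eq_mul_inv] at hd
  have hc (μ : Fin 4) : pd μ (fun q => adaptedFrame R w s k₂ k₃ q 1 ν) p =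
      if ν = 1 ∧ μ = 0 then s * (-lapseDeriv M P ρ w (p 0) / (R (p 0) * w (p 0)) ^ 2) else 0 := by
    fin_cases ν
    · exact (pd_const 0 μ).trans (by simp)
    · exact (pd_of_coord hd μ).trans (by simp)
    · exact (pd_const 0 μ).trans (by simp)
    · exact (pd_const 0 μ).trans (by simp)
  simp only [covAlong, hc, h.christoffel_eq (N := region T δ U) (fun p hp => region_time hp) hp,
    Fin.sum_univ_four, diagConn]
  have hR := (h.R_pos _ hτ).ne'
  have hw := (h.w_pos _ hτ).ne'
  fin_cases a <;> fin_cases ν <;> simp [adaptedFrame, sphereLeg, ksQ, ksM] <;>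
    field_simp <;> (first | ring1 | linear_combination lapseDeriv M P ρ w (p 0) * hs2)

/-- The sphere legs are parallel along `∂_τ` and `∂_t`. -/
theorem covAlong_sphereLeg {k : ℝ × ℝ → ℝ × ℝ} (hk : DifferentiableAt ℝ k (p 2, p 3))
    {a : Fin 4} (ha : a = 0 ∨ a = 1) (ν : Fin 4) :
    covAlong (adaptedFrame R w s k₂ k₃) (christoffel (confMetric R w)) p a (sphereLeg R k) ν = 0 := by
  have hτ := region_time hp
  obtain ⟨h0, h1⟩ := pd_sphereLeg (h.R_pos _ hτ).ne' (h.deriv_R _ hτ) hk ν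
  simp only [covAlong, h.christoffel_eq (N := region T δ U) (fun p hp => region_time hp) hp,
    Fin.sum_univ_four, diagConn, h0, h1]
  rcases ha with rfl | rfl <;> fin_cases ν <;> simp [adaptedFrame, sphereLeg, ksQ, ksM]

end

end RadialProfile

/-! ### The connection in the adapted frame -/

namespace RadialProfile

variable {M rc rstar δ T s : ℝ} {R P ρ w : ℝ → ℝ} {U : Set (ℝ × ℝ)} {k₂ k₃ : ℝ × ℝ → ℝ × ℝ}

/-- The expansion rates of the legs of the adapted frame. -/
def frameRate (M : ℝ) (R P ρ w : ℝ → ℝ) (τ : ℝ) : Fin 4 → ℝ :=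
  ![0, lapseDeriv M P ρ w τ / (R τ * w τ), P τ / R τ, P τ / R τ]

/-- The adapted frame does not mix the blocks `{0, 1}` and `{2, 3}`, on which the Schouten
eigenvalues are either distinguished by the frame or degenerate. -/
theorem adaptedFrame_block (p : Pt) (a μ : Fin 4) :
    adaptedFrame R w s k₂ k₃ p a μ = 0 ∨
      (∀ τ, schoutenEig M R P ρ w τ μ = schoutenEig M R P ρ w τ a) ∧
        ∀ ν, weylPattern μ ν = weylPattern a ν ∧ weylPattern ν μ = weylPattern ν a := by
  fin_cases a <;> fin_cases μ <;> first
    | exact Or.inr ⟨fun _ => rfl, fun _ => ⟨rfl, rfl⟩⟩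
    | (refine Or.inr ⟨fun _ => rfl, fun ν => ?_⟩; fin_cases ν <;> exact ⟨rfl, rfl⟩)
    | (left; simp [adaptedFrame, sphereLeg])

section

variable (h : RadialProfile M rc rstar δ R P ρ w) (hU : IsOpen U)
  (hk₂ : ContDiffOn ℝ ∞ k₂ U) (hk₃ : ContDiffOn ℝ ∞ k₃ U)
  (hk : ∀ y ∈ U, sphereInner y (k₂ y) (k₂ y) = 1 ∧ sphereInner y (k₃ y) (k₃ y) = 1 ∧
    sphereInner y (k₂ y) (k₃ y) = 0) (hs : s = 1 ∨ s = -1)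

include h

section

include hk hs

theorem adaptedFrame_matrix {p : Pt} (hp : p ∈ region T δ U) :
    adaptedFrame R w s k₂ k₃ p * confMetric R w p * (adaptedFrame R w s k₂ k₃ p).transpose = eta :=
  mul_mul_transpose_of_bil (h.adaptedFrame_orthonormal hp hs hk)

theorem adaptedFrame_det {p : Pt} (hp : p ∈ region T δ U) :
    (adaptedFrame R w s k₂ k₃ p).det ≠ 0 :=
  frame_det_ne_zero (h.adaptedFrame_matrix hk hs hp)

end

include hk₂ hk₃ in
theorem smooth_adaptedFrame (a μ : Fin 4) :
    ContDiffOn ℝ ∞ (fun p => adaptedFrame R w s k₂ k₃ p a μ) (region T δ U) := by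
  have hN : ∀ p ∈ region T δ U, p 0 ∈ Ioo (-δ) (2 + δ) := fun p hp => region_time hp
  have hp23 : ContDiffOn ℝ ∞ (fun p : Pt => (p 2, p 3)) (region T δ U) :=
    (by fun_prop : ContDiff ℝ ∞ fun p : Pt => (p 2, p 3)).contDiffOn
  have hmaps : MapsTo (fun p : Pt => (p 2, p 3)) (region T δ U) U := fun p hp => hp.2.2.2
  have hR := ContDiffOn.of_time h.smooth_R hN
  have hR0 : ∀ p ∈ region T δ U, R (p 0) ≠ 0 := fun p hp => (h.R_pos _ (hN p hp)).ne'
  have hleg {k : ℝ × ℝ → ℝ × ℝ} (hk : ContDiffOn ℝ ∞ k U) (μ : Fin 4) :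
      ContDiffOn ℝ ∞ (fun p => sphereLeg R k p μ) (region T δ U) := by
    have h1 := (contDiff_fst.comp_contDiffOn (hk.comp hp23 hmaps)).div hR hR0
    have h2 := (contDiff_snd.comp_contDiffOn (hk.comp hp23 hmaps)).div hR hR0
    fin_cases μ
    exacts [contDiffOn_const, contDiffOn_const, h1, h2]
  have h1 := (contDiffOn_const (c := s)).div (ContDiffOn.of_time h.smooth_lapse hN)
    fun p hp => h.lapse_ne (hN p hp)
  fin_cases a
  · exact contDiffOn_const
  · fin_cases μ
    exacts [contDiffOn_const, h1, contDiffOn_const, contDiffOn_const]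
  · exact hleg hk₂ μ
  · exact hleg hk₃ μ

include hk₂ hk₃ hk hs in
theorem smooth_coframe (b μ : Fin 4) :
    ContDiffOn ℝ ∞ (fun p => coframe (adaptedFrame R w s k₂ k₃) p b μ) (region T δ U) := by
  have he := h.smooth_adaptedFrame (T := T) (s := s) hk₂ hk₃
  have hg := h.smooth_confMetric (N := region T δ U) (fun p hp => region_time hp)
  refine ContDiffOn.congr (f := fun p => (eta * adaptedFrame R w s k₂ k₃ p * confMetric R w p) b μ)
    ?_ fun p hp => by
      rw [coframe_eq (by rw [confMetric, ksMetric, Matrix.diagonal_transpose])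
        (h.adaptedFrame_matrix hk hs hp)]
  simp only [Matrix.mul_apply]
  exact ContDiffOn.sum fun i _ => (ContDiffOn.sum fun j _ => contDiffOn_const.mul (he j i)).mul
    (hg i μ)

include hk₂ hk₃ hk hs hU in
/-- The frame connection coefficients are those of `adaptedConn`. Metric compatibility gives the
antisymmetry in the last two indices, the derivatives of `e_0` and `e_1` are explicit, and `e_2`, `e_3`
are parallel along the first two legs; only the rotation of `k₂, k₃` on the sphere is not determined. -/
theorem frameConn_adaptedFrame {p : Pt} (hp : p ∈ region T δ U) :
    ∃ x : Fin 4 → ℝ, (x 0 = 0 ∧ x 1 = 0) ∧ ∀ a b c,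
      frameConn (adaptedFrame R w s k₂ k₃) (christoffel (confMetric R w)) p a b c =
        adaptedConn (frameRate M R P ρ w (p 0)) x a b c := by
  have hN := isOpen_region (T := T) (δ := δ) hU
  have hτ (p : Pt) (hp : p ∈ region T δ U) : p 0 ∈ Ioo (-δ) (2 + δ) := region_time hp
  have hdet := h.adaptedFrame_det (T := T) hk hs hp
  have hkd {k : ℝ × ℝ → ℝ × ℝ} (hk : ContDiffOn ℝ ∞ k U) : DifferentiableAt ℝ k (p 2, p 3) :=
    (hk.contDiffAt (hU.mem_nhds hp.2.2.2)).differentiableAt (by simp)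
  set e := adaptedFrame R w s k₂ k₃ with he
  set γ := frameConn e (christoffel (confMetric R w)) p with hγ
  have hg : DiffM (confMetric R w) p := fun a b =>
    ((h.smooth_confMetric hτ a b).contDiffAt (hN.mem_nhds hp)).differentiableAt (by simp)
  have hanti (a b c : Fin 4) : γ a c b * eta c c + γ a b c * eta b b = 0 := by
    have := frameConn_antisymm hN (h.smooth_adaptedFrame (s := s) hk₂ hk₃) hp
      (fun q hq => h.adaptedFrame_det hk hs hq) hg (christoffel_compat (ksDiag_ne (h.lapse_ne (hτ p hp))
        (h.R_pos _ (hτ p hp)).ne'))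
      (fun q hq => h.adaptedFrame_matrix hk hs hq) a b c
    rw [Finset.sum_add_distrib, Finset.sum_eq_single c, Finset.sum_eq_single b] at this
    · exact this
    · intro j _ hj; rw [eta, Matrix.diagonal_apply_ne _ hj.symm, mul_zero]
    · simp
    · intro j _ hj; rw [eta, Matrix.diagonal_apply_ne _ hj, mul_zero]
    · simp
  have h0 (a b : Fin 4) : γ a b 0 = frameRate M R P ρ w (p 0) a * kron b a := by
    rw [hγ, frameConn_eq_covAlong, ← sum_coframe_mul hdet, Finset.mul_sum]
    refine Finset.sum_congr rfl fun ν _ => ?_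
    rw [h.covAlong_time hp, frameRate]
    ring
  have h1 (a b : Fin 4) : γ a b 1 = if a = 1 then frameRate M R P ρ w (p 0) 1 * kron b 0 else 0 := by
    have hcf : coframe e p b 0 = kron b 0 := by
      rw [← sum_coframe_mul hdet, Fin.sum_univ_four]
      simp [he, adaptedFrame]
    rw [hγ, frameConn_eq_covAlong, ← hcf]
    simp only [he, h.covAlong_lapse hp hs]
    rw [Fin.sum_univ_four]
    by_cases ha : a = 1 <;> simp [ha, frameRate]
    ring
  have h23 (a b c : Fin 4) (ha : a = 0 ∨ a = 1) (hc : c = 2 ∨ c = 3) : γ a b c = 0 := by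
    rw [hγ, frameConn_eq_covAlong]
    refine Finset.sum_eq_zero fun ν _ => ?_
    rcases hc with rfl | rfl
    · exact mul_eq_zero_of_right _ (h.covAlong_sphereLeg hp (hkd hk₂) ha ν)
    · exact mul_eq_zero_of_right _ (h.covAlong_sphereLeg hp (hkd hk₃) ha ν)
  refine ⟨fun a => γ a 2 3, ⟨h23 _ _ _ (Or.inl rfl) (Or.inr rfl),
    h23 _ _ _ (Or.inr rfl) (Or.inr rfl)⟩, fun a b c => ?_⟩
  have a1 := hanti a b c
  have a2 := h0 a b
  have a3 := h0 a c
  have a4 := h1 a b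
  have a5 := h1 a c
  have hr0 : frameRate M R P ρ w (p 0) 0 = 0 := rfl
  clear_value γ
  clear h0 h1 hanti hγ
  fin_cases b <;> fin_cases c <;> fin_cases a <;>
    simp [adaptedConn, kron, eta, hr0] at a1 a2 a3 a4 a5 ⊢ <;> linarith

end

end RadialProfile

/-! ### The solution of the extended conformal field equations -/

theorem weylConnection_zero (g : Field2) : weylConnection g (fun _ _ => 0) = christoffel g := by
  funext x a b c
  simp [weylConnection]

theorem christoffel_symm {g : Field2} (hg : ∀ y, (g y).transpose = g y) (x : Pt) (a b c : Fin 4) :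
    christoffel g x a b c = christoffel g x c b a := by
  have hs (i j : Fin 4) : (fun y => g y i j) = fun y => g y j i := by
    funext y
    exact congrFun (congrFun (hg y) j) i
  rw [christoffel, christoffel]
  congr 1
  refine Finset.sum_congr rfl fun e _ => ?_
  rw [hs a c]
  ring

theorem pd_Theta (p : Pt) (μ : Fin 4) : pd μ Theta p = if μ = 0 then -(p 0 / 2) else 0 := by
  have h : HasDerivAt (fun t : ℝ => 1 - t ^ 2 / 4) (-(p 0 / 2)) (p 0) := by
    refine (((hasDerivAt_pow 2 (p 0)).div_const 4).const_sub 1).congr_deriv ?_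
    push_cast
    ring
  exact pd_of_coord h μ

theorem confMetric_transpose (R w : ℝ → ℝ) (x : Pt) :
    (confMetric R w x).transpose = confMetric R w x := by
  rw [confMetric, ksMetric, Matrix.diagonal_transpose]

namespace RadialProfile

variable {M rc rstar δ T s : ℝ} {R P ρ w : ℝ → ℝ} {U : Set (ℝ × ℝ)} {k₂ k₃ : ℝ × ℝ → ℝ × ℝ}
  (h : RadialProfile M rc rstar δ R P ρ w) (hU : IsOpen U)
  (hk₂ : ContDiffOn ℝ ∞ k₂ U) (hk₃ : ContDiffOn ℝ ∞ k₃ U)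
  (hk : ∀ y ∈ U, sphereInner y (k₂ y) (k₂ y) = 1 ∧ sphereInner y (k₃ y) (k₃ y) = 1 ∧
    sphereInner y (k₂ y) (k₃ y) = 0) (hs : s = 1 ∨ s = -1)

include h hk hs

theorem frame_schouten {p : Pt} (hp : p ∈ region T δ U) (a b : Fin 4) :
    frameTen2 (adaptedFrame R w s k₂ k₃)
      (schouten (confMetric R w) (christoffel (confMetric R w))) p a b =
      schoutenEig M R P ρ w (p 0) a * eta a b := by
  refine frameTen2_of_eigen (h.adaptedFrame_orthonormal hp hs hk)
    (h.schouten_eq (region_time hp) rfl) (fun a μ => ?_) a b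
  rcases adaptedFrame_block (M := M) (P := P) (ρ := ρ) p a μ with h0 | ⟨h1, -⟩
  · rw [h0, zero_mul, zero_mul]
  · rw [h1]

theorem frame_planeTensor {p : Pt} (hp : p ∈ region T δ U) {D : Field4} (c₁ c₂ : ℝ)
    (hD : ∀ c d a b, D p c d a b = planeTensor (fun a b => c₁ * weylPattern a b
      + c₂ * (schoutenEig M R P ρ w (p 0) a + schoutenEig M R P ρ w (p 0) b))
      (confMetric R w p) c d a b) (c d a b : Fin 4) :
    frameTen4 (adaptedFrame R w s k₂ k₃) D p c d a b =
      planeTensor (fun a b => c₁ * weylPattern a b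
        + c₂ * (schoutenEig M R P ρ w (p 0) a + schoutenEig M R P ρ w (p 0) b)) eta c d a b := by
  refine frameTen4_planeTensor (h.adaptedFrame_det hk hs hp)
    (h.adaptedFrame_orthonormal hp hs hk) hD (fun a b μ ν => ?_) c d a b
  rcases adaptedFrame_block (M := M) (P := P) (ρ := ρ) p a μ with h0 | ⟨h1, h2⟩
  · rw [h0]; ring
  rcases adaptedFrame_block (M := M) (P := P) (ρ := ρ) p b ν with h0 | ⟨h3, h4⟩
  · rw [h0]; ring
  · simp only [h1, h3, (h2 ν).1, (h4 a).2]

theorem frame_weyl {p : Pt} (hp : p ∈ region T δ U) (c d a b : Fin 4) :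
    frameTen4 (adaptedFrame R w s k₂ k₃) (confWeyl M R w) p c d a b =
      planeTensor ((M / R (p 0) ^ 3) • weylPattern) eta c d a b := by
  rw [h.frame_planeTensor hk hs hp (M / R (p 0) ^ 3) 0 (fun c d a b => ?_)]
  · simp [planeTensor]
  · simp [planeTensor, confWeyl]

theorem frame_curvature {p : Pt} (hp : p ∈ region T δ U) (c d a b : Fin 4) :
    frameTen4 (adaptedFrame R w s k₂ k₃) (curvature (christoffel (confMetric R w))) p c d a b =
      Theta p * planeTensor ((M / R (p 0) ^ 3) • weylPattern) eta c d a b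
      + planeTensor (fun a b => schoutenEig M R P ρ w (p 0) a + schoutenEig M R P ρ w (p 0) b)
        eta c d a b := by
  rw [h.frame_planeTensor hk hs hp (Theta p * (M / R (p 0) ^ 3)) 1 (fun c d a b => ?_)]
  · simp only [planeTensor, Matrix.smul_apply, smul_eq_mul]
    ring
  · rw [h.curvature_eq_weyl_add_schouten (region_time hp) rfl]
    simp only [planeTensor, Matrix.smul_apply, smul_eq_mul]
    ring

include hU hk₂ hk₃

/-- The frame components of the unphysical fields solve the extended conformal field equations, with
`f = 0`. -/
theorem isXCFESolutionOn :
    IsXCFESolutionOn (region T δ U) (adaptedFrame R w s k₂ k₃)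
      (frameConn (adaptedFrame R w s k₂ k₃) (christoffel (confMetric R w)))
      (frameTen2 (adaptedFrame R w s k₂ k₃)
        (schouten (confMetric R w) (christoffel (confMetric R w))))
      (frameTen4 (adaptedFrame R w s k₂ k₃) (confWeyl M R w)) Theta
      (gaugeCov (adaptedFrame R w s k₂ k₃) Theta fun _ _ => 0) := by
  have hN := isOpen_region (T := T) (δ := δ) hU
  have hτ (p : Pt) (hp : p ∈ region T δ U) : p 0 ∈ Ioo (-δ) (2 + δ) := region_time hp
  have hdet (p : Pt) (hp : p ∈ region T δ U) := h.adaptedFrame_det (T := T) hk hs hp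
  have hrate (τ : ℝ) : frameRate M R P ρ w τ 0 = 0 ∧
    frameRate M R P ρ w τ 3 = frameRate M R P ρ w τ 2 := ⟨rfl, rfl⟩
  have heta : eta = Matrix.diagonal ![-1, 1, 1, 1] := rfl
  have hv : ∀ i : Fin 4, (![-1, 1, 1, 1] : Fin 4 → ℝ) i ≠ 0 := fun i => by
    fin_cases i <;> simp
  constructor
  · exact hdet
  · intro p hp a b c
    obtain ⟨x, -, hγ⟩ := h.frameConn_adaptedFrame hU hk₂ hk₃ hk hs hp
    have htr : traceCov (frameConn (adaptedFrame R w s k₂ k₃) (christoffel (confMetric R w))) p a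
        = 0 := by
      simp only [traceCov, hγ, Fin.sum_univ_four]
      fin_cases a <;> simp [adaptedConn, (hrate _).1]
    have hg : DiffM (confMetric R w) p := fun a b =>
      ((h.smooth_confMetric hτ a b).contDiffAt (hN.mem_nhds hp)).differentiableAt (by simp)
    rw [htr, mul_zero, zero_mul]
    exact frameConn_antisymm hN (h.smooth_adaptedFrame (s := s) hk₂ hk₃) hp hdet hg
      (christoffel_compat (h.diag_ne (hτ p hp) rfl)) (fun q hq => h.adaptedFrame_matrix hk hs hq)
      a b c
  · intro p hp a b μ
    exact zeroTorsion_frameConn (hdet p hp) (christoffel_symm (confMetric_transpose R w) p) a b μ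
  · intro p hp c d a b
    rw [frameCurvature_frameConn hN (h.smooth_adaptedFrame (s := s) hk₂ hk₃)
      (h.smooth_coframe hk₂ hk₃ hk hs) (h.smooth_christoffel hτ) hp hdet
      (fun q _ => christoffel_symm (confMetric_transpose R w) q), h.frame_curvature hk hs hp,
      algCurvature, h.frame_weyl hk hs hp, heta,
      shift_schouten_eq_planeTensor hv (schoutenEig M R P ρ w (p 0))
        (fun a b => by rw [h.frame_schouten hk hs hp, heta])]
    ring
  · intro p hp c d b
    obtain ⟨x, hx, hγ⟩ := h.frameConn_adaptedFrame hU hk₂ hk₃ hk hs hp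
    refine zeroCotton_adapted (l := schoutenEig M R P ρ w) (ψ := M / R (p 0) ^ 3) hN hp
      (adaptedFrame_time p) hγ hx (hrate _) (fun q hq => h.frame_schouten hk hs hq)
      (h.deriv_schoutenEig (hτ p hp)) (h.frame_weyl hk hs hp) (fun a => ?_) ⟨rfl, rfl⟩
      ⟨rfl, rfl, rfl, rfl⟩ c d b
    have hda : dirDeriv (adaptedFrame R w s k₂ k₃) a Theta p = kron a 0 * -(p 0 / 2) := by
      simp [dirDeriv, pd_Theta, adaptedFrame_time]
    simp only [gaugeCov, frameCov, hda, mul_zero, Finset.sum_const_zero, zero_add]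
  · intro p hp b c d
    obtain ⟨x, hx, hγ⟩ := h.frameConn_adaptedFrame hU hk₂ hk₃ hk hs hp
    refine zeroBianchi_adapted (ψ := fun τ => M / R τ ^ 3) hN hp (adaptedFrame_time p) hγ hx
      (hrate _) (fun q hq => h.frame_weyl hk hs hq) ?_ b c d
    have hR := (h.R_pos _ (hτ p hp)).ne'
    refine ((hasDerivAt_const (p 0) M).fun_div ((h.deriv_R _ (hτ p hp)).fun_pow 3)
      (pow_ne_zero 3 hR)).congr_deriv ?_
    simp only [frameRate, Matrix.cons_val]
    field_simp
    push_cast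
    ring

theorem smooth_frameConn (a b c : Fin 4) : ContDiffOn ℝ ∞
    (fun p => frameConn (adaptedFrame R w s k₂ k₃) (christoffel (confMetric R w)) p a b c)
    (region T δ U) :=
  contDiffOn_frameConn (isOpen_region hU) (h.smooth_adaptedFrame hk₂ hk₃)
    (h.smooth_coframe hk₂ hk₃ hk hs) (h.smooth_christoffel fun _ hp => region_time hp) a b c

omit hU hk₂ hk₃

theorem smooth_frameWeyl (a b c d : Fin 4) : ContDiffOn ℝ ∞
    (fun p => frameTen4 (adaptedFrame R w s k₂ k₃) (confWeyl M R w) p a b c d)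
    (region T δ U) := by
  refine ContDiffOn.congr ?_ fun p hp => h.frame_weyl hk hs hp a b c d
  simp only [planeTensor, Matrix.smul_apply, smul_eq_mul]
  exact ((ContDiffOn.of_time h.smooth_weylScale fun p hp => region_time hp).mul
    contDiffOn_const).mul contDiffOn_const

theorem smooth_frameSchouten (a b : Fin 4) : ContDiffOn ℝ ∞
    (fun p => frameTen2 (adaptedFrame R w s k₂ k₃)
      (schouten (confMetric R w) (christoffel (confMetric R w))) p a b) (region T δ U) := by
  refine ContDiffOn.congr ?_ fun p hp => h.frame_schouten hk hs hp a b
  exact (ContDiffOn.of_time (h.smooth_schoutenEig a) fun p hp => region_time hp).mul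
    contDiffOn_const

end RadialProfile

/-! ### The congruence and its frame in Gaussian coordinates -/

namespace RadialProfile

variable {M rc rstar δ T s : ℝ} {R P ρ w : ℝ → ℝ} {U : Set (ℝ × ℝ)} {k₂ k₃ : ℝ × ℝ → ℝ × ℝ}
  (h : RadialProfile M rc rstar δ R P ρ w)

include h

theorem jac_radialCongruence {p : Pt} (hp : p 0 ∈ Ioo (-δ) 2) :
    jac (radialCongruence ρ) p = ![![0, 1, 0, 0], ![w (p 0) / (R (p 0) * ρ (p 0) ^ 2), 0, 0, 0],
      ![0, 0, 1, 0], ![0, 0, 0, 1]] := by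
  have h0 (μ j : Fin 4) : pd μ (fun q => q j) p = if μ = j then 1 else 0 := pd_coord μ j
  ext i μ
  fin_cases i
  · refine (h0 μ 1).trans ?_
    fin_cases μ <;> simp
  · refine (pd_of_coord (h.deriv_radius hp) μ).trans ?_
    fin_cases μ <;> simp
  · refine (h0 μ 2).trans ?_
    fin_cases μ <;> simp
  · refine (h0 μ 3).trans ?_
    fin_cases μ <;> simp

theorem push_radialCongruence {p : Pt} (hp : p 0 ∈ Ioo (-δ) 2) (v : Pt) :
    push (radialCongruence ρ) p v =
      ![v 1, w (p 0) / (R (p 0) * ρ (p 0) ^ 2) * v 0, v 2, v 3] := by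
  ext i
  change ∑ j, jac (radialCongruence ρ) p i j * v j = _
  rw [h.jac_radialCongruence hp, Fin.sum_univ_four]
  fin_cases i <;> simp

theorem Theta_eq {p : Pt} (hp : p 0 ∈ Ioo (-δ) (2 + δ)) : Theta p = R (p 0) * ρ (p 0) :=
  (h.R_mul_ρ _ hp).symm

theorem sqrt_neg_sdsD : √(-sdsD M rstar) = rstar * w 0 := by
  have h0 : (0 : ℝ) ∈ Ioo (-δ) 2 := ⟨by linarith [h.δ_pos], by norm_num⟩
  have hw := h.w_pos 0 (h.phys_subset h0)
  have hR := h.R_pos 0 (h.phys_subset h0)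
  have hD := h.sdsD_eq h0
  rw [h.ρ_zero, inv_inv] at hD
  rw [h.R_zero] at hR
  rw [hD, Real.sqrt_eq_iff_mul_self_eq (by rw [neg_neg]; positivity) (by positivity)]
  field_simp

theorem zero_mem : (0 : ℝ) ∈ Ioo (-δ) 2 := ⟨by linarith [h.δ_pos], by norm_num⟩

theorem smooth_ρ_inv : ContDiffOn ℝ ∞ (fun τ => (ρ τ)⁻¹) (Ioo (-δ) 2) :=
  (h.smooth_ρ.mono fun _ hτ => h.phys_subset hτ).inv fun τ hτ => (h.ρ_pos τ hτ).ne'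

theorem isSdSCongruence :
    IsSdSCongruence M rc rstar T δ (radialCongruence ρ) (radialCovector ρ w) where
  smooth_Ψ := by
    rw [contDiffOn_pi]
    intro i
    have h1 := ContDiffOn.of_time (N := physRegion T δ univ) h.smooth_ρ_inv
      fun p hp => ⟨hp.1.1, hp.2⟩
    have h2 (j : Fin 4) : ContDiffOn ℝ ∞ (fun p : Pt => p j) (physRegion T δ univ) :=
      (contDiff_apply ℝ ℝ j).contDiffOn
    fin_cases i
    exacts [h2 1, h1, h2 2, h2 3]
  smooth_β := by
    rw [contDiffOn_pi]
    intro i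
    have h1 := ContDiffOn.of_time (N := physRegion T δ univ)
      ((contDiffOn_id.mul h.smooth_ρ).neg.div (contDiffOn_const.mul h.smooth_w)
        fun τ hτ => mul_ne_zero two_ne_zero (h.w_pos τ hτ).ne') fun p hp => ⟨hp.1.1, hp.1.2.1⟩
    fin_cases i
    exacts [contDiffOn_const, h1, contDiffOn_const, contDiffOn_const]
  cosmological := fun p hp => h.ρ_lt _ ⟨hp.1.1, hp.2⟩
  geodesic := fun t u v _ => h.isConformalGeodesicOn t u v
  initial_point := fun t u v _ => by simp [radialCongruence, h.ρ_zero]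
  initial_velocity := fun t u v _ => by
    have hR := h.R_pos 0 (h.phys_subset h.zero_mem)
    rw [h.R_zero] at hR
    refine (h.deriv_curve h.zero_mem t u v).deriv.trans ?_
    rw [h.sqrt_neg_sdsD, h.R_zero, h.ρ_zero]
    congr 2
    field_simp
  initial_β := fun t u v _ => by
    ext i
    fin_cases i <;> simp [radialCovector]
  escape := fun t u v _ => by
    have h2 : (2 : ℝ) ∈ Ioo (-δ) (2 + δ) := ⟨by linarith [h.δ_pos], by linarith [h.δ_pos]⟩
    have hρ2 : ρ 2 = 0 := by
      have := h.R_mul_ρ 2 h2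
      rw [show (1 : ℝ) - 2 ^ 2 / 4 = 0 by norm_num] at this
      exact (mul_eq_zero.1 this).resolve_left (h.R_pos 2 h2).ne'
    have hc : Tendsto ρ (𝓝[<] 2) (𝓝[>] 0) := by
      refine tendsto_nhdsWithin_iff.2 ⟨?_, ?_⟩
      -- `r = 1 / ρ` and `ρ` tends to its zero at `τ = 2` through positive values
      · rw [← hρ2]
        exact ((h.deriv_ρ 2 h2).continuousAt).tendsto.mono_left nhdsWithin_le_nhds
      · filter_upwards [Ioo_mem_nhdsLT (show -δ < 2 by linarith [h.δ_pos])] with τ hτ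
          using h.ρ_pos τ hτ
    exact tendsto_inv_nhdsGT_zero.comp hc

theorem isUnphysicalExtension :
    IsUnphysicalExtension M T δ (radialCongruence ρ) (radialCovector ρ w) (confMetric R w)
      fun _ _ => 0 where
  smooth_g := h.smooth_confMetric fun _ hp => region_time hp
  smooth_f := fun _ => contDiffOn_const
  eq_g := fun p hp => by
    have hτ : p 0 ∈ Ioo (-δ) 2 := ⟨hp.1.1, hp.2⟩
    have hρ := h.ρ_pos _ hτ
    have hR := h.R_pos _ (h.phys_subset hτ)
    have hw := h.w_pos _ (h.phys_subset hτ)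
    have hg : sdsMetric M (radialCongruence ρ p) =
      Matrix.diagonal (sdsDiag M (radialCongruence ρ p)) := rfl
    have hS : sphS (radialCongruence ρ p) = sphS p := rfl
    have hD := h.sdsD_eq hτ
    rw [pullMetric, h.Theta_eq (h.phys_subset hτ), hg, confMetric, ksMetric]
    ext i j
    rw [Matrix.smul_apply, Matrix.mul_apply]
    simp only [Matrix.mul_diagonal, Matrix.transpose_apply, Fin.sum_univ_four, smul_eq_mul]
    simp only [h.jac_radialCongruence hτ]
    fin_cases i <;> fin_cases j <;>
      simp [sdsDiag, ksDiag, hS] <;> simp [radialCongruence, hD] <;> field_simp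
  eq_f := fun p hp μ => by
    have hτ : p 0 ∈ Ioo (-δ) 2 := ⟨hp.1.1, hp.2⟩
    have hρ := h.ρ_pos _ hτ
    have hR := h.R_pos _ (h.phys_subset hτ)
    have hw := h.w_pos _ (h.phys_subset hτ)
    rw [h.jac_radialCongruence hτ, pd_Theta, h.Theta_eq (h.phys_subset hτ), Fin.sum_univ_four]
    fin_cases μ <;> simp [radialCovector]
    field_simp
    ring

theorem isRescaledWeyl : IsRescaledWeyl T δ (confMetric R w) (confWeyl M R w) where
  smooth_d := h.smooth_confWeyl fun _ hp => region_time hp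
  eq_d := fun _ hp => h.weylTensor_eq (region_time hp) rfl

/-- The `t` component `s / (R w)` has the rate of Weyl propagation. -/
theorem deriv_inv_lapse {τ : ℝ} (hτ : τ ∈ Ioo (-δ) 2) (s : ℝ) :
    HasDerivAt (fun τ => s / (R τ * w τ)) (τ / (2 * (R τ * ρ τ)) * (s / (R τ * w τ))
      - sdsD' M (ρ τ)⁻¹ / (2 * sdsD M (ρ τ)⁻¹) * (w τ / (R τ * ρ τ ^ 2)) * (s / (R τ * w τ))) τ := by
  have hτ' := h.phys_subset hτ
  have hρ := h.ρ_pos τ hτ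
  have hR := h.R_pos τ hτ'
  have hw := h.w_pos τ hτ'
  have hsq := h.w_sq τ hτ'
  have hτ2 : τ / (2 * (R τ * ρ τ)) = (w τ - P τ * ρ τ) / (R τ * ρ τ) := by
    rw [div_eq_div_iff (by positivity) (by positivity)]
    linear_combination (-2) * (R τ * ρ τ) * h.w_eq τ hτ'
  refine ((hasDerivAt_const τ s).fun_div (h.deriv_lapse hτ') (h.lapse_ne hτ')).congr_deriv ?_
  -- after clearing denominators only `w² = 1 - ρ² + M ρ³` remains
  rw [hτ2, h.sdsD_eq hτ, sdsD', lapseDeriv]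
  generalize R τ = R0 at *
  generalize P τ = P0 at *
  generalize ρ τ = y at *
  generalize w τ = W at *
  field_simp
  linear_combination (-2) * s * hsq

/-- The sphere components `c / R` have the rate of Weyl propagation. -/
theorem deriv_inv_radius {τ : ℝ} (hτ : τ ∈ Ioo (-δ) 2) (c : ℝ) :
    HasDerivAt (fun τ => c / R τ) (τ / (2 * (R τ * ρ τ)) * (c / R τ)
      - ((ρ τ)⁻¹)⁻¹ * (w τ / (R τ * ρ τ ^ 2)) * (c / R τ)) τ := by
  have hτ' := h.phys_subset hτ
  have hρ := h.ρ_pos τ hτ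
  have hR := h.R_pos τ hτ'
  have hτ2 : τ / (2 * (R τ * ρ τ)) = (w τ - P τ * ρ τ) / (R τ * ρ τ) := by
    rw [div_eq_div_iff (by positivity) (by positivity)]
    linear_combination (-2) * (R τ * ρ τ) * h.w_eq τ hτ'
  refine ((hasDerivAt_const τ c).fun_div (h.deriv_R τ hτ') hR.ne').congr_deriv ?_
  rw [hτ2]
  field_simp
  ring

theorem isWeylFrame (hk₂ : ContDiffOn ℝ ∞ k₂ U) (hk₃ : ContDiffOn ℝ ∞ k₃ U)
    (hk : ∀ y ∈ U, sphereInner y (k₂ y) (k₂ y) = 1 ∧ sphereInner y (k₃ y) (k₃ y) = 1 ∧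
      sphereInner y (k₂ y) (k₃ y) = 0) (hs : s = 1 ∨ s = -1) :
    IsWeylFrame M rstar T δ U (radialCongruence ρ) (radialCovector ρ w) (confMetric R w) s k₂ k₃
      (adaptedFrame R w s k₂ k₃) where
  smooth_e := h.smooth_adaptedFrame hk₂ hk₃
  orthonormal := fun p hp => h.adaptedFrame_orthonormal hp hs hk
  time_leg := fun _ _ => rfl
  propagated := fun a t u v _ _ => by
    have hpush (τ : ℝ) (hτ : τ ∈ Ioo (-δ) 2) (X : Pt) :
        push (radialCongruence ρ) ![τ, t, u, v] X =
          ![X 1, w τ / (R τ * ρ τ ^ 2) * X 0, X 2, X 3] := h.push_radialCongruence hτ X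
    refine h.weylPropagated fun τ hτ => ?_
    have hev : (fun τ => push (radialCongruence ρ) ![τ, t, u, v]
        (adaptedFrame R w s k₂ k₃ ![τ, t, u, v] a)) =ᶠ[𝓝 τ] fun τ =>
        ![adaptedFrame R w s k₂ k₃ ![τ, t, u, v] a 1,
          w τ / (R τ * ρ τ ^ 2) * adaptedFrame R w s k₂ k₃ ![τ, t, u, v] a 0,
          adaptedFrame R w s k₂ k₃ ![τ, t, u, v] a 2,
          adaptedFrame R w s k₂ k₃ ![τ, t, u, v] a 3] := by
      filter_upwards [isOpen_Ioo.mem_nhds hτ] with σ hσ using hpush σ hσ _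
    refine HasDerivAt.congr_of_eventuallyEq ?_ hev
    rw [hpush τ hτ, hasDerivAt_pi]
    have hlapse := h.deriv_inv_lapse hτ s
    have hrad (c : ℝ) := inv_inv (ρ τ) ▸ h.deriv_inv_radius hτ c
    have hvel := h.deriv_velocity hτ
    have hzero := hasDerivAt_const τ (0 : ℝ)
    intro b
    fin_cases a <;> fin_cases b <;>
      simp [adaptedFrame, sphereLeg, sdsQ]
    exacts [hzero, hvel, hzero, hzero, hlapse, hzero, hzero, hzero, hzero, hzero, hrad _, hrad _,
      hzero, hzero, hrad _, hrad _]
  initial_e1 := fun t u v _ _ => by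
    rw [h.push_radialCongruence h.zero_mem, h.sqrt_neg_sdsD]
    ext i
    fin_cases i <;> simp [adaptedFrame, h.R_zero]
  initial_e2 := fun t u v _ _ => by
    rw [h.push_radialCongruence h.zero_mem]
    ext i
    fin_cases i <;> simp [adaptedFrame, sphereLeg, h.R_zero]
  initial_e3 := fun t u v _ _ => by
    rw [h.push_radialCongruence h.zero_mem]
    ext i
    fin_cases i <;> simp [adaptedFrame, sphereLeg, h.R_zero]

end RadialProfile

end ConformalSdS

end

theorem proposition4 (M rc rstar T : ℝ) (hM : 0 < M) (hM' : M < 2 / (3 * √3))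
    (hrc : IsGreatest {r : ℝ | 0 < r ∧ ConformalSdS.sdsD M r = 0} rc)
    (hrstar : rc < rstar) (hT : 0 < T) :
    ∃ (δ : ℝ) (Ψ β : ConformalSdS.Pt → ConformalSdS.Pt) (g : ConformalSdS.Field2)
      (f : ConformalSdS.Pt → ConformalSdS.Pt) (d : ConformalSdS.Field4),
      0 < δ ∧
      ConformalSdS.IsSdSCongruence M rc rstar T δ Ψ β ∧
      ConformalSdS.IsUnphysicalExtension M T δ Ψ β g f ∧
      ConformalSdS.IsRescaledWeyl T δ g d ∧
      ∀ (U : Set (ℝ × ℝ)) (k₂ k₃ : ℝ × ℝ → ℝ × ℝ) (s : ℝ),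
        IsOpen U → ContDiffOn ℝ ∞ k₂ U → ContDiffOn ℝ ∞ k₃ U →
        (∀ y ∈ U, ConformalSdS.sphereInner y (k₂ y) (k₂ y) = 1 ∧
          ConformalSdS.sphereInner y (k₃ y) (k₃ y) = 1 ∧
          ConformalSdS.sphereInner y (k₂ y) (k₃ y) = 0) →
        (s = 1 ∨ s = -1) →
        ∃ e : ConformalSdS.Field2,
          ConformalSdS.IsWeylFrame M rstar T δ U Ψ β g s k₂ k₃ e ∧
          (∀ a b c, ContDiffOn ℝ ∞
            (fun p => ConformalSdS.frameConn e (ConformalSdS.weylConnection g f) p a b c)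
            (ConformalSdS.region T δ U)) ∧
          (∀ a b c h, ContDiffOn ℝ ∞
            (fun p => ConformalSdS.frameTen4 e d p a b c h)
            (ConformalSdS.region T δ U)) ∧
          (∀ a b, ContDiffOn ℝ ∞
            (fun p => ConformalSdS.frameTen2 e
              (ConformalSdS.schouten g (ConformalSdS.weylConnection g f)) p a b)
            (ConformalSdS.region T δ U)) ∧
          ConformalSdS.IsXCFESolutionOn (ConformalSdS.region T δ U) e
            (ConformalSdS.frameConn e (ConformalSdS.weylConnection g f))
            (ConformalSdS.frameTen2 e
              (ConformalSdS.schouten g (ConformalSdS.weylConnection g f)))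
            (ConformalSdS.frameTen4 e d)
            ConformalSdS.Theta
            (ConformalSdS.gaugeCov e ConformalSdS.Theta f) := by
  -- `M < 1` suffices: that `D` has a positive zero is part of `hrc`
  have hM1 : M < 1 := by
    refine hM'.trans_le ?_
    have h3 : (1 : ℝ) ≤ √3 := Real.one_le_sqrt.2 (by norm_num)
    rw [div_le_one (by positivity)]
    linarith
  obtain ⟨δ, R, P, ρ, w, h⟩ := ConformalSdS.exists_radialProfile hM hM1 hrc hrstar
  refine ⟨δ, ConformalSdS.radialCongruence ρ, ConformalSdS.radialCovector ρ w,
    ConformalSdS.confMetric R w, fun _ _ => 0, ConformalSdS.confWeyl M R w, h.δ_pos,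
    h.isSdSCongruence, h.isUnphysicalExtension, h.isRescaledWeyl,
    fun U k₂ k₃ s hU hk₂ hk₃ hk hs => ?_⟩
  rw [ConformalSdS.weylConnection_zero]
  exact ⟨ConformalSdS.adaptedFrame R w s k₂ k₃, h.isWeylFrame hk₂ hk₃ hk hs,
    h.smooth_frameConn hU hk₂ hk₃ hk hs, h.smooth_frameWeyl hk hs, h.smooth_frameSchouten hk hs,
    h.isXCFESolutionOn hU hk₂ hk₃ hk hs⟩
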